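/- Let $0\le k<d$ and $m\ge 1$ be integers. Let $A(d,k)$ be the space of $k$-flats ($k$-dimensional affine subspaces) of $\mathbb R^d$ and $G(d,k)$ the space of $k$-dimensional linear subspaces, both with the Borel $\sigma$-field of the Fell topology on closed sets. Let $\mathbb Q$ be a probability measure on $G(d,k)$ and $$\lambda(\cdot)=\int_{G(d,k)}\int_{E^\perp}\mathbf 1\{E+x\in\cdot\}\,\mathcal H^{d-k}(dx)\,\mathbb Q(dE),$$ and let $\eta_1$ be a Poisson process on $A(d,k)$ with intensity measure $\lambda$, i.e. a stationary Poisson process of $k$-flats with intensity $1$ and directional distribution $\mathbb Q$. Write $\eta_1^{(m)}$ for its $m$-th factorial measure (integration with respect to it is summation over $m$-tuples of pairwise distinct flats of $\eta_1$). Let $\mathcal C_0^d$ be a measurable family of compact subsets of $\mathbb R^d$ (measurable for the Borel $\sigma$-field of the Fell topology) with $\emptyset\in\mathcal C^d_0$ and $rB\cap E\in\mathcal C^d_0$ for all $B\in\mathcal C^d_0$, $r>0$ and all affine subspaces $E\subset\mathbb R^d$. Let $\psi:\mathcal C_0^d\to\mathbb R$ be measurable with $\psi(\emptyset)=0$ and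 $$\int|\psi(B\cap E_1\cap\dots\cap E_m)|^3\,\lambda^m(d(E_1,\dots,E_m))<\infty\qquad\text{for all }B\in\mathcal C_0^d,$$ and suppose that $\psi$ is homogeneous of degree $\alpha\in\mathbb R$: $\psi(rB)=r^\alpha\psi(B)$ for all $B\in\mathcal C^d_0$ and $r>0$. For $B\in\mathcal C_0^d$ and $r>0$ put $$\zeta_1(B)=\frac1{m!}\int\psi(B\cap E_1\cap\dots\cap E_m)\,\eta_1^{(m)}(d(E_1,\dots,E_m)),\qquad \tilde\zeta_r(B)=r^{-(m-1/2)(d-k)-\alpha}\big(\zeta_1(rB)-\mathbb E\zeta_1(rB)\big).$$ Let $\xi=\{\xi(B):B\in\mathcal C^d_0\}$ be a centred Gaussian field with covariance function $$C(A,B)=\frac1{((m-1)!)^2}\int\Big(\int\psi(A\cap E_1\cap E_2\cap\dots\cap E_m)\,\lambda^{m-1}(d(E_2,\dots,E_m))\Big)\Big(\int\psi(B\cap E_1\cap E_2'\cap\dots\cap E_m')\,\lambda^{m-1}(d(E_2',\dots,E_m'))\Big)\lambda(dE_1),$$ where for $m=1$ the inner integrals are read as $\psi(A\cap E_1)$ and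 $\psi(B\cap E_1)$. For $\ell$-dimensional random vectors $X,Y$ with finite second moments let $d_3(X,Y)=\sup_g|\mathbb E g(X)-\mathbb E g(Y)|$, the supremum being over all $g\in C^3(\mathbb R^\ell)$ all of whose partial derivatives of order two and three are bounded by $1$ in absolute value. Then for every $B\in\mathcal C^d_0$ the integral defining $\zeta_1(B)$ converges absolutely almost surely and $\zeta_1(B)$ is square integrable. For all $\ell\ge1$ and $B_1,\dots,B_\ell\in\mathcal C_0^d$ there is a constant $c(B_1,\dots,B_\ell)$ with $$d_3\big((\tilde\zeta_r(B_1),\dots,\tilde\zeta_r(B_\ell)),(\xi(B_1),\dots,\xi(B_\ell))\big)\le c(B_1,\dots,B_\ell)\,r^{-(d-k)/2},\qquad r\ge1.$$ In particular $\{\tilde\zeta_r(B):B\in\mathcal C^d_0\}$ converges to $\{\xi(B):B\in\mathcal C_0^d\}$ as $r\to\infty$ in the sense of convergence in distribution of all finite-dimensional distributions. -/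

import Mathlib

open MeasureTheory ProbabilityTheory Filter TopologicalSpace
open scoped ENNReal NNReal Topology Nat

noncomputable section

namespace PoissonFlats

/-! ### Point processes -/

section PointProcess

variable {X : Type*} [MeasurableSpace X]

/-- `η` is a Poisson process on `X` with intensity measure `Λ`: a random element of the space of
`σ`-finite measures with values in `{0, 1, 2, …, ∞}` (measurable for the `σ`-field generated by the
evaluations `μ ↦ μ B`) whose values on a measurable set `B` are Poisson distributed with parameter
`Λ B` (and a.s. infinite if `Λ B = ∞`) and independent on disjoint sets. -/
structure IsPoissonProcess {Ω : Type*} [MeasurableSpace Ω] (η : Ω → Measure X) (Λ : Measure X)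
    (P : Measure Ω) : Prop where
  measurable : Measurable η
  sigmaFinite : ∀ ω, SigmaFinite (η ω)
  integer_valued : ∀ ω B, MeasurableSet B → ∃ n : ℕ∞, η ω B = (n : ℝ≥0∞)
  map_eval : ∀ B, MeasurableSet B → Λ B ≠ ∞ →
    P.map (fun ω => η ω B) = (poissonMeasure (Λ B).toNNReal).map (fun n : ℕ => (n : ℝ≥0∞))
  eval_eq_top : ∀ B, MeasurableSet B → Λ B = ∞ → ∀ᵐ ω ∂P, η ω B = ∞
  indep : ∀ (n : ℕ) (B : Fin n → Set X), (∀ i, MeasurableSet (B i)) →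
    Pairwise (fun i j => Disjoint (B i) (B j)) → iIndepFun (fun i ω => η ω (B i)) P

/-- The factorial measure `μ^{(m)}` on `X^m`, that is the iterated integral
`∫ … ∫ 1{(x₁, …, x_m) ∈ ·} (μ - δ_{x₁} - … - δ_{x_{m-1}})(dx_m) … (μ - δ_{x₁})(dx₂) μ(dx₁)`.
For `μ = ∑ δ_{x_i}` integration with respect to `μ^{(m)}` is summation over all `m`-tuples of
points with distinct indices. -/
def factorialMeasure : (m : ℕ) → Measure X → Measure (Fin m → X)
  | 0, _ => Measure.dirac Fin.elim0
  | m + 1, μ => μ.bind fun x =>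
      (factorialMeasure m (μ - Measure.dirac x)).map fun y => (Fin.cons x y : Fin (m + 1) → X)

end PointProcess

/-! ### Flats and compact sets -/

/-- The Euclidean space `ℝ^d`. -/
abbrev Euc (d : ℕ) : Type := EuclideanSpace ℝ (Fin d)

/-- The Fell topology on the closed subsets of a topological space, generated by the sets
`{F | F ∩ K = ∅}`, `K` compact, and `{F | F ∩ G ≠ ∅}`, `G` open. -/
@[reducible] def fellTopology (Y : Type*) [TopologicalSpace Y] : TopologicalSpace (Closeds Y) :=
  TopologicalSpace.generateFrom
    ({S | ∃ K : Set Y, IsCompact K ∧ S = {F : Closeds Y | (F : Set Y) ∩ K = ∅}} ∪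
      {S | ∃ G : Set Y, IsOpen G ∧ S = {F : Closeds Y | ((F : Set Y) ∩ G).Nonempty}})

/-- The Borel `σ`-field of the Fell topology on the closed subsets. -/
@[reducible] def fellBorel (Y : Type*) [TopologicalSpace Y] : MeasurableSpace (Closeds Y) :=
  @borel (Closeds Y) (fellTopology Y)

/-- The system of all compact subsets of `ℝ^d` carries the Borel `σ`-field induced by the Fell
topology. -/
instance (d : ℕ) : MeasurableSpace (Compacts (Euc d)) :=
  (fellBorel (Euc d)).comap fun B => ⟨(B : Set (Euc d)), B.isCompact.isClosed⟩

/-- The space `A(d,k)` of all `k`-flats (`k`-dimensional affine subspaces) of `ℝ^d`. -/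
def Flat (d k : ℕ) : Type :=
  {E : AffineSubspace ℝ (Euc d) //
    (E : Set (Euc d)).Nonempty ∧ Module.finrank ℝ E.direction = k}

/-- The space `G(d,k)` of all `k`-dimensional linear subspaces of `ℝ^d`. -/
def Grass (d k : ℕ) : Type :=
  {L : Submodule ℝ (Euc d) // Module.finrank ℝ L = k}

/-- A flat as a closed set. -/
def Flat.toCloseds {d k : ℕ} (E : Flat d k) : Closeds (Euc d) :=
  ⟨(E.1 : Set (Euc d)), E.1.closed_of_finiteDimensional⟩

/-- A linear subspace as a closed set. -/
def Grass.toCloseds {d k : ℕ} (L : Grass d k) : Closeds (Euc d) :=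
  ⟨(L.1 : Set (Euc d)), L.1.closed_of_finiteDimensional⟩

instance (d k : ℕ) : MeasurableSpace (Flat d k) :=
  (fellBorel (Euc d)).comap Flat.toCloseds

instance (d k : ℕ) : MeasurableSpace (Grass d k) :=
  (fellBorel (Euc d)).comap Grass.toCloseds

/-- The translate `L + x` of a linear subspace. -/
def Grass.translate {d k : ℕ} (L : Grass d k) (x : Euc d) : Flat d k :=
  ⟨AffineSubspace.mk' x L.1, AffineSubspace.mk'_nonempty x L.1, by
    rw [AffineSubspace.direction_mk']; exact L.2⟩

/-- The measure `t ∫_{G(d,k)} ∫_{L^⊥} 1{L + x ∈ ·} H^{d-k}(dx) Q(dL)` on `A(d,k)`, the intensity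
measure of a stationary Poisson process of `k`-flats with intensity `t` and directional distribution
`Q`. The volume of the inner product space `L^⊥` is its Lebesgue measure, which is the
`(d-k)`-dimensional Hausdorff measure on `L^⊥` in the usual normalization. -/
def flatIntensity {d k : ℕ} (t : ℝ≥0) (Q : Measure (Grass d k)) : Measure (Flat d k) :=
  t • Q.bind fun L =>
    (volume : Measure L.1ᗮ).map fun x : L.1ᗮ => L.translate (x : Euc d)

/-- The dilate `rB`. -/
def dilate {d : ℕ} (r : ℝ) (B : Compacts (Euc d)) : Compacts (Euc d) :=
  B.map (fun x => r • x) (continuous_const_smul r)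

/-- The intersection `B ∩ E` of a compact set with an affine subspace. -/
def interAffine {d : ℕ} (B : Compacts (Euc d)) (E : AffineSubspace ℝ (Euc d)) :
    Compacts (Euc d) :=
  ⟨(B : Set (Euc d)) ∩ (E : Set (Euc d)), B.isCompact.inter_right E.closed_of_finiteDimensional⟩

/-- The intersection `B ∩ E₁ ∩ … ∩ E_n`. -/
def interFlats {d k n : ℕ} (B : Compacts (Euc d)) (E : Fin n → Flat d k) : Compacts (Euc d) :=
  ⟨(B : Set (Euc d)) ∩ ⋂ i, ((E i).1 : Set (Euc d)),
    B.isCompact.inter_right (isClosed_iInter fun i => (E i).1.closed_of_finiteDimensional)⟩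

/-- A measurable family of compact sets that contains `∅` and contains `rB ∩ E` whenever it
contains `B`, for all `r > 0` and all affine subspaces `E`. -/
structure IsWindowFamily {d : ℕ} (C₀ : Set (Compacts (Euc d))) : Prop where
  measurableSet : MeasurableSet C₀
  empty_mem : (⊥ : Compacts (Euc d)) ∈ C₀
  interAffine_mem : ∀ B ∈ C₀, ∀ r : ℝ, 0 < r → ∀ E : AffineSubspace ℝ (Euc d),
    interAffine (dilate r B) E ∈ C₀

/-! ### The random fields -/

/-- The functional `(1/m!) ∫ ψ(B ∩ E₁ ∩ … ∩ E_m) μ^{(m)}(d(E₁, …, E_m))`. -/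
def zeta {d k : ℕ} (m : ℕ) (ψ : Compacts (Euc d) → ℝ) (μ : Measure (Flat d k))
    (B : Compacts (Euc d)) : ℝ :=
  1 / (m ! : ℝ) * ∫ E, ψ (interFlats B E) ∂(factorialMeasure m μ)

/-- The covariance function `C(A, B)` of the limit field; for `m = 1` the inner integrals are
`ψ(A ∩ E₁)` and `ψ(B ∩ E₁)`. -/
def covFun {d k : ℕ} (m : ℕ) (ψ : Compacts (Euc d) → ℝ) (Λ : Measure (Flat d k))
    (A B : Compacts (Euc d)) : ℝ :=
  1 / ((m - 1)! : ℝ) ^ 2 *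
    ∫ E₁,
      (∫ E : Fin (m - 1) → Flat d k, ψ (interFlats A (Fin.cons E₁ E : Fin (m - 1 + 1) → Flat d k))
        ∂(Measure.pi fun _ => Λ)) *
      (∫ E : Fin (m - 1) → Flat d k, ψ (interFlats B (Fin.cons E₁ E : Fin (m - 1 + 1) → Flat d k))
        ∂(Measure.pi fun _ => Λ)) ∂Λ

/-- `ξ` is a centred Gaussian field on the index set `T` with covariance function `C`. -/
structure IsCentredGaussianField {T Ω : Type*} [MeasurableSpace Ω] (ξ : T → Ω → ℝ)
    (C : T → T → ℝ) (P : Measure Ω) : Prop where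
  gaussian : IsGaussianProcess ξ P
  integral_eq_zero : ∀ A, ∫ ω, ξ A ω ∂P = 0
  covariance_eq : ∀ A B, cov[ξ A, ξ B; P] = C A B

/-! ### The distance `d₃` -/

/-- The test functions of the distance `d₃`: functions in `C³(ℝ^ℓ)` all of whose partial
derivatives of orders two and three are bounded by one in absolute value. -/
def testFunctions (l : ℕ) : Set ((Fin l → ℝ) → ℝ) :=
  {g | ContDiff ℝ 3 g ∧
    (∀ (i₁ i₂ : Fin l) (x : Fin l → ℝ),
      |iteratedFDeriv ℝ 2 g x ![Pi.single i₁ 1, Pi.single i₂ 1]| ≤ 1) ∧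
    (∀ (i₁ i₂ i₃ : Fin l) (x : Fin l → ℝ),
      |iteratedFDeriv ℝ 3 g x ![Pi.single i₁ 1, Pi.single i₂ 1, Pi.single i₃ 1]| ≤ 1)}

/-- The distance `d₃(X, Y) = sup_g |E g(X) - E g(Y)|` between two `ℓ`-dimensional random vectors
(with finite second moments, so that all these expectations exist). -/
def dist3 {l : ℕ} {Ω Ω' : Type*} [MeasurableSpace Ω] [MeasurableSpace Ω']
    (X : Ω → Fin l → ℝ) (P : Measure Ω) (Y : Ω' → Fin l → ℝ) (P' : Measure Ω') : ℝ≥0∞ :=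
  ⨆ g ∈ testFunctions l, ENNReal.ofReal |∫ ω, g (X ω) ∂P - ∫ ω, g (Y ω) ∂P'|

/-- The normalized field `r^{-(m-1/2)(d-k)-α} (ζ(rB) - E ζ(rB))` of the process `η`. -/
def zetaTilde {d k : ℕ} {Ω : Type*} [MeasurableSpace Ω] (m : ℕ) (α : ℝ)
    (ψ : Compacts (Euc d) → ℝ) (η : Ω → Measure (Flat d k)) (P : Measure Ω) (r : ℝ)
    (B : Compacts (Euc d)) (ω : Ω) : ℝ :=
  r ^ (-((m : ℝ) - 1 / 2) * ((d : ℝ) - (k : ℝ)) - α) *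
    (zeta m ψ (η ω) (dilate r B) - ∫ ω', zeta m ψ (η ω') (dilate r B) ∂P)

end PoissonFlats

end

open PoissonFlats

/-!
The theorem is a quantitative central limit theorem for factorial sums of a finite Poisson
process of high intensity, and the reduction to that situation is a matter of scaling.

*Scaling.* The intensity measure of the flats is homogeneous of degree `d - k` under dilations
(`map_scale_flatIntensity`) and gives finite mass to the flats that hit a bounded set
(`flatIntensity_hitting_lt_top`).  Together with the homogeneity of `ψ` this shows that
`ζ₁(r B)` is almost surely `r ^ α / m!` times the factorial sum of
`(E₁, …, E_m) ↦ ψ (B ∩ E₁ ∩ … ∩ E_m)` over a Poisson process with finite intensity measure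
`t • Λ`, where `t = r ^ (d - k)` and `Λ` is the intensity measure restricted to the flats that hit
a fixed compact window (`ae_zeta_dilate`, `factorialMeasure_restrict`,
`isFinitePoisson_windowed`).

*First-order expansion.* A centred factorial sum is the sum of its linear part, a compensated
Poisson integral of the one-point projection of the kernel, and a remainder.  The Mecke equation
(`mecke`, `integral_pointSum_mul_of_memLp`) expresses covariances by the effect of adding one
point; adding a point to the remainder produces a centred factorial sum of lower order, so that
each of two applications (`exists_abs_integral_pointSum_mul_centred_le`) gains a factor `1 / t`.
After normalization by `t ^ (m - 1/2)` the remainder is centred with second moment of order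
`1 / t` (`exists_integral_remainder_sq_le`), and it changes the expectation of a test function
with bounded second derivatives only by `O(t ^ (-1/2))` (`abs_integral_add_sub_le`).

*Linear part.* A compensated Poisson integral of intensity `t • Λ` has the law of a sum of
`n = ⌈t⌉₊` independent copies of one with intensity in `[1/2, 1]` (`map_compensated_eq_convPow`),
and a centred Gaussian vector splits in the same way.  Replacing the summands one by one, with
matching first and second moments and bounded third moments, is Lindeberg's argument
(`abs_integral_sub_le_of_moments`, `abs_integral_convPow_sub_le`) and gives the rate
`t ^ (-1/2) = r ^ (-(d - k) / 2)` (`exists_abs_integral_compensated_sub_le`).  The two parts are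
combined in `exists_abs_integral_pointSum_sub_le` and `exists_abs_integral_zetaTilde_sub_le`.

*Convergence in distribution.* Multiples of the real and imaginary parts of characters are
admissible test functions for `d₃`, so that characteristic functions converge and Lévy's
continuity theorem applies (`tendstoInDistribution_of_testFunctions`).
-/

namespace PoissonFlats

noncomputable section

/-! ### Point measures -/

section PointMeasure

variable {X : Type*} [MeasurableSpace X]

/-- The counting measure `∑ δ_x` of a finite list of points. -/
def listMeasure (l : List X) : Measure X := (l.map Measure.dirac).sum

@[simp] lemma listMeasure_nil : listMeasure ([] : List X) = 0 := rfl

@[simp] lemma listMeasure_cons (x : X) (l : List X) :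
    listMeasure (x :: l) = Measure.dirac x + listMeasure l := rfl

instance isFiniteMeasure_listMeasure (l : List X) : IsFiniteMeasure (listMeasure l) := by
  induction l with
  | nil => rw [listMeasure_nil]; infer_instance
  | cons x l ih => rw [listMeasure_cons]; infer_instance

/-- A measure with values in `{0, 1, 2, …, ∞}`. -/
def IsIntegerValued (μ : Measure X) : Prop :=
  ∀ B, MeasurableSet B → ∃ n : ℕ∞, μ B = (n : ℝ≥0∞)

lemma IsIntegerValued.one_le {μ : Measure X} (hμ : IsIntegerValued μ) {B : Set X}
    (hB : MeasurableSet B) (h : μ B ≠ 0) : 1 ≤ μ B := by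
  obtain ⟨n, hn⟩ := hμ B hB
  rw [hn] at h ⊢
  have h0 : n ≠ 0 := by rintro rfl; exact h (by simp)
  exact_mod_cast Order.one_le_iff_ne_zero.2 h0

lemma IsIntegerValued.restrict {μ : Measure X} (hμ : IsIntegerValued μ) {W : Set X}
    (hW : MeasurableSet W) : IsIntegerValued (μ.restrict W) := fun B hB => by
  rw [Measure.restrict_apply hB]; exact hμ _ (hB.inter hW)

lemma dirac_le_of_one_le {μ : Measure X} [MeasurableSingletonClass X] {x : X}
    (h : 1 ≤ μ {x}) : Measure.dirac x ≤ μ := by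
  refine Measure.le_iff.2 fun s _ => ?_
  by_cases hx : x ∈ s
  · calc Measure.dirac x s ≤ 1 := prob_le_one
      _ ≤ μ {x} := h
      _ ≤ μ s := measure_mono (Set.singleton_subset_iff.2 hx)
  · rw [Measure.dirac_apply, Set.indicator_of_notMem hx]; exact zero_le

lemma IsIntegerValued.sub_dirac {μ : Measure X} (hμ : IsIntegerValued μ) {x : X}
    (h : Measure.dirac x ≤ μ) : IsIntegerValued (μ - Measure.dirac x) := fun B hB => by
  rw [Measure.sub_apply hB h]
  obtain ⟨n, hn⟩ := hμ B hB
  rw [hn, Measure.dirac_apply' _ hB]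
  by_cases hx : x ∈ B
  · rw [Set.indicator_of_mem hx]
    refine ⟨n - 1, ?_⟩
    simp
  · rw [Set.indicator_of_notMem hx]
    exact ⟨n, by simp⟩

/-- A nonzero finite integer-valued measure has an atom: halving the space along a countable
separating family, one can always keep a half of mass at least one. -/
lemma IsIntegerValued.exists_one_le_singleton [MeasurableSpace.CountablySeparated X]
    {μ : Measure X} [IsFiniteMeasure μ] (hμ : IsIntegerValued μ) (h0 : μ Set.univ ≠ 0) :
    ∃ x, 1 ≤ μ {x} := by
  classical
  obtain ⟨S, hS, hsep⟩ := exists_seq_separating X (p := MeasurableSet) MeasurableSet.empty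
    (Set.univ : Set X)
  let A : ℕ → Set X := fun n => Nat.rec Set.univ
    (fun n A => if μ (A ∩ S n) ≠ 0 then A ∩ S n else A \ S n) n
  have A_succ : ∀ n, A (n + 1) = if μ (A n ∩ S n) ≠ 0 then A n ∩ S n else A n \ S n :=
    fun n => rfl
  have hA : ∀ n, MeasurableSet (A n) ∧ μ (A n) ≠ 0 := by
    intro n
    induction n with
    | zero => exact ⟨MeasurableSet.univ, h0⟩
    | succ n ih =>
      rw [A_succ]
      split_ifs with h
      · exact ⟨ih.1.inter (hS n), h⟩
      · refine ⟨ih.1.diff (hS n), fun h' => ih.2 ?_⟩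
        rw [← measure_inter_add_sdiff (A n) (hS n), h', not_not.1 h, add_zero]
  have hanti : Antitone A := antitone_nat_of_succ_le fun n => by
    rw [A_succ]
    split_ifs
    · exact Set.inter_subset_left
    · exact Set.sdiff_subset
  have hinf : 1 ≤ μ (⋂ n, A n) := by
    rw [hanti.measure_iInter (fun n => (hA n).1.nullMeasurableSet) ⟨0, measure_ne_top _ _⟩]
    exact le_iInf fun n => hμ.one_le (hA n).1 (hA n).2
  obtain ⟨x, hx⟩ : (⋂ n, A n).Nonempty := by
    by_contra h
    rw [Set.not_nonempty_iff_eq_empty] at h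
    simp [h] at hinf
  refine ⟨x, hinf.trans (measure_mono fun y hy => ?_)⟩
  refine hsep y trivial x trivial fun n => ?_
  have hx' := Set.mem_iInter.1 hx (n + 1)
  have hy' := Set.mem_iInter.1 hy (n + 1)
  rw [A_succ] at hx' hy'
  split_ifs at hx' hy' with h
  · exact iff_of_true hy'.2 hx'.2
  · exact iff_of_false hy'.2 hx'.2

/-- A finite integer-valued measure is the counting measure of a finite list of points. -/
lemma IsIntegerValued.exists_listMeasure [MeasurableSpace.CountablySeparated X]
    [MeasurableSingletonClass X]
    {μ : Measure X} [IsFiniteMeasure μ] (hμ : IsIntegerValued μ) : ∃ l, μ = listMeasure l := by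
  obtain ⟨n, hn⟩ : ∃ n : ℕ, μ Set.univ = n := by
    obtain ⟨n, hn⟩ := hμ _ MeasurableSet.univ
    have : n ≠ ⊤ := by rintro rfl; exact measure_ne_top μ Set.univ (by simp [hn])
    lift n to ℕ using this
    exact ⟨n, by simpa using hn⟩
  induction n generalizing μ with
  | zero => exact ⟨[], by simpa using hn⟩
  | succ n ih =>
    obtain ⟨x, hx⟩ := hμ.exists_one_le_singleton (by rw [hn]; simp)
    have hle := dirac_le_of_one_le hx
    obtain ⟨l, hl⟩ := ih (hμ.sub_dirac hle) (by
      rw [Measure.sub_apply MeasurableSet.univ hle, hn]; simp)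
    refine ⟨x :: l, ?_⟩
    rw [listMeasure_cons, ← hl, add_comm, Measure.sub_add_cancel_of_le hle]

lemma listMeasure_singleton_of_mem {l : List X} {x : X} (hx : x ∈ l) : 1 ≤ listMeasure l {x} := by
  induction l with
  | nil => simp at hx
  | cons y l ih =>
    rw [listMeasure_cons, Measure.add_apply]
    rcases List.mem_cons.1 hx with rfl | h
    · refine le_add_right ?_
      simp
    · exact le_add_left (ih h)

lemma listMeasure_perm {l l' : List X} (h : l.Perm l') : listMeasure l = listMeasure l' :=
  (h.map _).sum_eq

lemma listMeasure_eraseIdx (l : List X) (i : Fin l.length) :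
    Measure.dirac (l.get i) + listMeasure (l.eraseIdx i) = listMeasure l := by
  rw [← listMeasure_cons]
  exact listMeasure_perm (List.getElem_cons_eraseIdx_perm i.2)

lemma ae_listMeasure_mem [MeasurableSingletonClass X] (l : List X) :
    ∀ᵐ x ∂listMeasure l, x ∈ l := by
  induction l with
  | nil => simp
  | cons y l ih =>
    rw [listMeasure_cons, ae_add_measure_iff]
    exact ⟨by rw [ae_dirac_eq]; simp, ih.mono fun x hx => List.mem_cons_of_mem _ hx⟩

lemma lintegral_listMeasure [MeasurableSingletonClass X] (l : List X) (f : X → ℝ≥0∞) :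
    ∫⁻ x, f x ∂listMeasure l = ∑ i : Fin l.length, f (l.get i) := by
  induction l with
  | nil => simp
  | cons y l ih =>
    rw [listMeasure_cons, lintegral_add_measure, lintegral_dirac, ih]
    exact (Fin.sum_univ_succ (fun i : Fin (l.length + 1) => f ((y :: l).get i))).symm

lemma integrable_listMeasure [MeasurableSingletonClass X] {E : Type*} [NormedAddCommGroup E]
    (l : List X) (f : X → E) :
    Integrable f (listMeasure l) := by
  induction l with
  | nil => simp
  | cons y l ih =>
    rw [listMeasure_cons]
    exact Integrable.add_measure (integrable_dirac (by simp)) ih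

lemma integral_listMeasure [MeasurableSingletonClass X] {E : Type*} [NormedAddCommGroup E]
    [NormedSpace ℝ E] [CompleteSpace E] (l : List X) (f : X → E) :
    ∫ x, f x ∂listMeasure l = ∑ i : Fin l.length, f (l.get i) := by
  induction l with
  | nil => simp
  | cons y l ih =>
    rw [listMeasure_cons, integral_add_measure (integrable_dirac (by simp))
      (integrable_listMeasure _ _), integral_dirac, ih]
    exact (Fin.sum_univ_succ (fun i : Fin (l.length + 1) => f ((y :: l).get i))).symm

/-- A `σ`-finite integer-valued measure is concentrated on a countable set. -/
lemma IsIntegerValued.exists_countable [MeasurableSpace.CountablySeparated X]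
    [MeasurableSingletonClass X] {μ : Measure X} [SigmaFinite μ] (hμ : IsIntegerValued μ) :
    ∃ S : Set X, S.Countable ∧ μ Sᶜ = 0 := by
  have h : ∀ n, ∃ l, μ.restrict (spanningSets μ n) = listMeasure l := fun n => by
    have : IsFiniteMeasure (μ.restrict (spanningSets μ n)) :=
      ⟨by simpa using measure_spanningSets_lt_top μ n⟩
    exact (hμ.restrict (measurableSet_spanningSets μ n)).exists_listMeasure
  choose l hl using h
  have hc : (⋃ n, {x | x ∈ l n}).Countable :=
    Set.countable_iUnion fun n => (List.finite_toSet (l n)).countable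
  refine ⟨_, hc, ?_⟩
  have : ∀ᵐ x ∂μ.restrict (⋃ n, spanningSets μ n), x ∈ ⋃ n, {x | x ∈ l n} := by
    rw [ae_restrict_iUnion_iff]
    intro n
    rw [hl n]
    exact (ae_listMeasure_mem _).mono fun x hx => Set.mem_iUnion.2 ⟨n, hx⟩
  rw [iUnion_spanningSets, Measure.restrict_univ] at this
  exact this

lemma aemeasurable_of_countable [MeasurableSingletonClass X] {Y : Type*} [MeasurableSpace Y]
    [Nonempty Y] {μ : Measure X} {S : Set X} (hS : S.Countable) (hμ : μ Sᶜ = 0) (f : X → Y) :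
    AEMeasurable f μ := by
  classical
  obtain ⟨c⟩ := ‹Nonempty Y›
  refine ⟨S.piecewise f fun _ => c, fun A _ => ?_, ?_⟩
  · rw [Set.piecewise_preimage, Set.ite]
    refine (hS.mono Set.inter_subset_right).measurableSet.union ?_
    exact (measurable_const ‹_›).diff hS.measurableSet
  · filter_upwards [compl_mem_ae_iff.2 hμ] with x hx
    rw [Set.piecewise_eq_of_mem _ _ _ (by simpa using hx)]

/-- The factorial measure of the point configuration given by a list. -/
def factorialList : (m : ℕ) → List X → Measure (Fin m → X)
  | 0, _ => Measure.dirac Fin.elim0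
  | m + 1, l => ∑ i : Fin l.length,
      (factorialList m (l.eraseIdx i)).map fun y => (Fin.cons (l.get i) y : Fin (m + 1) → X)

lemma measurable_finCons {m : ℕ} :
    Measurable fun p : X × (Fin m → X) => (Fin.cons p.1 p.2 : Fin (m + 1) → X) := by
  refine measurable_pi_lambda _ fun i => ?_
  refine Fin.cases ?_ (fun j => ?_) i
  · simpa using measurable_fst
  · simp only [Fin.cons_succ]
    exact (measurable_pi_apply j).comp measurable_snd

lemma measurable_finCons_right {m : ℕ} (x : X) :
    Measurable fun y : Fin m → X => (Fin.cons x y : Fin (m + 1) → X) :=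
  measurable_finCons.comp (measurable_const.prodMk measurable_id)

lemma listMeasure_eq_of_sub_dirac {μ : Measure X} [MeasurableSingletonClass X]
    {l : List X} {W : Set X} (hW : MeasurableSet W)
    (hl : μ.restrict W = listMeasure l) (i : Fin l.length) :
    (μ - Measure.dirac (l.get i)).restrict W = listMeasure (l.eraseIdx i) ∧
      Measure.dirac (l.get i) ≤ μ ∧ l.get i ∈ W := by
  classical
  have hi : 1 ≤ listMeasure l {l.get i} := listMeasure_singleton_of_mem (List.get_mem l i)
  rw [← hl, Measure.restrict_apply (measurableSet_singleton _)] at hi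
  have hmem : l.get i ∈ W := by
    by_contra h
    rw [Set.singleton_inter_eq_empty.2 h] at hi
    simp at hi
  have hle : Measure.dirac (l.get i) ≤ μ :=
    dirac_le_of_one_le (hi.trans (measure_mono Set.inter_subset_left))
  refine ⟨?_, hle, hmem⟩
  rw [Measure.restrict_sub_eq_restrict_sub_restrict hW, hl, restrict_dirac, if_pos hmem,
    ← listMeasure_eraseIdx l i, add_comm, Measure.add_sub_cancel]

/-- On `W^m` the factorial measure of `μ` is the factorial measure of the finitely many points
of `μ` in `W`. -/
lemma factorialMeasure_restrict [MeasurableSpace.CountablySeparated X]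
    [MeasurableSingletonClass X] {W : Set X} (hW : MeasurableSet W) (m : ℕ) :
    ∀ (μ : Measure X) [SigmaFinite μ] (_ : IsIntegerValued μ) (l : List X)
      (_ : μ.restrict W = listMeasure l),
      (factorialMeasure m μ).restrict (Set.univ.pi fun _ => W) = factorialList m l := by
  induction m with
  | zero =>
    intro μ _ hμ l hl
    simp only [factorialMeasure, factorialList]
    have : (Set.univ.pi fun _ : Fin 0 => W) = Set.univ := by ext; simp
    rw [this, Measure.restrict_univ]
  | succ m ih =>
    intro μ _ hμ l hl
    have hWm : MeasurableSet (Set.univ.pi fun _ : Fin (m + 1) => W) :=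
      MeasurableSet.univ_pi fun _ => hW
    obtain ⟨S, hSc, hS⟩ := hμ.exists_countable
    simp only [factorialMeasure, factorialList]
    set κ : X → Measure (Fin (m + 1) → X) := fun x =>
      (factorialMeasure m (μ - Measure.dirac x)).map
        fun y => (Fin.cons x y : Fin (m + 1) → X) with hκ
    -- `κ` need not be measurable, but `μ` is concentrated on countably many points
    have hae : AEMeasurable κ μ := aemeasurable_of_countable hSc hS κ
    have hpre : ∀ x : X, (fun y : Fin m → X => (Fin.cons x y : Fin (m + 1) → X)) ⁻¹'
        (Set.univ.pi fun _ => W) = {y | x ∈ W ∧ y ∈ Set.univ.pi fun _ : Fin m => W} := by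
      intro x
      ext y
      simp [Set.mem_pi, Fin.forall_fin_succ]
    ext A hA
    rw [Measure.restrict_apply hA, Measure.bind_apply (hA.inter hWm) hae]
    have hind : ∀ x, κ x (A ∩ Set.univ.pi fun _ => W) =
        W.indicator (fun x => κ x (A ∩ Set.univ.pi fun _ => W)) x := by
      intro x
      by_cases hx : x ∈ W
      · rw [Set.indicator_of_mem hx]
      · rw [Set.indicator_of_notMem hx, hκ, Measure.map_apply (measurable_finCons_right x)
          (hA.inter hWm), Set.preimage_inter, hpre]
        simp [hx]
    rw [lintegral_congr hind, lintegral_indicator hW, hl, lintegral_listMeasure,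
      Measure.finsetSum_apply]
    refine Finset.sum_congr rfl fun i _ => ?_
    obtain ⟨h1, h2, h3⟩ := listMeasure_eq_of_sub_dirac hW hl i
    have : SigmaFinite (μ - Measure.dirac (l.get i)) :=
      ⟨⟨⟨spanningSets μ, fun _ => trivial,
        fun n => (Measure.sub_le _).trans_lt (measure_spanningSets_lt_top μ n),
        iUnion_spanningSets μ⟩⟩⟩
    rw [← ih _ (hμ.sub_dirac h2) _ h1, hκ, Measure.map_apply (measurable_finCons_right _)
      (hA.inter hWm), Measure.map_apply (measurable_finCons_right _) hA, Measure.restrict_apply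
      (measurable_finCons_right _ hA), Set.preimage_inter, hpre]
    simp only [h3, true_and]
    rfl

end PointMeasure

/-! ### Symmetric kernels and their sums over point configurations -/

section Kernels

universe u

variable {X : Type u}

/-- The section `f(x, ·)` of a function of `m + 1` variables. -/
def sect {m : ℕ} (f : (Fin (m + 1) → X) → ℝ) (x : X) : (Fin m → X) → ℝ :=
  fun y => f (Fin.cons x y)

/-- Symmetry of a function of `m` variables, in recursive form: the first two variables may be
exchanged, and the same holds for all sections. -/
def IsSymm : (m : ℕ) → ((Fin m → X) → ℝ) → Prop
  | 0, _ => True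
  | 1, _ => True
  | m + 2, f => (∀ x, IsSymm (m + 1) (sect f x)) ∧ ∀ x y, sect (sect f x) y = sect (sect f y) x

lemma IsSymm.sect {m : ℕ} {f : (Fin (m + 1) → X) → ℝ} (hf : IsSymm (m + 1) f) (x : X) :
    IsSymm m (sect f x) := by
  cases m with
  | zero => trivial
  | succ m => exact hf.1 x

lemma IsSymm.comp {m : ℕ} {f : (Fin m → X) → ℝ} (hf : IsSymm m f) (u : ℝ → ℝ) :
    IsSymm m fun x => u (f x) := by
  induction m with
  | zero => trivial
  | succ m ih =>
    cases m with
    | zero => trivial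
    | succ m =>
      refine ⟨fun x => ih (hf.1 x), fun x y => ?_⟩
      have h := hf.2 x y
      funext z
      exact congrArg u (congrFun h z)

/-- The sum of a symmetric function `f` of `m` variables over all `m`-tuples of points with
distinct indices in a list. The recursion splits off the tuples that contain the head of the
list. -/
def tupleSum : (m : ℕ) → ((Fin m → X) → ℝ) → List X → ℝ
  | 0, f, _ => f Fin.elim0
  | _ + 1, _, [] => 0
  | m + 1, f, x :: l => tupleSum (m + 1) f l + (m + 1) * tupleSum m (sect f x) l

@[simp] lemma tupleSum_zero (f : (Fin 0 → X) → ℝ) (l : List X) :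
    tupleSum 0 f l = f Fin.elim0 := by
  unfold tupleSum; rfl

@[simp] lemma tupleSum_nil {m : ℕ} (f : (Fin (m + 1) → X) → ℝ) :
    tupleSum (m + 1) f [] = 0 := by
  unfold tupleSum; rfl

lemma tupleSum_cons {m : ℕ} (f : (Fin (m + 1) → X) → ℝ) (x : X) (l : List X) :
    tupleSum (m + 1) f (x :: l) =
      tupleSum (m + 1) f l + (m + 1) * tupleSum m (sect f x) l := by
  rw [tupleSum]

/-- Splitting a tuple sum according to the first point of the tuple. -/
lemma tupleSum_eq_sum {m : ℕ} {f : (Fin (m + 1) → X) → ℝ} (hf : IsSymm (m + 1) f) (l : List X) :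
    tupleSum (m + 1) f l =
      ∑ i : Fin l.length, tupleSum m (sect f (l.get i)) (l.eraseIdx i) := by
  induction l generalizing m with
  | nil => simp
  | cons x l ih =>
    rw [tupleSum_cons]
    have hs : ∑ i : Fin (x :: l).length,
        tupleSum m (sect f ((x :: l).get i)) ((x :: l).eraseIdx i) =
        tupleSum m (sect f x) l +
          ∑ i : Fin l.length, tupleSum m (sect f (l.get i)) (x :: l.eraseIdx i) :=
      Fin.sum_univ_succ (fun i : Fin (l.length + 1) =>
        tupleSum m (sect f ((x :: l).get i)) ((x :: l).eraseIdx i))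
    rw [hs]
    cases m with
    | zero =>
      rw [ih hf]
      simp only [tupleSum_zero]
      push_cast
      ring
    | succ m =>
      simp only [tupleSum_cons, Finset.sum_add_distrib, ← Finset.mul_sum]
      rw [ih hf, ih (hf.sect x)]
      have h2 : ∀ i : Fin l.length, sect (sect f (l.get i)) x = sect (sect f x) (l.get i) :=
        fun i => hf.2 _ _
      simp only [h2]
      push_cast
      ring

lemma abs_tupleSum_le {m : ℕ} (f : (Fin m → X) → ℝ) (l : List X) :
    |tupleSum m f l| ≤ tupleSum m (fun x => |f x|) l := by
  induction l generalizing m with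
  | nil => cases m <;> simp
  | cons x l ih =>
    cases m with
    | zero => simp
    | succ m =>
      rw [tupleSum_cons, tupleSum_cons]
      refine (abs_add_le _ _).trans (add_le_add (ih _) ?_)
      rw [abs_mul, abs_of_nonneg (by positivity : (0 : ℝ) ≤ (m : ℝ) + 1)]
      exact mul_le_mul_of_nonneg_left (ih _) (by positivity)

lemma tupleSum_nonneg {m : ℕ} {f : (Fin m → X) → ℝ} (hf : ∀ x, 0 ≤ f x) (l : List X) :
    0 ≤ tupleSum m f l := by
  have h := abs_tupleSum_le f l
  rw [show (fun x => |f x|) = f from funext fun x => abs_of_nonneg (hf x)] at h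
  exact (abs_nonneg _).trans h

lemma tupleSum_one (f : (Fin 1 → X) → ℝ) (l : List X) :
    tupleSum 1 f l = (l.map fun x => f (Fin.cons x Fin.elim0)).sum := by
  induction l with
  | nil => simp
  | cons x l ih =>
    rw [tupleSum_cons, ih]
    simp [sect, add_comm]

variable [MeasurableSpace X]

lemma measurable_sect {m : ℕ} {f : (Fin (m + 1) → X) → ℝ} (hf : Measurable f) (x : X) :
    Measurable (sect f x) :=
  hf.comp (measurable_finCons_right x)

lemma integrable_factorialList (m : ℕ) {f : (Fin m → X) → ℝ} (hf : Measurable f) (l : List X) :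
    Integrable f (factorialList m l) := by
  induction m generalizing l with
  | zero => exact (integrable_dirac' hf.stronglyMeasurable (by simp))
  | succ m ih =>
    refine integrable_finsetSum_measure.2 fun i _ => ?_
    rw [integrable_map_measure hf.aestronglyMeasurable (measurable_finCons_right _).aemeasurable]
    exact ih (measurable_sect hf _) _

lemma integral_factorialList {m : ℕ} {f : (Fin m → X) → ℝ} (hf : Measurable f)
    (hs : IsSymm m f) (l : List X) : ∫ x, f x ∂factorialList m l = tupleSum m f l := by
  induction m generalizing l with
  | zero => rw [factorialList, integral_dirac' _ _ hf.stronglyMeasurable, tupleSum_zero]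
  | succ m ih =>
    have hI : ∀ i : Fin l.length, Integrable f ((factorialList m (l.eraseIdx i)).map
        fun y => (Fin.cons (l.get i) y : Fin (m + 1) → X)) := fun i => by
      rw [integrable_map_measure hf.aestronglyMeasurable
        (measurable_finCons_right _).aemeasurable]
      exact integrable_factorialList m (measurable_sect hf _) _
    rw [factorialList, integral_finsetSum_measure fun i _ => hI i, tupleSum_eq_sum hs]
    refine Finset.sum_congr rfl fun i _ => ?_
    rw [integral_map (measurable_finCons_right _).aemeasurable hf.aestronglyMeasurable]
    exact ih (measurable_sect hf _) (hs.sect _) _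

/-- A version of `tupleSum` on measures instead of lists which is visibly measurable: formally
the integral of `f` with respect to the factorial measure of `μ - δ_{y_1} - … - δ_{y_j}`, where
the integrals with respect to this difference are written as differences of integrals. -/
def measureTupleSum : (m : ℕ) → ((Fin m → X) → ℝ) → (j : ℕ) → (Fin j → X) → Measure X → ℝ
  | 0, f, _, _, _ => f Fin.elim0
  | m + 1, f, j, y, μ =>
      ∫ x, measureTupleSum m (sect f x) (j + 1) (Fin.cons x y) μ ∂μ -
        ∑ i, measureTupleSum m (sect f (y i)) (j + 1) (Fin.cons (y i) y) μ

lemma measureTupleSum_eq [MeasurableSingletonClass X] {m : ℕ} {f : (Fin m → X) → ℝ}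
    (hf : IsSymm m f) (l : List X) {j : ℕ} (y : Fin j → X) {μ : Measure X}
    (hμ : μ = listMeasure (l ++ List.ofFn y)) : measureTupleSum m f j y μ = tupleSum m f l := by
  induction m generalizing l j with
  | zero => rw [measureTupleSum, tupleSum_zero]
  | succ m ih =>
    have hint : ∀ (g : X → ℝ) (l : List X), ∫ x, g x ∂listMeasure l = (l.map g).sum := by
      intro g l
      rw [integral_listMeasure]
      induction l with
      | nil => simp
      | cons x l ih =>
        rw [List.map_cons, List.sum_cons, ← ih]
        exact Fin.sum_univ_succ fun i : Fin (l.length + 1) => g ((x :: l).get i)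
    rw [measureTupleSum]
    conv_lhs => enter [1, 1]; rw [hμ]
    rw [hint, List.map_append, List.sum_append, List.map_ofFn, List.sum_ofFn]
    simp only [Function.comp]
    rw [add_sub_cancel_right, ← hint, integral_listMeasure, tupleSum_eq_sum hf]
    refine Finset.sum_congr rfl fun i _ => ih (hf.sect _) _ _ ?_
    rw [hμ]
    refine listMeasure_perm ?_
    rw [List.ofFn_cons]
    refine List.Perm.trans ?_ List.perm_middle.symm
    exact (List.getElem_cons_eraseIdx_perm i.2).symm.append_right _

lemma measurable_measureTupleSum {Z : Type u} [MeasurableSpace Z] (κ : Kernel Z X)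
    [IsSFiniteKernel κ] {m : ℕ} {f : Z → (Fin m → X) → ℝ} (hf : Measurable (Function.uncurry f))
    {j : ℕ} {y : Z → Fin j → X} (hy : Measurable y) :
    Measurable fun z => measureTupleSum m (f z) j (y z) (κ z) := by
  induction m generalizing Z j with
  | zero => exact hf.comp (measurable_id.prodMk measurable_const)
  | succ m ih =>
    refine Measurable.sub ?_ (Finset.measurable_sum _ fun i _ => ?_)
    · have h := ih (Z := Z × X) (κ.comap Prod.fst measurable_fst)
        (f := fun z => sect (f z.1) z.2) (y := fun z => Fin.cons z.2 (y z.1))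
        (hf.comp ((measurable_fst.comp measurable_fst).prodMk
          (measurable_finCons.comp ((measurable_snd.comp measurable_fst).prodMk measurable_snd))))
        (measurable_finCons.comp (measurable_snd.prodMk (hy.comp measurable_fst)))
      exact (StronglyMeasurable.integral_kernel_prod_right' (κ := κ)
        h.stronglyMeasurable).measurable
    · have hyi : Measurable fun z => y z i := (measurable_pi_apply i).comp hy
      exact ih κ (f := fun z => sect (f z) (y z i)) (y := fun z => Fin.cons (y z i) (y z))
        (hf.comp (measurable_fst.prodMk
          (measurable_finCons.comp ((hyi.comp measurable_fst).prodMk measurable_snd))))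
        (measurable_finCons.comp (hyi.prodMk hy))

/-- The measures of mass in `[n, n + 1)`, as a finite kernel. -/
def massKernel (n : ℕ) : Kernel (Measure X) X where
  toFun μ := open Classical in if μ Set.univ ∈ Set.Ico (n : ℝ≥0∞) (n + 1) then μ else 0
  measurable' := Measurable.ite
    (Measure.measurable_coe MeasurableSet.univ measurableSet_Ico) measurable_id measurable_const

instance (n : ℕ) : IsFiniteKernel (massKernel (X := X) n) :=
  ⟨n + 1, by simp, fun μ => by
    simp only [massKernel, Kernel.coe_mk]
    split_ifs with h
    · exact h.2.le
    · simp⟩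

/-- The identity on finite measures, as an s-finite kernel. -/
def idKernel : Kernel (Measure X) X := Kernel.sum massKernel

instance : IsSFiniteKernel (idKernel (X := X)) := by
  unfold idKernel; infer_instance

lemma idKernel_apply (μ : Measure X) [IsFiniteMeasure μ] : idKernel μ = μ := by
  rw [idKernel, Kernel.sum_apply]
  obtain ⟨n, hn⟩ : ∃ n : ℕ, μ Set.univ ∈ Set.Ico (n : ℝ≥0∞) (n + 1) := by
    have hfin := measure_ne_top μ Set.univ
    refine ⟨⌊(μ Set.univ).toReal⌋₊, ?_, ?_⟩
    · rw [← ENNReal.ofReal_natCast, ← ENNReal.ofReal_toReal hfin]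
      exact ENNReal.ofReal_le_ofReal (by
        rw [ENNReal.toReal_ofReal ENNReal.toReal_nonneg]; exact Nat.floor_le ENNReal.toReal_nonneg)
    · have := Nat.lt_floor_add_one (μ Set.univ).toReal
      rw [← ENNReal.ofReal_toReal hfin, ← ENNReal.ofReal_natCast, ← ENNReal.ofReal_one,
        ← ENNReal.ofReal_add (by positivity) (by positivity),
        ENNReal.ofReal_lt_ofReal_iff (by positivity)]
      rwa [ENNReal.toReal_ofReal ENNReal.toReal_nonneg]
  ext s hs
  rw [Measure.sum_apply _ hs, tsum_eq_single n]
  · simp [massKernel, hn.1, hn.2]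
  · intro k hk
    have : ¬ (μ Set.univ ∈ Set.Ico (k : ℝ≥0∞) (k + 1)) := by
      rintro ⟨h1, h2⟩
      apply hk
      have a : (k : ℝ≥0∞) < n + 1 := h1.trans_lt hn.2
      have b : (n : ℝ≥0∞) < k + 1 := hn.1.trans_lt h2
      have a' : k < n + 1 := by exact_mod_cast a
      have b' : n < k + 1 := by exact_mod_cast b
      omega
    simp only [massKernel, Kernel.coe_mk, if_neg this]
    simp

end Kernels

/-! ### Finite Poisson processes and the Mecke equation -/

section Mecke

universe u

variable {X : Type u} [MeasurableSpace X] {Ω : Type*} [MeasurableSpace Ω]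

/-- A Poisson process with finite intensity measure, normalized to be a finite measure
everywhere and not only almost surely. -/
structure IsFinitePoisson (η : Ω → Measure X) (Λ : Measure X) (P : Measure Ω) : Prop where
  measurable : Measurable η
  finite : ∀ ω, IsFiniteMeasure (η ω)
  integer_valued : ∀ ω, IsIntegerValued (η ω)
  map_eval : ∀ B, MeasurableSet B →
    P.map (fun ω => η ω B) = (poissonMeasure (Λ B).toNNReal).map (fun n : ℕ => (n : ℝ≥0∞))
  indep : ∀ (n : ℕ) (B : Fin n → Set X), (∀ i, MeasurableSet (B i)) →
    Pairwise (fun i j => Disjoint (B i) (B j)) → iIndepFun (fun i ω => η ω (B i)) P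

lemma measurable_eval {η : Ω → Measure X} (hη : Measurable η) {B : Set X}
    (hB : MeasurableSet B) : Measurable fun ω => η ω B :=
  (Measure.measurable_coe hB).comp hη

/-- The Poisson distribution on `[0, ∞]`. -/
def poissonENN (r : ℝ≥0) : Measure ℝ≥0∞ := (poissonMeasure r).map fun n : ℕ => (n : ℝ≥0∞)

instance (r : ℝ≥0) : IsProbabilityMeasure (poissonENN r) :=
  Measure.isProbabilityMeasure_map (by fun_prop)

lemma lintegral_poissonENN (r : ℝ≥0) {f : ℝ≥0∞ → ℝ≥0∞} (hf : Measurable f) :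
    ∫⁻ k, f k ∂poissonENN r =
      ∑' n : ℕ, ENNReal.ofReal (Real.exp (-r) * r ^ n / n !) * f n := by
  rw [poissonENN, lintegral_map hf (by fun_prop), poissonMeasure, lintegral_sum_measure]
  refine tsum_congr fun n => ?_
  rw [lintegral_smul_measure, lintegral_dirac, smul_eq_mul]

/-- The Mecke equation of the Poisson distribution. -/
lemma lintegral_poissonENN_mul (r : ℝ≥0) {f : ℝ≥0∞ → ℝ≥0∞} (hf : Measurable f) :
    ∫⁻ k, k * f k ∂poissonENN r = r * ∫⁻ k, f (k + 1) ∂poissonENN r := by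
  have hm : Measurable fun k : ℝ≥0∞ => k * f k := measurable_id.mul hf
  have hm' : Measurable fun k : ℝ≥0∞ => f (k + 1) := hf.comp (measurable_id.add_const 1)
  rw [lintegral_poissonENN r hm, lintegral_poissonENN r hm',
    tsum_eq_zero_add' ENNReal.summable, ← ENNReal.tsum_mul_left]
  simp only [Nat.cast_zero, zero_mul, mul_zero, zero_add]
  refine tsum_congr fun n => ?_
  have h : ENNReal.ofReal (Real.exp (-r) * r ^ (n + 1) / (n + 1)!) * ((n + 1 : ℕ) : ℝ≥0∞) =
      r * ENNReal.ofReal (Real.exp (-r) * r ^ n / n !) := by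
    rw [← ENNReal.ofReal_natCast, ← ENNReal.ofReal_mul (by positivity),
      ← ENNReal.ofReal_coe_nnreal, ← ENNReal.ofReal_mul (by positivity)]
    congr 1
    rw [Nat.factorial_succ]
    push_cast
    have : (n ! : ℝ) ≠ 0 := by positivity
    field_simp
    ring
  push_cast at h ⊢
  rw [← mul_assoc, h, mul_assoc]

lemma lintegral_pi_poissonENN_mul {ι : Type*} [Fintype ι] [DecidableEq ι] (r : ι → ℝ≥0) (i : ι)
    {f : (ι → ℝ≥0∞) → ℝ≥0∞} (hf : Measurable f) :
    ∫⁻ k, k i * f k ∂Measure.pi (fun j => poissonENN (r j)) =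
      r i * ∫⁻ k, f (Function.update k i (k i + 1)) ∂Measure.pi (fun j => poissonENN (r j)) := by
  have hm : Measurable fun k : ι → ℝ≥0∞ => Function.update k i (k i + 1) :=
    measurable_pi_lambda _ fun j => by
      by_cases h : j = i
      · subst h; simpa using (measurable_pi_apply j).add_const 1
      · simpa [Function.update_of_ne h] using measurable_pi_apply j
  have hmul : Measurable fun k : ι → ℝ≥0∞ => k i * f k := (measurable_pi_apply i).mul hf
  have hfm : Measurable fun k : ι → ℝ≥0∞ => f (Function.update k i (k i + 1)) := hf.comp hm
  rw [lintegral_eq_lmarginal_univ (fun _ => 0), lmarginal_erase' _ hmul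
    (Finset.mem_univ i), lintegral_eq_lmarginal_univ (fun _ => 0), lmarginal_erase' _ hfm
    (Finset.mem_univ i)]
  have : (fun x : ι → ℝ≥0∞ => ∫⁻ xi, (Function.update x i xi) i * f (Function.update x i xi)
      ∂poissonENN (r i)) = fun x => r i * ∫⁻ xi, f (Function.update (Function.update x i xi) i
        ((Function.update x i xi) i + 1)) ∂poissonENN (r i) := by
    funext x
    simp only [Function.update_self, Function.update_idem]
    exact lintegral_poissonENN_mul (r i) (f := fun xi => f (Function.update x i xi))
      (hf.comp (measurable_update x))
  rw [this]
  simp only [lmarginal]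
  rw [lintegral_const_mul]
  · have h1 : Measurable fun p : (ι → ℝ≥0∞) × ℝ≥0∞ => f (Function.update
        (Function.update p.1 i p.2) i ((Function.update p.1 i p.2) i + 1)) := by
      refine hf.comp (hm.comp ?_)
      exact measurable_pi_lambda _ fun j => by
        by_cases h : j = i
        · subst h; simpa using measurable_snd
        · simp only [Function.update_of_ne h]
          exact (measurable_pi_apply j).comp measurable_fst
    exact (h1.lintegral_prod_right' (ν := poissonENN (r i))).comp measurable_updateFinset

namespace IsFinitePoisson

variable {η : Ω → Measure X} {Λ : Measure X} {P : Measure Ω} [IsProbabilityMeasure P]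

lemma map_pi (h : IsFinitePoisson η Λ P) {ι : Type*} [Fintype ι] {B : ι → Set X}
    (hB : ∀ i, MeasurableSet (B i)) (hd : Pairwise fun i j => Disjoint (B i) (B j)) :
    P.map (fun ω i => η ω (B i)) = Measure.pi fun i => poissonENN (Λ (B i)).toNNReal := by
  have e := Fintype.equivFin ι
  have h1 := h.indep _ (fun i => B (e.symm i)) (fun i => hB _)
    (fun i j hij => hd (e.symm.injective.ne hij))
  have h2 : iIndepFun (fun i ω => η ω (B i)) P := by
    simpa using h1.precomp e.injective
  rw [(iIndepFun_iff_map_fun_eq_pi_map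
    fun i => (measurable_eval h.measurable (hB i)).aemeasurable).1 h2]
  congr 1
  funext i
  exact h.map_eval _ (hB i)

lemma lintegral_eval_mul_disjoint (h : IsFinitePoisson η Λ P) [IsFiniteMeasure Λ]
    {ι : Type*} [Fintype ι] [DecidableEq ι]
    {B : ι → Set X} (hB : ∀ i, MeasurableSet (B i))
    (hd : Pairwise fun i j => Disjoint (B i) (B j)) (i : ι) {f : (ι → ℝ≥0∞) → ℝ≥0∞}
    (hf : Measurable f) :
    ∫⁻ ω, η ω (B i) * f (fun j => η ω (B j)) ∂P =
      Λ (B i) * ∫⁻ ω, f (Function.update (fun j => η ω (B j)) i (η ω (B i) + 1)) ∂P := by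
  have hm : Measurable fun ω j => η ω (B j) :=
    measurable_pi_lambda _ fun j => measurable_eval h.measurable (hB j)
  have hu : Measurable fun k : ι → ℝ≥0∞ => Function.update k i (k i + 1) :=
    measurable_pi_lambda _ fun j => by
      by_cases h : j = i
      · subst h; simpa using (measurable_pi_apply j).add_const 1
      · simpa [Function.update_of_ne h] using measurable_pi_apply j
  have h1 := lintegral_pi_poissonENN_mul (fun j => (Λ (B j)).toNNReal) i hf
  have hmul : Measurable fun k : ι → ℝ≥0∞ => k i * f k := (measurable_pi_apply i).mul hf
  have hfu : Measurable fun k : ι → ℝ≥0∞ => f (Function.update k i (k i + 1)) := hf.comp hu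
  rw [← h.map_pi hB hd, lintegral_map hmul hm,
    lintegral_map hfu hm, ENNReal.coe_toNNReal (measure_ne_top _ _)] at h1
  exact h1

/-- The Mecke equation for functions of finitely many evaluations, by decomposition into the
atoms of the algebra that the sets generate. -/
lemma lintegral_eval_mul (h : IsFinitePoisson η Λ P) [IsFiniteMeasure Λ]
    {ι : Type*} [Fintype ι] {B : ι → Set X} (hB : ∀ i, MeasurableSet (B i)) {A : Set X}
    (hA : MeasurableSet A) {f : (ι → ℝ≥0∞) → ℝ≥0∞} (hf : Measurable f) :
    ∫⁻ ω, η ω A * f (fun j => η ω (B j)) ∂P =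
      ∫⁻ x in A, ∫⁻ ω, f (fun j => (η ω + Measure.dirac x) (B j)) ∂P ∂Λ := by
  classical
  let D : Option ι → Set X := fun o => o.elim A B
  have hD : ∀ o, MeasurableSet (D o) := by
    rintro (_ | i)
    · exact hA
    · exact hB i
  let e : X → Option ι → Bool := fun x o => decide (x ∈ D o)
  have he : Measurable e := measurable_pi_lambda _ fun o =>
    measurable_to_bool (by
      have : (fun x => decide (x ∈ D o)) ⁻¹' {true} = D o := by ext; simp
      rw [this]; exact hD o)
  let C : (Option ι → Bool) → Set X := fun a => e ⁻¹' {a}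
  have hC : ∀ a, MeasurableSet (C a) := fun a => he (measurableSet_singleton a)
  have hCd : Pairwise fun a b => Disjoint (C a) (C b) := fun a b hab =>
    Disjoint.preimage _ (by simpa using hab)
  let F : Option ι → Finset (Option ι → Bool) := fun o => Finset.univ.filter fun a => a o = true
  have hDF : ∀ o, D o = e ⁻¹' (F o : Set (Option ι → Bool)) := fun o => by
    ext x; simp [F, e]
  have hsum : ∀ (μ : Measure X) (o : Option ι), μ (D o) = ∑ a ∈ F o, μ (C a) := fun μ o => by
    rw [hDF, sum_measure_preimage_singleton _ fun a _ => hC a]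
  let f' : ((Option ι → Bool) → ℝ≥0∞) → ℝ≥0∞ := fun k => f fun i => ∑ a ∈ F (some i), k a
  have hf' : Measurable f' := hf.comp (measurable_pi_lambda _ fun i =>
    Finset.measurable_sum _ fun a _ => measurable_pi_apply a)
  have hff' : ∀ μ : Measure X, f (fun j => μ (B j)) = f' fun a => μ (C a) := fun μ => by
    simp only [f']
    congr 1
    funext i
    exact hsum μ (some i)
  have hm : Measurable fun ω a => η ω (C a) :=
    measurable_pi_lambda _ fun j => measurable_eval h.measurable (hC j)
  have hAC : A = ⋃ a ∈ F none, C a := by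
    ext x
    simp only [Set.mem_iUnion, C, F, Set.mem_preimage, Set.mem_singleton_iff, exists_prop,
      exists_eq_right', Finset.mem_filter, Finset.mem_univ, true_and, e, decide_eq_true_eq]
    rfl
  calc ∫⁻ ω, η ω A * f (fun j => η ω (B j)) ∂P
      = ∫⁻ ω, ∑ a ∈ F none, η ω (C a) * f' (fun a => η ω (C a)) ∂P := by
        refine lintegral_congr fun ω => ?_
        rw [← Finset.sum_mul, ← hsum (η ω) none, hff']
        rfl
    _ = ∑ a ∈ F none, Λ (C a) * ∫⁻ ω, f' (Function.update (fun b => η ω (C b)) a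
          (η ω (C a) + 1)) ∂P := by
        have hmul : ∀ a, Measurable fun ω => η ω (C a) * f' (fun a => η ω (C a)) := fun a =>
          (measurable_eval h.measurable (hC a)).mul (hf'.comp hm)
        rw [lintegral_finsetSum _ fun a _ => hmul a]
        exact Finset.sum_congr rfl fun a _ => h.lintegral_eval_mul_disjoint hC hCd a hf'
    _ = ∑ a ∈ F none, ∫⁻ x in C a, ∫⁻ ω, f (fun j => (η ω + Measure.dirac x) (B j)) ∂P ∂Λ := by
        refine Finset.sum_congr rfl fun a _ => ?_
        rw [mul_comm, ← setLIntegral_const]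
        refine setLIntegral_congr_fun (hC a) fun x hx => ?_
        refine lintegral_congr fun ω => ?_
        rw [hff']
        congr 1
        funext b
        rw [Measure.add_apply, Measure.dirac_apply' _ (hC b)]
        by_cases hb : b = a
        · subst hb; simp [hx]
        · have : x ∉ C b := fun hx' => hb (by
            rw [← show e x = b from hx', show e x = a from hx])
          simp [Function.update_of_ne hb, this]
    _ = _ := by
        conv_rhs => rw [hAC]
        rw [lintegral_biUnion_finset _ fun a _ => hC a]
        intro a _ b _ hab
        exact hCd hab

end IsFinitePoisson

/-- Finite measures on a space of measures are determined by the finite-dimensional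
distributions of the evaluations. -/
lemma ext_of_map_eval {ν₁ ν₂ : Measure (Measure X)} [IsFiniteMeasure ν₁]
    (h : ∀ (ι : Type u) [Fintype ι] (B : ι → Set X), (∀ i, MeasurableSet (B i)) →
      ν₁.map (fun μ i => μ (B i)) = ν₂.map (fun μ i => μ (B i))) : ν₁ = ν₂ := by
  let e : Measure X → {B : Set X // MeasurableSet B} → ℝ≥0∞ := fun μ B => μ B.1
  have he : Measurable e := measurable_pi_lambda _ fun B => Measure.measurable_coe B.2
  have heq : ν₁.map e = ν₂.map e := by
    refine IsProjectiveLimit.unique (P := fun I => (ν₁.map e).map I.restrict)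
      (fun I => rfl) fun I => ?_
    beta_reduce
    rw [Measure.map_map (Finset.measurable_restrict I) he,
      Measure.map_map (Finset.measurable_restrict I) he]
    exact (h I (fun i => i.1.1) fun i => i.1.2).symm
  ext A hA
  obtain ⟨S, hS, rfl⟩ : ∃ S, MeasurableSet S ∧ e ⁻¹' S = A := by
    have hle : (Measure.instMeasurableSpace : MeasurableSpace (Measure X)) ≤
        MeasurableSpace.comap e inferInstance := by
      refine iSup₂_le fun s hs => ?_
      rintro _ ⟨t, ht, rfl⟩
      refine ⟨(fun k => k ⟨s, hs⟩) ⁻¹' t, ?_, rfl⟩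
      exact measurable_pi_apply (⟨s, hs⟩ : {B : Set X // MeasurableSet B})
        (by rwa [BorelSpace.measurable_eq (α := ℝ≥0∞)])
    exact hle _ hA
  rw [← Measure.map_apply he hS, heq, Measure.map_apply he hS]

namespace IsFinitePoisson

variable {η : Ω → Measure X} {Λ : Measure X} {P : Measure Ω} [IsProbabilityMeasure P]

/-- A finite Poisson process as a kernel. -/
def kernel (h : IsFinitePoisson η Λ P) : Kernel Ω X := idKernel.comap η h.measurable

instance (h : IsFinitePoisson η Λ P) : IsSFiniteKernel h.kernel := by
  unfold kernel; infer_instance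

omit [IsProbabilityMeasure P] in
lemma kernel_apply (h : IsFinitePoisson η Λ P) (ω : Ω) : h.kernel ω = η ω := by
  have := h.finite ω
  rw [kernel, Kernel.comap_apply, idKernel_apply]

omit [IsProbabilityMeasure P] in
lemma measurable_add_dirac (h : IsFinitePoisson η Λ P) :
    Measurable fun p : X × Ω => η p.2 + Measure.dirac p.1 :=
  (h.measurable.comp measurable_snd).add (Measure.measurable_dirac.comp measurable_fst)

/-- The **Mecke equation**, as an equality of measures on `X × Measure X`. -/
lemma mecke (h : IsFinitePoisson η Λ P) [IsFiniteMeasure Λ] :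
    (P ⊗ₘ h.kernel).map (fun p : Ω × X => (p.2, η p.1)) =
      (Λ.prod P).map fun p => (p.1, η p.2 + Measure.dirac p.1) := by
  have hm1 : Measurable fun p : Ω × X => (p.2, η p.1) :=
    measurable_snd.prodMk (h.measurable.comp measurable_fst)
  have hm2 : Measurable fun p : X × Ω => (p.1, η p.2 + Measure.dirac p.1) :=
    measurable_fst.prodMk h.measurable_add_dirac
  have hL : ∀ {A : Set X} {S : Set (Measure X)}, MeasurableSet A → MeasurableSet S →
      (P ⊗ₘ h.kernel).map (fun p : Ω × X => (p.2, η p.1)) (A ×ˢ S) =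
        ∫⁻ ω in η ⁻¹' S, η ω A ∂P := by
    intro A S hA hS
    have : (fun p : Ω × X => (p.2, η p.1)) ⁻¹' (A ×ˢ S) = (η ⁻¹' S) ×ˢ A := by
      ext p; simp [and_comm]
    rw [Measure.map_apply hm1 (hA.prod hS), this, Measure.compProd_apply_prod (h.measurable hS) hA]
    simp only [h.kernel_apply]
  have hR : ∀ {A : Set X} {S : Set (Measure X)}, MeasurableSet A → MeasurableSet S →
      (Λ.prod P).map (fun p => (p.1, η p.2 + Measure.dirac p.1)) (A ×ˢ S) =
        (((Λ.restrict A).prod P).map fun p => η p.2 + Measure.dirac p.1) S := by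
    intro A S hA hS
    rw [Measure.map_apply hm2 (hA.prod hS), Measure.map_apply h.measurable_add_dirac hS,
      ← Measure.restrict_univ (μ := P), Measure.prod_restrict, Measure.restrict_apply
      (h.measurable_add_dirac hS), Measure.restrict_univ]
    congr 1
    ext p; simp [and_comm]
  have htot : ∀ A, MeasurableSet A → ∫⁻ ω, η ω A ∂P = Λ A := fun A hA => by
    have := h.lintegral_eval_mul (ι := Empty) (B := fun _ => ∅) (fun i => i.elim) hA
      (f := fun _ => 1) measurable_const
    simpa using this
  have hkey : ∀ A, MeasurableSet A →
      (P.withDensity fun ω => η ω A).map η =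
        ((Λ.restrict A).prod P).map fun p => η p.2 + Measure.dirac p.1 := by
    intro A hA
    have hAm := measurable_eval h.measurable hA
    have : IsFiniteMeasure (P.withDensity fun ω => η ω A) :=
      isFiniteMeasure_withDensity (by rw [htot A hA]; exact measure_ne_top _ _)
    refine ext_of_map_eval fun ι _ B hB => ?_
    have hBm : Measurable fun (μ : Measure X) (i : ι) => μ (B i) :=
      measurable_pi_lambda _ fun i => Measure.measurable_coe (hB i)
    ext T hT
    have hT' : MeasurableSet ((fun (μ : Measure X) (i : ι) => μ (B i)) ⁻¹' T) := hBm hT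
    have h1 := h.lintegral_eval_mul hB hA (f := T.indicator 1) (measurable_one.indicator hT)
    rw [Measure.map_apply hBm hT, Measure.map_apply h.measurable hT',
      withDensity_apply _ (h.measurable hT'), Measure.map_apply hBm hT,
      Measure.map_apply h.measurable_add_dirac hT', Measure.prod_apply (h.measurable_add_dirac hT')]
    rw [← lintegral_indicator (h.measurable hT')]
    convert h1 using 2
    · funext ω
      by_cases hω : (fun j => η ω (B j)) ∈ T
      · rw [Set.indicator_of_mem (by exact hω), Set.indicator_of_mem hω]; simp
      · rw [Set.indicator_of_notMem (by exact hω), Set.indicator_of_notMem hω]; simp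
    · funext x
      rw [← lintegral_indicator_one (measurable_prodMk_left (h.measurable_add_dirac hT'))]
      refine lintegral_congr fun ω => ?_
      rfl
  have hfin : IsFiniteMeasure ((P ⊗ₘ h.kernel).map fun p : Ω × X => (p.2, η p.1)) := ⟨by
    rw [← Set.univ_prod_univ, hL MeasurableSet.univ MeasurableSet.univ]
    simp only [Set.preimage_univ, Measure.restrict_univ]
    rw [htot _ MeasurableSet.univ]
    exact measure_lt_top _ _⟩
  refine Measure.ext_prod fun {A S} hA hS => ?_
  rw [hL hA hS, hR hA hS, ← hkey A hA, Measure.map_apply h.measurable hS,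
    withDensity_apply _ (h.measurable hS)]

lemma lintegral_mecke (h : IsFinitePoisson η Λ P) [IsFiniteMeasure Λ]
    {f : X → Measure X → ℝ≥0∞} (hf : Measurable (Function.uncurry f)) :
    ∫⁻ ω, ∫⁻ x, f x (η ω) ∂η ω ∂P = ∫⁻ x, ∫⁻ ω, f x (η ω + Measure.dirac x) ∂P ∂Λ := by
  have hm1 : Measurable fun p : Ω × X => (p.2, η p.1) :=
    measurable_snd.prodMk (h.measurable.comp measurable_fst)
  have hm2 : Measurable fun p : X × Ω => (p.1, η p.2 + Measure.dirac p.1) :=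
    measurable_fst.prodMk h.measurable_add_dirac
  have := congrArg (fun M => ∫⁻ p, Function.uncurry f p ∂M) h.mecke
  beta_reduce at this
  have hf1 : Measurable fun p : Ω × X => Function.uncurry f (p.2, η p.1) := hf.comp hm1
  have hf2 : Measurable fun p : X × Ω => Function.uncurry f (p.1, η p.2 + Measure.dirac p.1) :=
    hf.comp hm2
  rw [lintegral_map hf hm1, lintegral_map hf hm2, Measure.lintegral_compProd hf1,
    lintegral_prod _ hf2.aemeasurable] at this
  simpa only [h.kernel_apply, Function.uncurry] using this

end IsFinitePoisson

end Mecke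

/-! ### Factorial integrals with respect to a Poisson process -/

section FactorialIntegrals

universe u

variable {X : Type u} [MeasurableSpace X]

lemma measurePreserving_finCons (Λ : Measure X) [SigmaFinite Λ] (m : ℕ) :
    MeasurePreserving (fun p : X × (Fin m → X) => (Fin.cons p.1 p.2 : Fin (m + 1) → X))
      (Λ.prod (Measure.pi fun _ => Λ)) (Measure.pi fun _ => Λ) := by
  have h := (measurePreserving_piFinSuccAbove (fun _ : Fin (m + 1) => Λ) 0).symm
  convert h using 1
  funext p
  simp [MeasurableEquiv.piFinSuccAbove, Fin.insertNthEquiv]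

lemma measurableEmbedding_finCons (m : ℕ) :
    MeasurableEmbedding (fun p : X × (Fin m → X) => (Fin.cons p.1 p.2 : Fin (m + 1) → X)) := by
  have h := (MeasurableEquiv.piFinSuccAbove (fun _ : Fin (m + 1) => X) 0).symm.measurableEmbedding
  convert h using 1
  funext p
  simp [MeasurableEquiv.piFinSuccAbove, Fin.insertNthEquiv]

lemma measurable_uncurry_sect {m : ℕ} {f : (Fin (m + 1) → X) → ℝ} (hf : Measurable f) :
    Measurable (Function.uncurry (sect f)) := hf.comp measurable_finCons

lemma lintegral_pi_succ (Λ : Measure X) [SigmaFinite Λ] {m : ℕ} {f : (Fin (m + 1) → X) → ℝ≥0∞}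
    (hf : Measurable f) :
    ∫⁻ z, f z ∂(Measure.pi fun _ => Λ) =
      ∫⁻ x, ∫⁻ y : Fin m → X, f (Fin.cons x y) ∂(Measure.pi fun _ => Λ) ∂Λ := by
  rw [← (measurePreserving_finCons Λ m).lintegral_comp hf]
  exact lintegral_prod _ (hf.comp measurable_finCons).aemeasurable

lemma integrable_pi_succ_iff (Λ : Measure X) [SigmaFinite Λ] {m : ℕ}
    {f : (Fin (m + 1) → X) → ℝ} :
    Integrable f (Measure.pi fun _ => Λ) ↔
      Integrable (Function.uncurry (sect f)) (Λ.prod (Measure.pi fun _ => Λ)) :=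
  ((measurePreserving_finCons Λ m).integrable_comp_emb (measurableEmbedding_finCons m)).symm

/-- The mean value of a kernel. -/
def meanVal (Λ : Measure X) {m : ℕ} (f : (Fin m → X) → ℝ) : ℝ :=
  ∫ z, f z ∂(Measure.pi fun _ => Λ)

lemma meanVal_succ (Λ : Measure X) [SigmaFinite Λ] {m : ℕ}
    {f : (Fin (m + 1) → X) → ℝ} (hf : Integrable f (Measure.pi fun _ => Λ)) :
    meanVal Λ f = ∫ x, meanVal Λ (sect f x) ∂Λ := by
  rw [meanVal, ← (measurePreserving_finCons Λ m).integral_comp (measurableEmbedding_finCons m)]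
  exact integral_prod _ ((integrable_pi_succ_iff Λ).1 hf)

lemma meanVal_zero (Λ : Measure X) (f : (Fin 0 → X) → ℝ) : meanVal Λ f = f Fin.elim0 := by
  rw [meanVal, Measure.pi_of_empty (fun _ => Λ) Fin.elim0, integral_dirac]

/-- The sum of `f` over the `m`-tuples of points of a finite point measure with distinct
indices. -/
def pointSum (m : ℕ) (f : (Fin m → X) → ℝ) (μ : Measure X) : ℝ :=
  measureTupleSum m f 0 Fin.elim0 (idKernel μ)

/-- The sum of `f` over the `m`-tuples of points with distinct indices of `μ - δ_x`. -/
def pointSumErase (m : ℕ) (f : (Fin m → X) → ℝ) (x : X) (μ : Measure X) : ℝ :=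
  measureTupleSum m f 1 (Fin.cons x Fin.elim0) (idKernel μ)

lemma measurable_pointSum {m : ℕ} {f : (Fin m → X) → ℝ} (hf : Measurable f) :
    Measurable (pointSum m f) :=
  measurable_measureTupleSum idKernel (f := fun _ => f) (y := fun _ => Fin.elim0)
    (hf.comp measurable_snd) measurable_const

lemma measurable_pointSumErase {m : ℕ} {f : (Fin (m + 1) → X) → ℝ} (hf : Measurable f) :
    Measurable fun p : X × Measure X => pointSumErase m (sect f p.1) p.1 p.2 :=
  measurable_measureTupleSum (Z := X × Measure X) (idKernel.comap Prod.snd measurable_snd)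
    (f := fun p => sect f p.1) (y := fun p => Fin.cons p.1 Fin.elim0)
    (hf.comp (measurable_finCons.comp
      ((measurable_fst.comp measurable_fst).prodMk measurable_snd)))
    (measurable_finCons.comp (measurable_fst.prodMk measurable_const))

variable [MeasurableSingletonClass X]

lemma pointSum_listMeasure {m : ℕ} {f : (Fin m → X) → ℝ} (hf : IsSymm m f) (l : List X) :
    pointSum m f (listMeasure l) = tupleSum m f l := by
  rw [pointSum, idKernel_apply]
  exact measureTupleSum_eq hf l _ (by simp)

lemma pointSumErase_listMeasure {m : ℕ} {f : (Fin m → X) → ℝ} (hf : IsSymm m f) (x : X)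
    (l : List X) :
    pointSumErase m f x (listMeasure l + Measure.dirac x) = tupleSum m f l := by
  rw [pointSumErase, idKernel_apply]
  refine measureTupleSum_eq hf l _ ?_
  rw [add_comm, ← listMeasure_cons]
  refine listMeasure_perm ?_
  simp only [List.ofFn_cons, List.ofFn_zero]
  exact (List.perm_append_singleton x l).symm

omit [MeasurableSingletonClass X] in
lemma pointSum_zero (f : (Fin 0 → X) → ℝ) (μ : Measure X) : pointSum 0 f μ = f Fin.elim0 := by
  rw [pointSum, measureTupleSum]

omit [MeasurableSingletonClass X] in
lemma pointSum_succ {m : ℕ} {f : (Fin (m + 1) → X) → ℝ} {μ : Measure X} [IsFiniteMeasure μ] :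
    pointSum (m + 1) f μ = ∫ x, pointSumErase m (sect f x) x μ ∂μ := by
  rw [pointSum, measureTupleSum, Finset.univ_eq_empty, Finset.sum_empty, sub_zero,
    idKernel_apply]
  simp only [pointSumErase, idKernel_apply]

variable [MeasurableSpace.CountablySeparated X]

lemma pointSumErase_add_dirac {m : ℕ} {f : (Fin m → X) → ℝ} (hf : IsSymm m f) (x : X)
    {μ : Measure X} [IsFiniteMeasure μ] (hμ : IsIntegerValued μ) :
    pointSumErase m f x (μ + Measure.dirac x) = pointSum m f μ := by
  obtain ⟨l, rfl⟩ := hμ.exists_listMeasure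
  rw [pointSumErase_listMeasure hf, pointSum_listMeasure hf]

lemma pointSum_add_dirac {m : ℕ} {f : (Fin (m + 1) → X) → ℝ} (hf : IsSymm (m + 1) f) (x : X)
    {μ : Measure X} [IsFiniteMeasure μ] (hμ : IsIntegerValued μ) :
    pointSum (m + 1) f (μ + Measure.dirac x) =
      pointSum (m + 1) f μ + (m + 1) * pointSum m (sect f x) μ := by
  obtain ⟨l, rfl⟩ := hμ.exists_listMeasure
  rw [add_comm (listMeasure l), ← listMeasure_cons, pointSum_listMeasure hf,
    pointSum_listMeasure hf, pointSum_listMeasure (hf.sect x), tupleSum_cons]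

lemma pointSum_nonneg {m : ℕ} {f : (Fin m → X) → ℝ} (hf : IsSymm m f) (h0 : ∀ x, 0 ≤ f x)
    {μ : Measure X} [IsFiniteMeasure μ] (hμ : IsIntegerValued μ) : 0 ≤ pointSum m f μ := by
  obtain ⟨l, rfl⟩ := hμ.exists_listMeasure
  rw [pointSum_listMeasure hf]
  exact tupleSum_nonneg h0 l

lemma abs_pointSum_le {m : ℕ} {f : (Fin m → X) → ℝ} (hf : IsSymm m f)
    {μ : Measure X} [IsFiniteMeasure μ] (hμ : IsIntegerValued μ) :
    |pointSum m f μ| ≤ pointSum m (fun x => |f x|) μ := by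
  obtain ⟨l, rfl⟩ := hμ.exists_listMeasure
  rw [pointSum_listMeasure hf, pointSum_listMeasure (hf.comp _)]
  exact abs_tupleSum_le f l

lemma pointSumErase_nonneg_ae {m : ℕ} {f : (Fin (m + 1) → X) → ℝ} (hf : IsSymm (m + 1) f)
    (h0 : ∀ x, 0 ≤ f x) {μ : Measure X} [IsFiniteMeasure μ] (hμ : IsIntegerValued μ) :
    ∀ᵐ x ∂μ, 0 ≤ pointSumErase m (sect f x) x μ := by
  classical
  obtain ⟨l, rfl⟩ := hμ.exists_listMeasure
  filter_upwards [ae_listMeasure_mem l] with x hx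
  have : listMeasure l = listMeasure (l.erase x) + Measure.dirac x := by
    rw [add_comm, ← listMeasure_cons]
    exact listMeasure_perm (List.perm_cons_erase hx)
  rw [this, pointSumErase_listMeasure (hf.sect x)]
  exact tupleSum_nonneg (fun _ => h0 _) _

variable {Ω : Type*} [MeasurableSpace Ω] {η : Ω → Measure X} {Λ : Measure X} {P : Measure Ω}
  [IsProbabilityMeasure P] [IsFiniteMeasure Λ]

namespace IsFinitePoisson

omit [MeasurableSingletonClass X] [MeasurableSpace.CountablySeparated X]
  [IsProbabilityMeasure P] [IsFiniteMeasure Λ] in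
lemma measurable_pointSum (h : IsFinitePoisson η Λ P) {m : ℕ} {f : (Fin m → X) → ℝ}
    (hf : Measurable f) : Measurable fun ω => pointSum m f (η ω) :=
  (PoissonFlats.measurable_pointSum hf).comp h.measurable

/-- The Mecke equation for factorial integrals of nonnegative functions. -/
lemma lintegral_pointSum_mul (h : IsFinitePoisson η Λ P) {m : ℕ} {f : (Fin (m + 1) → X) → ℝ}
    (hfm : Measurable f) (hf : IsSymm (m + 1) f) (h0 : ∀ x, 0 ≤ f x) {G : Measure X → ℝ≥0∞}
    (hG : Measurable G) :
    ∫⁻ ω, ENNReal.ofReal (pointSum (m + 1) f (η ω)) * G (η ω) ∂P =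
      ∫⁻ x, ∫⁻ ω, ENNReal.ofReal (pointSum m (sect f x) (η ω)) * G (η ω + Measure.dirac x)
        ∂P ∂Λ := by
  have hH : Measurable (Function.uncurry fun (x : X) (μ : Measure X) =>
      ENNReal.ofReal (pointSumErase m (sect f x) x μ) * G μ) :=
    (measurable_pointSumErase hfm).ennreal_ofReal.mul (hG.comp measurable_snd)
  have h1 := h.lintegral_mecke hH
  have := h.finite
  convert h1 using 1
  · refine lintegral_congr fun ω => ?_
    have hint : Integrable (fun x => pointSumErase m (sect f x) x (η ω)) (η ω) := by
      obtain ⟨l, hl⟩ := (h.integer_valued ω).exists_listMeasure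
      rw [hl]; exact integrable_listMeasure _ _
    have hmeas : Measurable fun x => ENNReal.ofReal (pointSumErase m (sect f x) x (η ω)) :=
      ((measurable_pointSumErase hfm).comp measurable_prodMk_right).ennreal_ofReal
    rw [lintegral_mul_const _ hmeas, pointSum_succ, ofReal_integral_eq_lintegral_ofReal hint
      (pointSumErase_nonneg_ae hf h0 (h.integer_valued ω))]
  · refine lintegral_congr fun x => lintegral_congr fun ω => ?_
    rw [pointSumErase_add_dirac (hf.sect x) x (h.integer_valued ω)]

/-- The Mecke equation for factorial integrals. -/
lemma integral_pointSum_mul (h : IsFinitePoisson η Λ P) {m : ℕ} {f : (Fin (m + 1) → X) → ℝ}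
    (hfm : Measurable f) (hf : IsSymm (m + 1) f) {G : Measure X → ℝ} (hG : Measurable G)
    (hfin : ∫⁻ x, ∫⁻ ω, ‖pointSum m (sect f x) (η ω) * G (η ω + Measure.dirac x)‖ₑ ∂P ∂Λ ≠ ∞) :
    Integrable (fun ω => pointSum (m + 1) f (η ω) * G (η ω)) P ∧
    Integrable (fun p : X × Ω => pointSum m (sect f p.1) (η p.2) * G (η p.2 + Measure.dirac p.1))
      (Λ.prod P) ∧
    ∫ ω, pointSum (m + 1) f (η ω) * G (η ω) ∂P =
      ∫ x, ∫ ω, pointSum m (sect f x) (η ω) * G (η ω + Measure.dirac x) ∂P ∂Λ := by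
  have := h.finite
  have hm1 : Measurable fun p : Ω × X => (p.2, η p.1) :=
    measurable_snd.prodMk (h.measurable.comp measurable_fst)
  have hm2 : Measurable fun p : X × Ω => (p.1, η p.2 + Measure.dirac p.1) :=
    measurable_fst.prodMk h.measurable_add_dirac
  set H : X × Measure X → ℝ := fun p => pointSumErase m (sect f p.1) p.1 p.2 * G p.2 with hHdef
  have hH : Measurable H := (measurable_pointSumErase hfm).mul (hG.comp measurable_snd)
  have hHm2 : ∀ p : X × Ω, H (p.1, η p.2 + Measure.dirac p.1) =
      pointSum m (sect f p.1) (η p.2) * G (η p.2 + Measure.dirac p.1) := fun p => by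
    rw [hHdef]
    simp only
    rw [pointSumErase_add_dirac (hf.sect p.1) p.1 (h.integer_valued p.2)]
  have hHm1 : ∀ ω, ∫ x, H (x, η ω) ∂η ω = pointSum (m + 1) f (η ω) * G (η ω) := fun ω => by
    simp only [hHdef]
    rw [integral_mul_const, pointSum_succ]
  have hI2 : Integrable (fun p : X × Ω => H (p.1, η p.2 + Measure.dirac p.1)) (Λ.prod P) := by
    refine ⟨(hH.comp hm2).aestronglyMeasurable, ?_⟩
    have hmeas : Measurable fun p : X × Ω => ‖H (p.1, η p.2 + Measure.dirac p.1)‖ₑ :=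
      (hH.comp hm2).enorm
    rw [hasFiniteIntegral_iff_enorm, lintegral_prod _ hmeas.aemeasurable]
    have hHm2' : ∀ x ω, H (x, η ω + Measure.dirac x) =
      pointSum m (sect f x) (η ω) * G (η ω + Measure.dirac x) := fun x ω => hHm2 (x, ω)
    simp only [hHm2']
    exact lt_top_iff_ne_top.2 hfin
  have hIM : Integrable H ((Λ.prod P).map fun p => (p.1, η p.2 + Measure.dirac p.1)) :=
    (integrable_map_measure hH.aestronglyMeasurable hm2.aemeasurable).2 hI2
  have hI1 : Integrable (fun p : Ω × X => H (p.2, η p.1)) (P ⊗ₘ h.kernel) := by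
    rw [← h.mecke] at hIM
    exact (integrable_map_measure hH.aestronglyMeasurable hm1.aemeasurable).1 hIM
  have heq := congrArg (fun M => ∫ p, H p ∂M) h.mecke
  beta_reduce at heq
  rw [integral_map hm1.aemeasurable hH.aestronglyMeasurable,
    integral_map hm2.aemeasurable hH.aestronglyMeasurable, Measure.integral_compProd hI1,
    integral_prod _ hI2] at heq
  simp only [h.kernel_apply, hHm1] at heq
  refine ⟨?_, ?_, heq.trans (integral_congr_ae (ae_of_all _ fun x =>
    integral_congr_ae (ae_of_all _ fun ω => hHm2 (x, ω))))⟩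
  · have hI := (Measure.integrable_compProd_iff hI1.aestronglyMeasurable).1 hI1
    refine hI.2.mono' ((h.measurable_pointSum hfm).mul
      (hG.comp h.measurable)).aestronglyMeasurable (ae_of_all _ fun ω => ?_)
    rw [← hHm1 ω, h.kernel_apply]
    exact norm_integral_le_integral_norm _
  · simpa only [hHm2] using hI2

end IsFinitePoisson

end FactorialIntegrals

/-! ### Second moments of factorial integrals -/

section Moments

universe u

variable {X : Type u} [MeasurableSpace X]

lemma pi_smul_measure (t : ℝ≥0) (Λ : Measure X) [IsFiniteMeasure Λ] (m : ℕ) :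
    (Measure.pi fun _ : Fin m => t • Λ) = t ^ m • Measure.pi fun _ : Fin m => Λ := by
  refine Measure.pi_eq fun s _ => ?_
  rw [Measure.smul_apply, Measure.pi_pi]
  simp only [Measure.smul_apply, ENNReal.smul_def, smul_eq_mul, Finset.prod_mul_distrib,
    Finset.prod_const, Finset.card_univ, Fintype.card_fin, ENNReal.coe_pow]

/-- A symmetric measurable kernel that is square integrable. -/
structure IsKernel (Λ : Measure X) {m : ℕ} (f : (Fin m → X) → ℝ) : Prop where
  measurable : Measurable f
  symm : IsSymm m f
  sq : Integrable (fun z => f z ^ 2) (Measure.pi fun _ => Λ)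

/-- The squared `L²` norm of a kernel. -/
def normSqK (Λ : Measure X) {m : ℕ} (f : (Fin m → X) → ℝ) : ℝ :=
  ∫ z, f z ^ 2 ∂(Measure.pi fun _ => Λ)

/-- The squared `L²` norm of a kernel, as an extended nonnegative number. -/
def enormSqK (Λ : Measure X) {m : ℕ} (f : (Fin m → X) → ℝ) : ℝ≥0∞ :=
  ∫⁻ z, ENNReal.ofReal (f z ^ 2) ∂(Measure.pi fun _ => Λ)

lemma normSqK_nonneg (Λ : Measure X) {m : ℕ} (f : (Fin m → X) → ℝ) : 0 ≤ normSqK Λ f :=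
  integral_nonneg fun _ => sq_nonneg _

lemma enormSqK_succ (Λ : Measure X) [SigmaFinite Λ] {m : ℕ} {f : (Fin (m + 1) → X) → ℝ}
    (hf : Measurable f) : enormSqK Λ f = ∫⁻ x, enormSqK Λ (sect f x) ∂Λ :=
  lintegral_pi_succ Λ (hf.pow_const 2).ennreal_ofReal

lemma measurable_enormSqK_sect (Λ : Measure X) [SigmaFinite Λ] {m : ℕ}
    {f : (Fin (m + 1) → X) → ℝ} (hf : Measurable f) :
    Measurable fun x => enormSqK Λ (sect f x) :=
  Measurable.lintegral_prod_right'
    (f := fun p : X × (Fin m → X) => ENNReal.ofReal (sect f p.1 p.2 ^ 2))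
    (((measurable_uncurry_sect hf).pow_const 2).ennreal_ofReal)

lemma stronglyMeasurable_meanVal_sect (Λ : Measure X) [SigmaFinite Λ] {m : ℕ}
    {f : (Fin (m + 1) → X) → ℝ} (hf : Measurable f) :
    StronglyMeasurable fun x => meanVal Λ (sect f x) :=
  StronglyMeasurable.integral_prod_right' (measurable_uncurry_sect hf).stronglyMeasurable

namespace IsKernel

variable {Λ : Measure X} [IsFiniteMeasure Λ]

omit [IsFiniteMeasure Λ] in
lemma abs {m : ℕ} {f : (Fin m → X) → ℝ} (hf : IsKernel Λ f) : IsKernel Λ fun z => |f z| :=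
  ⟨hf.measurable.abs, hf.symm.comp _, by simpa only [sq_abs] using hf.sq⟩

omit [IsFiniteMeasure Λ] in
lemma memLp {m : ℕ} {f : (Fin m → X) → ℝ} (hf : IsKernel Λ f) :
    MemLp f 2 (Measure.pi fun _ => Λ) :=
  (memLp_two_iff_integrable_sq hf.measurable.aestronglyMeasurable).2 hf.sq

lemma integrable {m : ℕ} {f : (Fin m → X) → ℝ} (hf : IsKernel Λ f) :
    Integrable f (Measure.pi fun _ => Λ) :=
  hf.memLp.integrable one_le_two

omit [IsFiniteMeasure Λ] in
lemma enormSqK_eq {m : ℕ} {f : (Fin m → X) → ℝ} (hf : IsKernel Λ f) :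
    enormSqK Λ f = ENNReal.ofReal (normSqK Λ f) :=
  (ofReal_integral_eq_lintegral_ofReal hf.sq (ae_of_all _ fun _ => sq_nonneg _)).symm

lemma sect_ae {m : ℕ} {f : (Fin (m + 1) → X) → ℝ} (hf : IsKernel Λ f) :
    ∀ᵐ x ∂Λ, IsKernel Λ (sect f x) := by
  have h := ((integrable_pi_succ_iff Λ).1 hf.sq).prod_right_ae
  filter_upwards [h] with x hx
  exact ⟨measurable_sect hf.measurable x, hf.symm.sect x, hx⟩

lemma normSqK_succ {m : ℕ} {f : (Fin (m + 1) → X) → ℝ} (hf : IsKernel Λ f) :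
    Integrable (fun x => normSqK Λ (sect f x)) Λ ∧
      normSqK Λ f = ∫ x, normSqK Λ (sect f x) ∂Λ :=
  ⟨((integrable_pi_succ_iff Λ).1 hf.sq).integral_prod_left, meanVal_succ Λ hf.sq⟩

lemma sq_meanVal_le {m : ℕ} {f : (Fin m → X) → ℝ} (hf : IsKernel Λ f) :
    meanVal Λ f ^ 2 ≤ (Measure.pi fun _ : Fin m => Λ).real Set.univ * normSqK Λ f := by
  set μ := Measure.pi fun _ : Fin m => Λ
  have h : ∀ c : ℝ, 0 ≤ μ.real Set.univ * (c * c) + (-2 * meanVal Λ f) * c + normSqK Λ f := by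
    intro c
    have h0 : 0 ≤ ∫ z, (f z - c) ^ 2 ∂μ := integral_nonneg fun _ => sq_nonneg _
    have h1 : ∫ z, (f z - c) ^ 2 ∂μ = ∫ z, (f z ^ 2 - 2 * c * f z + c ^ 2) ∂μ :=
      integral_congr_ae (ae_of_all _ fun z => by ring)
    have hI : Integrable (fun z => f z ^ 2 - 2 * c * f z) μ :=
      hf.sq.sub (hf.integrable.const_mul _)
    rw [h1, integral_add hI (integrable_const _),
      integral_sub hf.sq (hf.integrable.const_mul _), integral_const_mul, integral_const] at h0
    simp only [smul_eq_mul] at h0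
    change 0 ≤ normSqK Λ f - 2 * c * meanVal Λ f + _ at h0
    linarith
  have := discrim_le_zero h
  rw [discrim] at this
  linarith

/-- The one-point projection of a square integrable kernel is square integrable. -/
lemma memLp_proj {m : ℕ} {f : (Fin (m + 1) → X) → ℝ} (hf : IsKernel Λ f) :
    MemLp (fun x => meanVal Λ (sect f x)) 2 Λ := by
  rw [memLp_two_iff_integrable_sq
    (stronglyMeasurable_meanVal_sect Λ hf.measurable).aestronglyMeasurable]
  refine Integrable.mono' (hf.normSqK_succ.1.const_mul
    ((Measure.pi fun _ : Fin m => Λ).real Set.univ))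
    ((stronglyMeasurable_meanVal_sect Λ hf.measurable).pow 2).aestronglyMeasurable ?_
  filter_upwards [hf.sect_ae] with x hx
  rw [Real.norm_of_nonneg (sq_nonneg _)]
  exact hx.sq_meanVal_le

end IsKernel

variable [MeasurableSingletonClass X] [MeasurableSpace.CountablySeparated X]
  {Ω : Type*} [MeasurableSpace Ω] {η : Ω → Measure X} {Λ : Measure X} {P : Measure Ω}
  [IsProbabilityMeasure P] [IsFiniteMeasure Λ]

namespace IsFinitePoisson

/-- Campbell's formula for nonnegative functions. -/
lemma lintegral_pointSum (h : IsFinitePoisson η Λ P) {m : ℕ} {f : (Fin m → X) → ℝ}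
    (hfm : Measurable f) (hf : IsSymm m f) (h0 : ∀ x, 0 ≤ f x) :
    ∫⁻ ω, ENNReal.ofReal (pointSum m f (η ω)) ∂P =
      ∫⁻ z, ENNReal.ofReal (f z) ∂(Measure.pi fun _ => Λ) := by
  induction m with
  | zero =>
    simp only [pointSum_zero]
    rw [Measure.pi_of_empty (fun _ => Λ) Fin.elim0,
      lintegral_dirac' _ hfm.ennreal_ofReal]
    simp
  | succ m ih =>
    have h1 := h.lintegral_pointSum_mul hfm hf h0 (G := fun _ => 1) measurable_const
    simp only [mul_one] at h1
    rw [h1, lintegral_pi_succ Λ hfm.ennreal_ofReal]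
    refine lintegral_congr fun x => ?_
    exact ih (measurable_sect hfm x) (hf.sect x) (fun _ => h0 _)

lemma lintegral_pointSum_zero_mul_le {t : ℝ≥0} (h : IsFinitePoisson η (t • Λ) P) {m : ℕ}
    {f : (Fin 0 → X) → ℝ} {g : (Fin m → X) → ℝ} (hgm : Measurable g) (hg : IsSymm m g)
    (hg0 : ∀ x, 0 ≤ g x) (hf0 : ∀ x, 0 ≤ f x) :
    ∫⁻ ω, ENNReal.ofReal (pointSum 0 f (η ω)) * ENNReal.ofReal (pointSum m g (η ω)) ∂P ≤
      (1 + (Measure.pi fun _ : Fin m => Λ) Set.univ) * t ^ m *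
        (enormSqK Λ f + enormSqK Λ g) := by
  simp only [pointSum_zero]
  have hf : enormSqK Λ f = ENNReal.ofReal (f Fin.elim0 ^ 2) := by
    rw [enormSqK, Measure.pi_of_empty (fun _ => Λ) Fin.elim0, lintegral_dirac]
  rw [lintegral_const_mul _ (h.measurable_pointSum hgm).ennreal_ofReal,
    h.lintegral_pointSum hgm hg hg0, pi_smul_measure, lintegral_smul_measure, ENNReal.smul_def,
    smul_eq_mul, mul_left_comm, ← lintegral_const_mul _ hgm.ennreal_ofReal,
    mul_comm (1 + _) ((t : ℝ≥0∞) ^ m), mul_assoc, ENNReal.coe_pow]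
  refine mul_le_mul_right ?_ _
  calc ∫⁻ z, ENNReal.ofReal (f Fin.elim0) * ENNReal.ofReal (g z) ∂(Measure.pi fun _ => Λ)
      ≤ ∫⁻ z, (ENNReal.ofReal (f Fin.elim0 ^ 2) + ENNReal.ofReal (g z ^ 2))
          ∂(Measure.pi fun _ => Λ) := by
        refine lintegral_mono fun z => ?_
        rw [← ENNReal.ofReal_mul (hf0 _), ← ENNReal.ofReal_add (sq_nonneg _) (sq_nonneg _)]
        exact ENNReal.ofReal_le_ofReal (by nlinarith [sq_nonneg (f Fin.elim0 - g z)])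
    _ = ENNReal.ofReal (f Fin.elim0 ^ 2) * (Measure.pi fun _ : Fin m => Λ) Set.univ
          + enormSqK Λ g := by
        rw [lintegral_add_left measurable_const, lintegral_const, enormSqK]
    _ ≤ _ := by
        rw [hf, mul_add, add_mul, add_mul, one_mul, one_mul]
        refine add_le_add ?_ le_self_add
        rw [mul_comm]
        exact le_add_self

/-- A rough bound on mixed second moments, of the right order in the intensity. -/
lemma exists_lintegral_pointSum_mul_le (Λ : Measure X) [IsFiniteMeasure Λ] (m : ℕ) :
    ∀ m' : ℕ, ∃ C : ℝ≥0, ∀ {t : ℝ≥0} (_ : 1 ≤ t) {η : Ω → Measure X}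
      (_ : IsFinitePoisson η (t • Λ) P)
      {f : (Fin m → X) → ℝ} {g : (Fin m' → X) → ℝ} (_ : Measurable f) (_ : IsSymm m f)
      (_ : ∀ x, 0 ≤ f x) (_ : Measurable g) (_ : IsSymm m' g) (_ : ∀ x, 0 ≤ g x),
      ∫⁻ ω, ENNReal.ofReal (pointSum m f (η ω)) * ENNReal.ofReal (pointSum m' g (η ω)) ∂P ≤
        C * t ^ (m + m') * (enormSqK Λ f + enormSqK Λ g) := by
  induction m with
  | zero =>
    intro m'
    refine ⟨1 + ((Measure.pi fun _ : Fin m' => Λ) Set.univ).toNNReal, ?_⟩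
    intro t ht η h f g hfm hf hf0 hgm hg hg0
    refine (h.lintegral_pointSum_zero_mul_le hgm hg hg0 hf0).trans (le_of_eq ?_)
    rw [ENNReal.coe_add, ENNReal.coe_toNNReal (measure_ne_top _ _), ENNReal.coe_one, zero_add]
  | succ m ih =>
    intro m'
    cases m' with
    | zero =>
      refine ⟨1 + ((Measure.pi fun _ : Fin (m + 1) => Λ) Set.univ).toNNReal, ?_⟩
      intro t ht η h f g hfm hf hf0 hgm hg hg0
      have := h.lintegral_pointSum_zero_mul_le (f := g) hfm hf hf0 hg0
      simp only [mul_comm (ENNReal.ofReal (pointSum (m + 1) f _))]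
      refine this.trans (le_of_eq ?_)
      rw [ENNReal.coe_add, ENNReal.coe_toNNReal (measure_ne_top _ _), ENNReal.coe_one,
        add_comm (enormSqK Λ f), add_zero]
    | succ m' =>
      obtain ⟨C₁, hC₁⟩ := ih (m' + 1)
      obtain ⟨C₂, hC₂⟩ := ih m'
      refine ⟨C₁ * (1 + (Λ Set.univ).toNNReal) + (m' + 1) * C₂, ?_⟩
      intro t ht η h f g hfm hf hf0 hgm hg hg0
      have hfin := h.finite
      have ht' : (1 : ℝ≥0∞) ≤ t := by exact_mod_cast ht
      rw [h.lintegral_pointSum_mul hfm hf hf0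
        (G := fun μ => ENNReal.ofReal (pointSum (m' + 1) g μ))
        (PoissonFlats.measurable_pointSum hgm).ennreal_ofReal]
      have hle : ∀ x, ∫⁻ ω, ENNReal.ofReal (pointSum m (sect f x) (η ω)) *
          ENNReal.ofReal (pointSum (m' + 1) g (η ω + Measure.dirac x)) ∂P ≤
          t ^ (m + m' + 1) * (C₁ * (enormSqK Λ (sect f x) + enormSqK Λ g) +
            (m' + 1) * C₂ * (enormSqK Λ (sect f x) + enormSqK Λ (sect g x))) := by
        intro x
        have e : ∀ ω, ENNReal.ofReal (pointSum m (sect f x) (η ω)) *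
            ENNReal.ofReal (pointSum (m' + 1) g (η ω + Measure.dirac x)) =
            ENNReal.ofReal (pointSum m (sect f x) (η ω)) *
              ENNReal.ofReal (pointSum (m' + 1) g (η ω)) +
            (m' + 1) * (ENNReal.ofReal (pointSum m (sect f x) (η ω)) *
              ENNReal.ofReal (pointSum m' (sect g x) (η ω))) := by
          intro ω
          have p1 := pointSum_nonneg hg hg0 (h.integer_valued ω)
          have p2 := pointSum_nonneg (hg.sect x) (fun _ => hg0 _) (h.integer_valued ω)
          rw [pointSum_add_dirac hg x (h.integer_valued ω), ENNReal.ofReal_add p1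
            (mul_nonneg (by positivity) p2), ENNReal.ofReal_mul (by positivity),
            ENNReal.ofReal_add (by positivity) zero_le_one, ENNReal.ofReal_natCast,
            ENNReal.ofReal_one]
          ring
        simp only [e]
        have m1 : Measurable fun ω => ENNReal.ofReal (pointSum m (sect f x) (η ω)) *
            ENNReal.ofReal (pointSum (m' + 1) g (η ω)) :=
          (h.measurable_pointSum (measurable_sect hfm x)).ennreal_ofReal.mul
            (h.measurable_pointSum hgm).ennreal_ofReal
        have m2 : Measurable fun ω => ENNReal.ofReal (pointSum m (sect f x) (η ω)) *
            ENNReal.ofReal (pointSum m' (sect g x) (η ω)) :=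
          (h.measurable_pointSum (measurable_sect hfm x)).ennreal_ofReal.mul
            (h.measurable_pointSum (measurable_sect hgm x)).ennreal_ofReal
        rw [lintegral_add_left m1, lintegral_const_mul _ m2]
        refine (add_le_add (hC₁ ht h (measurable_sect hfm x) (hf.sect x) (fun _ => hf0 _)
          hgm hg hg0) (mul_le_mul_right (hC₂ ht h (measurable_sect hfm x) (hf.sect x)
            (fun _ => hf0 _) (measurable_sect hgm x) (hg.sect x) (fun _ => hg0 _)) _)).trans ?_
        have hp : (t : ℝ≥0∞) ^ (m + m') ≤ t ^ (m + m' + 1) :=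
          pow_le_pow_right₀ ht' (Nat.le_succ _)
        refine (add_le_add (le_of_eq ?_) ?_).trans (le_of_eq (mul_add _ _ _).symm)
        · ring
        calc _ = (t : ℝ≥0∞) ^ (m + m') * ((m' + 1) * C₂ *
              (enormSqK Λ (sect f x) + enormSqK Λ (sect g x))) := by ring
          _ ≤ _ := by gcongr
      refine (lintegral_mono hle).trans ?_
      have mf := measurable_enormSqK_sect Λ hfm
      have mg := measurable_enormSqK_sect Λ hgm
      have m1 : Measurable fun x => enormSqK Λ (sect f x) + enormSqK Λ (sect g x) := mf.add mg
      have m2 : Measurable fun x => C₁ * (enormSqK Λ (sect f x) + enormSqK Λ g) +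
            (m' + 1) * C₂ * (enormSqK Λ (sect f x) + enormSqK Λ (sect g x)) :=
        ((mf.add_const _).const_mul _).add (m1.const_mul _)
      rw [lintegral_const_mul _ m2, lintegral_smul_measure, ENNReal.smul_def, smul_eq_mul,
        lintegral_add_left ((mf.add_const _).const_mul _), lintegral_const_mul _
        (mf.add_const _), lintegral_add_left mf, lintegral_const, 
        lintegral_const_mul _ m1, lintegral_add_left mf,
        ← enormSqK_succ Λ hfm, ← enormSqK_succ Λ hgm]
      push_cast
      rw [ENNReal.coe_toNNReal (measure_ne_top _ _)]
      have key : C₁ * (enormSqK Λ f + enormSqK Λ g * Λ Set.univ) ≤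
          C₁ * ((1 + Λ Set.univ) * (enormSqK Λ f + enormSqK Λ g)) := by
        refine mul_le_mul_right ?_ _
        rw [add_mul, one_mul, mul_add (Λ Set.univ), add_assoc]
        refine add_le_add le_rfl ?_
        rw [mul_comm (enormSqK Λ g)]
        exact le_add_left le_add_self
      refine (mul_le_mul_right (mul_le_mul_right (add_le_add_left key _) _) _).trans
        (le_of_eq ?_)
      ring

end IsFinitePoisson

end Moments

/-! ### The projection onto the first chaos -/

section Projection

universe u

variable {X : Type u} [MeasurableSpace X] [MeasurableSingletonClass X]
  [MeasurableSpace.CountablySeparated X]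
  {Ω : Type*} [MeasurableSpace Ω] {η : Ω → Measure X} {Λ : Measure X} {P : Measure Ω}
  [IsProbabilityMeasure P] [IsFiniteMeasure Λ]

omit [MeasurableSingletonClass X] [MeasurableSpace.CountablySeparated X] [IsFiniteMeasure Λ] in
lemma enorm_mul_le_ofReal_mul {a b a' b' : ℝ} (ha : |a| ≤ a') (hb : |b| ≤ b') :
    ‖a * b‖ₑ ≤ ENNReal.ofReal a' * ENNReal.ofReal b' := by
  rw [enorm_mul, Real.enorm_eq_ofReal_abs, Real.enorm_eq_ofReal_abs]
  exact mul_le_mul' (ENNReal.ofReal_le_ofReal ha) (ENNReal.ofReal_le_ofReal hb)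

namespace IsFinitePoisson

lemma exists_lintegral_enorm_pointSum_mul_le (P : Measure Ω) [IsProbabilityMeasure P]
    (Λ : Measure X) [IsFiniteMeasure Λ] (m m' : ℕ) :
    ∃ C : ℝ≥0, ∀ {t : ℝ≥0} (_ : 1 ≤ t) {η : Ω → Measure X} (_ : IsFinitePoisson η (t • Λ) P)
      {f : (Fin m → X) → ℝ} {g : (Fin m' → X) → ℝ} (_ : IsKernel Λ f) (_ : IsKernel Λ g),
      ∫⁻ ω, ‖pointSum m f (η ω) * pointSum m' g (η ω)‖ₑ ∂P ≤
        ENNReal.ofReal (C * t ^ (m + m') * (normSqK Λ f + normSqK Λ g)) := by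
  obtain ⟨C, hC⟩ := exists_lintegral_pointSum_mul_le (P := P) Λ m m'
  refine ⟨C, fun {t} ht {η} h {f g} hf hg => ?_⟩
  have hfin := h.finite
  have h1 := hC ht h hf.abs.measurable hf.abs.symm (fun _ => abs_nonneg _)
    hg.abs.measurable hg.abs.symm (fun _ => abs_nonneg _)
  have e : (C : ℝ≥0∞) * t ^ (m + m') * (enormSqK Λ (fun z => |f z|) + enormSqK Λ fun z => |g z|) =
      ENNReal.ofReal (C * t ^ (m + m') * (normSqK Λ f + normSqK Λ g)) := by
    have e1 : enormSqK Λ (fun z => |f z|) = ENNReal.ofReal (normSqK Λ f) := by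
      rw [← hf.enormSqK_eq]; simp only [enormSqK, sq_abs]
    have e2 : enormSqK Λ (fun z => |g z|) = ENNReal.ofReal (normSqK Λ g) := by
      rw [← hg.enormSqK_eq]; simp only [enormSqK, sq_abs]
    rw [e1, e2, ← ENNReal.ofReal_add (normSqK_nonneg _ _) (normSqK_nonneg _ _),
      ENNReal.ofReal_mul (by positivity), ENNReal.ofReal_mul (by positivity),
      ENNReal.ofReal_coe_nnreal, ENNReal.ofReal_pow (by positivity), ENNReal.ofReal_coe_nnreal]
  rw [← e]
  refine (lintegral_mono fun ω => ?_).trans h1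
  exact enorm_mul_le_ofReal_mul (abs_pointSum_le hf.symm (h.integer_valued ω))
    (abs_pointSum_le hg.symm (h.integer_valued ω))

lemma exists_abs_integral_pointSum_mul_le (P : Measure Ω) [IsProbabilityMeasure P]
    (Λ : Measure X) [IsFiniteMeasure Λ] (m m' : ℕ) :
    ∃ C : ℝ≥0, ∀ {t : ℝ≥0} (_ : 1 ≤ t) {η : Ω → Measure X} (_ : IsFinitePoisson η (t • Λ) P)
      {f : (Fin m → X) → ℝ} {g : (Fin m' → X) → ℝ} (_ : IsKernel Λ f) (_ : IsKernel Λ g),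
      |∫ ω, pointSum m f (η ω) * pointSum m' g (η ω) ∂P| ≤
        C * t ^ (m + m') * (normSqK Λ f + normSqK Λ g) := by
  obtain ⟨C, hC⟩ := exists_lintegral_enorm_pointSum_mul_le P Λ m m'
  refine ⟨C, fun {t} ht {η} h {f g} hf hg => ?_⟩
  have h1 := (enorm_integral_le_lintegral_enorm _).trans (hC ht h hf hg)
  rw [Real.enorm_eq_ofReal_abs] at h1
  refine (ENNReal.ofReal_le_ofReal_iff ?_).1 h1
  have := normSqK_nonneg Λ f
  have := normSqK_nonneg Λ g
  positivity

/-- Factorial integrals of square integrable kernels are square integrable. -/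
lemma memLp_pointSum {t : ℝ≥0} (ht : 1 ≤ t) (h : IsFinitePoisson η (t • Λ) P) {m : ℕ}
    {f : (Fin m → X) → ℝ} (hf : IsKernel Λ f) : MemLp (fun ω => pointSum m f (η ω)) 2 P := by
  obtain ⟨C, hC⟩ := exists_lintegral_enorm_pointSum_mul_le P Λ m m
  have hm := h.measurable_pointSum hf.measurable
  rw [memLp_two_iff_integrable_sq hm.aestronglyMeasurable]
  refine ⟨(hm.pow_const 2).aestronglyMeasurable, ?_⟩
  rw [hasFiniteIntegral_iff_enorm]
  simp only [sq]
  exact (hC ht h hf hf).trans_lt ENNReal.ofReal_lt_top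

lemma integral_pointSum_mul_of_memLp {t : ℝ≥0} (ht : 1 ≤ t) (h : IsFinitePoisson η (t • Λ) P)
    {m : ℕ} {f : (Fin (m + 1) → X) → ℝ} (hf : IsKernel Λ f) {G : Measure X → ℝ}
    (hG : Measurable G) (hG2 : MemLp (fun ω => G (η ω)) 2 P) :
    Integrable (fun p : X × Ω => pointSum m (sect f p.1) (η p.2) * G (η p.2 + Measure.dirac p.1))
      ((t • Λ).prod P) ∧
    ∫ ω, pointSum (m + 1) f (η ω) * G (η ω) ∂P =
      t * ∫ x, ∫ ω, pointSum m (sect f x) (η ω) * G (η ω + Measure.dirac x) ∂P ∂Λ := by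
  have hfin := h.finite
  have h1 := h.integral_pointSum_mul hf.measurable hf.symm hG ?_
  · refine ⟨h1.2.1, h1.2.2.trans ?_⟩
    rw [integral_smul_nnreal_measure]
    rfl
  · have h2 := h.lintegral_pointSum_mul hf.abs.measurable hf.abs.symm (fun _ => abs_nonneg _)
      (G := fun μ => ‖G μ‖ₑ) hG.enorm
    have h3 : ∫⁻ ω, ENNReal.ofReal (pointSum (m + 1) (fun z => |f z|) (η ω)) * ‖G (η ω)‖ₑ ∂P ≠
        ∞ := by
      have := (h.memLp_pointSum ht hf.abs).integrable_mul hG2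
      refine ne_of_lt (lt_of_eq_of_lt (lintegral_congr fun ω => ?_) this.2)
      simp only [Pi.mul_apply]
      rw [enorm_mul, Real.enorm_eq_ofReal (pointSum_nonneg hf.abs.symm (fun _ => abs_nonneg _)
        (h.integer_valued ω))]
    rw [h2] at h3
    refine ne_top_of_le_ne_top h3 (lintegral_mono fun x => lintegral_mono fun ω => ?_)
    rw [enorm_mul, Real.enorm_eq_ofReal_abs]
    exact mul_le_mul_left (ENNReal.ofReal_le_ofReal
      (abs_pointSum_le (hf.symm.sect x) (h.integer_valued ω))) _

/-- If the functional `G` is centred and the correlations of its add-one-cost `D_x G` with factorial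
integrals are controlled, then so are the correlations of `G` itself; one order of the
intensity is saved, since the integral of `G` against a constant vanishes. -/
lemma exists_abs_integral_pointSum_mul_centred_le (P : Measure Ω) [IsProbabilityMeasure P]
    (Λ : Measure X) [IsFiniteMeasure Λ] (A : ℕ → ℝ) (hA : ∀ j, 0 ≤ A j) (m : ℕ) :
    ∃ A' : ℝ, 0 ≤ A' ∧ ∀ {t : ℝ≥0} (_ : 1 ≤ t) {η : Ω → Measure X}
      (_ : IsFinitePoisson η (t • Λ) P) {G : Measure X → ℝ} (_ : Measurable G)
      (_ : MemLp (fun ω => G (η ω)) 2 P) (_ : ∫ ω, G (η ω) ∂P = 0)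
      {b : X → ℝ} (_ : Integrable b Λ) (_ : ∀ x, 0 ≤ b x) {s : ℝ} (_ : 0 ≤ s)
      (_ : ∀ᵐ x ∂Λ, MemLp (fun ω => G (η ω + Measure.dirac x) - G (η ω)) 2 P ∧
        ∀ (j : ℕ) (k : (Fin j → X) → ℝ), IsKernel Λ k →
          |∫ ω, pointSum j k (η ω) * (G (η ω + Measure.dirac x) - G (η ω)) ∂P| ≤
            A j * t ^ j * s * (normSqK Λ k + b x))
      {f : (Fin m → X) → ℝ} (_ : IsKernel Λ f),
      |∫ ω, pointSum m f (η ω) * G (η ω) ∂P| ≤ A' * t ^ m * s * (normSqK Λ f + ∫ x, b x ∂Λ) := by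
  induction m with
  | zero =>
    refine ⟨0, le_rfl, ?_⟩
    intro t ht η h G hG hG2 hG0 b hb hb0 s hs hD f hf
    simp only [pointSum_zero]
    rw [integral_const_mul, hG0]
    simp
  | succ m ih =>
    obtain ⟨A', hA', hih⟩ := ih
    refine ⟨A' * (1 + Λ.real Set.univ) + A m, by have := hA m; positivity, ?_⟩
    intro t ht η h G hG hG2 hG0 b hb hb0 s hs hD f hf
    have hfin := h.finite
    obtain ⟨hI, heq⟩ := h.integral_pointSum_mul_of_memLp ht hf hG hG2
    rw [heq, abs_mul, abs_of_nonneg t.coe_nonneg]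
    set β := ∫ x, b x ∂Λ with hβ
    have hN := hf.normSqK_succ
    have hbd : Integrable (fun x => A' * t ^ m * s * (normSqK Λ (sect f x) + β) +
        A m * t ^ m * s * (normSqK Λ (sect f x) + b x)) Λ :=
      ((hN.1.add (integrable_const _)).const_mul _).add ((hN.1.add hb).const_mul _)
    have hle : ∀ᵐ x ∂Λ, ‖∫ ω, pointSum m (sect f x) (η ω) * G (η ω + Measure.dirac x) ∂P‖ ≤
        A' * t ^ m * s * (normSqK Λ (sect f x) + β) +
          A m * t ^ m * s * (normSqK Λ (sect f x) + b x) := by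
      filter_upwards [hf.sect_ae, hD] with x hx hDx
      have hs2 := h.memLp_pointSum ht hx
      have e : ∀ ω, pointSum m (sect f x) (η ω) * G (η ω + Measure.dirac x) =
          pointSum m (sect f x) (η ω) * G (η ω) +
            pointSum m (sect f x) (η ω) * (G (η ω + Measure.dirac x) - G (η ω)) :=
        fun ω => by ring
      have i1 : Integrable (fun ω => pointSum m (sect f x) (η ω) * G (η ω)) P :=
        hs2.integrable_mul hG2
      have i2 : Integrable (fun ω => pointSum m (sect f x) (η ω) *
          (G (η ω + Measure.dirac x) - G (η ω))) P := hs2.integrable_mul hDx.1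
      simp only [e]
      rw [integral_add i1 i2]
      exact (norm_add_le _ _).trans (add_le_add (hih ht h hG hG2 hG0 hb hb0 hs hD hx)
        (hDx.2 m _ hx))
    have h1 := norm_integral_le_of_norm_le hbd hle
    rw [Real.norm_eq_abs] at h1
    have i3 : Integrable (fun x => A' * t ^ m * s * (normSqK Λ (sect f x) + β)) Λ :=
      (hN.1.add (integrable_const _)).const_mul _
    have i4 : Integrable (fun x => A m * t ^ m * s * (normSqK Λ (sect f x) + b x)) Λ :=
      (hN.1.add hb).const_mul _
    rw [integral_add i3 i4, integral_const_mul, integral_const_mul,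
      integral_add hN.1 (integrable_const _), integral_add hN.1 hb, integral_const, ← hN.2,
      smul_eq_mul, ← hβ] at h1
    have hβ0 : 0 ≤ β := integral_nonneg hb0
    have hN0 := normSqK_nonneg Λ f
    have hU : 0 ≤ Λ.real Set.univ := measureReal_nonneg
    have h2 : normSqK Λ f + Λ.real Set.univ * β ≤
        (1 + Λ.real Set.univ) * (normSqK Λ f + β) := by nlinarith [mul_nonneg hU hN0]
    have hc : 0 ≤ A' * t ^ m * s := by positivity
    calc _ ≤ t * (A' * t ^ m * s * ((1 + Λ.real Set.univ) * (normSqK Λ f + β)) +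
          A m * t ^ m * s * (normSqK Λ f + β)) :=
          mul_le_mul_of_nonneg_left (h1.trans (by gcongr)) t.coe_nonneg
      _ = _ := by ring

/-- Campbell's formula. -/
lemma integral_pointSum {t : ℝ≥0} (ht : 1 ≤ t) (h : IsFinitePoisson η (t • Λ) P) {m : ℕ}
    {f : (Fin m → X) → ℝ} (hf : IsKernel Λ f) :
    ∫ ω, pointSum m f (η ω) ∂P = t ^ m * meanVal Λ f := by
  induction m with
  | zero => simp [pointSum_zero, meanVal_zero]
  | succ m ih =>
    have h1 := (h.integral_pointSum_mul_of_memLp ht hf (G := fun _ => 1) measurable_const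
      (memLp_const _)).2
    simp only [mul_one] at h1
    rw [h1, meanVal_succ Λ hf.integrable, pow_succ', mul_assoc,
      ← integral_const_mul ((t : ℝ) ^ m)]
    congr 1
    refine integral_congr_ae ?_
    filter_upwards [hf.sect_ae] with x hx using ih hx

lemma memLp_pointSum_sub {t : ℝ≥0} (ht : 1 ≤ t) (h : IsFinitePoisson η (t • Λ) P) {m : ℕ}
    {f : (Fin m → X) → ℝ} (hf : IsKernel Λ f) (c : ℝ) :
    MemLp (fun ω => pointSum m f (η ω) - c) 2 P :=
  (h.memLp_pointSum ht hf).sub (memLp_const _)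

/-- Covariances of factorial integrals are smaller by a factor `1 / t` than the products of the
means. -/
lemma exists_abs_covariance_pointSum_le (P : Measure Ω) [IsProbabilityMeasure P]
    (Λ : Measure X) [IsFiniteMeasure Λ] (m m' : ℕ) :
    ∃ C : ℝ, 0 ≤ C ∧ ∀ {t : ℝ≥0} (_ : 1 ≤ t) {η : Ω → Measure X} (_ : IsFinitePoisson η (t • Λ) P)
      {f : (Fin m → X) → ℝ} {g : (Fin (m' + 1) → X) → ℝ} (_ : IsKernel Λ f) (_ : IsKernel Λ g),
      |∫ ω, pointSum m f (η ω) * (pointSum (m' + 1) g (η ω) - t ^ (m' + 1) * meanVal Λ g) ∂P| ≤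
        C * t ^ (m + m') * (normSqK Λ f + normSqK Λ g) := by
  choose B hB using fun j => exists_abs_integral_pointSum_mul_le P Λ j m'
  obtain ⟨A', hA', h'⟩ := exists_abs_integral_pointSum_mul_centred_le P Λ
    (fun j => (m' + 1) * B j) (fun j => by positivity) m
  refine ⟨A', hA', fun {t} ht {η} h {f g} hf hg => ?_⟩
  have hfin := h.finite
  have hD : ∀ x ω, pointSum (m' + 1) g (η ω + Measure.dirac x) - t ^ (m' + 1) * meanVal Λ g -
      (pointSum (m' + 1) g (η ω) - t ^ (m' + 1) * meanVal Λ g) =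
        (m' + 1) * pointSum m' (sect g x) (η ω) := fun x ω => by
    rw [pointSum_add_dirac hg.symm x (h.integer_valued ω)]; ring
  have := h' ht h (G := fun μ => pointSum (m' + 1) g μ - t ^ (m' + 1) * meanVal Λ g)
    ((PoissonFlats.measurable_pointSum hg.measurable).sub_const _) (h.memLp_pointSum_sub ht hg _)
    ?_ (b := fun x => normSqK Λ (sect g x)) hg.normSqK_succ.1 (fun _ => normSqK_nonneg _ _)
    (s := t ^ m') (by positivity) ?_ hf
  · rw [hg.normSqK_succ.2, pow_add _ m m', ← mul_assoc]
    exact this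
  · rw [integral_sub ((h.memLp_pointSum ht hg).integrable one_le_two) (integrable_const _),
      h.integral_pointSum ht hg]
    simp
  · filter_upwards [hg.sect_ae] with x hx
    simp only [hD]
    refine ⟨(h.memLp_pointSum ht hx).const_mul _, fun j k hk => ?_⟩
    have e : ∀ ω, pointSum j k (η ω) * ((m' + 1) * pointSum m' (sect g x) (η ω)) =
        (m' + 1) * (pointSum j k (η ω) * pointSum m' (sect g x) (η ω)) := fun ω => by ring
    simp only [e]
    rw [integral_const_mul, abs_mul, abs_of_nonneg (by positivity : (0 : ℝ) ≤ m' + 1)]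
    calc _ ≤ ((m' : ℝ) + 1) * (B j * t ^ (j + m') * (normSqK Λ k + normSqK Λ (sect g x))) :=
          mul_le_mul_of_nonneg_left (hB j ht h hk hx) (by positivity)
      _ = _ := by rw [pow_add]; ring

end IsFinitePoisson

/-- The projection of a kernel to its first argument, as a kernel of order one. -/
def firstProj (Λ : Measure X) {m : ℕ} (f : (Fin (m + 1) → X) → ℝ) (y : Fin 1 → X) : ℝ :=
  meanVal Λ (sect f (y 0))

omit [MeasurableSingletonClass X] [MeasurableSpace.CountablySeparated X] in
lemma IsKernel.firstProj {m : ℕ} {f : (Fin (m + 1) → X) → ℝ} (hf : IsKernel Λ f) :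
    IsKernel Λ (firstProj Λ f) := by
  refine ⟨(stronglyMeasurable_meanVal_sect Λ hf.measurable).measurable.comp
    (measurable_pi_apply 0), trivial, ?_⟩
  exact ((measurePreserving_funUnique Λ (Fin 1)).integrable_comp_emb
    (MeasurableEquiv.measurableEmbedding _)).2 hf.memLp_proj.integrable_sq

omit [MeasurableSingletonClass X] [MeasurableSpace.CountablySeparated X] in
lemma meanVal_firstProj {m : ℕ} {f : (Fin (m + 1) → X) → ℝ} (hf : IsKernel Λ f) :
    meanVal Λ (firstProj Λ f) = meanVal Λ f := by
  rw [meanVal_succ Λ hf.firstProj.integrable, meanVal_succ Λ hf.integrable]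
  refine integral_congr_ae (ae_of_all _ fun x => ?_)
  simp only [meanVal_zero]
  rfl

/-- The remainder of the first order expansion of a factorial integral around its mean. -/
def remainder (t : ℝ≥0) (Λ : Measure X) {m : ℕ} (f : (Fin (m + 1) → X) → ℝ) (μ : Measure X) : ℝ :=
  pointSum (m + 1) f μ - t ^ (m + 1) * meanVal Λ f -
    (m + 1) * t ^ m * (pointSum 1 (firstProj Λ f) μ - t * meanVal Λ f)

omit [MeasurableSingletonClass X] [MeasurableSpace.CountablySeparated X]
  [IsFiniteMeasure Λ] in
lemma measurable_remainder (t : ℝ≥0) {m : ℕ} {f : (Fin (m + 1) → X) → ℝ}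
    (hf : Measurable f) (hf' : Measurable (firstProj Λ f)) : Measurable (remainder t Λ f) :=
  ((measurable_pointSum hf).sub_const _).sub (((measurable_pointSum hf').sub_const _).const_mul _)

omit [MeasurableSingletonClass X] [MeasurableSpace.CountablySeparated X]
  [IsFiniteMeasure Λ] in
lemma remainder_of_one (t : ℝ≥0) (f : (Fin 1 → X) → ℝ) (μ : Measure X) :
    remainder t Λ f μ = 0 := by
  have : firstProj Λ f = f := by
    funext y
    rw [firstProj, meanVal_zero, sect]
    congr 1
    funext i
    rw [(Fin.fin_one_eq_zero i : i = 0)]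
    rfl
  rw [remainder, this]
  simp

namespace IsFinitePoisson

lemma memLp_remainder {t : ℝ≥0} (ht : 1 ≤ t) (h : IsFinitePoisson η (t • Λ) P) {m : ℕ}
    {f : (Fin (m + 1) → X) → ℝ} (hf : IsKernel Λ f) :
    MemLp (fun ω => remainder t Λ f (η ω)) 2 P :=
  (h.memLp_pointSum_sub ht hf _).sub ((h.memLp_pointSum_sub ht hf.firstProj _).const_mul _)

lemma integral_remainder {t : ℝ≥0} (ht : 1 ≤ t) (h : IsFinitePoisson η (t • Λ) P) {m : ℕ}
    {f : (Fin (m + 1) → X) → ℝ} (hf : IsKernel Λ f) :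
    ∫ ω, remainder t Λ f (η ω) ∂P = 0 := by
  have i1 := (h.memLp_pointSum_sub ht hf (t ^ (m + 1) * meanVal Λ f)).integrable one_le_two
  have i2 := (h.memLp_pointSum_sub ht hf.firstProj (t * meanVal Λ f)).integrable one_le_two
  simp only [remainder]
  rw [integral_sub i1 (i2.const_mul _), integral_const_mul,
    integral_sub ((h.memLp_pointSum ht hf).integrable one_le_two) (integrable_const _),
    integral_sub ((h.memLp_pointSum ht hf.firstProj).integrable one_le_two) (integrable_const _),
    h.integral_pointSum ht hf, h.integral_pointSum ht hf.firstProj, meanVal_firstProj hf]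
  simp

/-- Adding a point changes the remainder by a multiple of a centred factorial sum, so that the
covariance bound applies once more and a second factor `1 / t` is gained. -/
lemma exists_abs_integral_pointSum_mul_remainder_le (P : Measure Ω) [IsProbabilityMeasure P]
    (Λ : Measure X) [IsFiniteMeasure Λ] (m m' : ℕ) :
    ∃ C : ℝ, 0 ≤ C ∧ ∀ {t : ℝ≥0} (_ : 1 ≤ t) {η : Ω → Measure X} (_ : IsFinitePoisson η (t • Λ) P)
      {f : (Fin m → X) → ℝ} {g : (Fin (m' + 2) → X) → ℝ} (_ : IsKernel Λ f) (_ : IsKernel Λ g),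
      |∫ ω, pointSum m f (η ω) * remainder t Λ g (η ω) ∂P| ≤
        C * t ^ (m + m') * (normSqK Λ f + normSqK Λ g) := by
  choose B hB0 hB using fun j => exists_abs_covariance_pointSum_le P Λ j m'
  obtain ⟨A', hA', h'⟩ := exists_abs_integral_pointSum_mul_centred_le P Λ
    (fun j => (m' + 2) * B j) (fun j => mul_nonneg (by positivity) (hB0 j)) m
  refine ⟨A', hA', fun {t} ht {η} h {f g} hf hg => ?_⟩
  have hfin := h.finite
  have hD : ∀ x ω, remainder t Λ g (η ω + Measure.dirac x) - remainder t Λ g (η ω) =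
      (m' + 2) * (pointSum (m' + 1) (sect g x) (η ω) -
        t ^ (m' + 1) * meanVal Λ (sect g x)) := fun x ω => by
    have e : pointSum 0 (sect (firstProj Λ g) x) (η ω) = meanVal Λ (sect g x) := by
      rw [pointSum_zero]; rfl
    rw [remainder, remainder, pointSum_add_dirac hg.symm x (h.integer_valued ω),
      pointSum_add_dirac hg.firstProj.symm x (h.integer_valued ω), e]
    push_cast
    ring
  have := h' ht h (measurable_remainder t hg.measurable hg.firstProj.measurable)
    (h.memLp_remainder ht hg) (h.integral_remainder ht hg) (b := fun x => normSqK Λ (sect g x))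
    hg.normSqK_succ.1 (fun _ => normSqK_nonneg _ _) (s := t ^ m') (by positivity) ?_ hf
  · rw [hg.normSqK_succ.2, pow_add _ m m', ← mul_assoc]
    exact this
  · filter_upwards [hg.sect_ae] with x hx
    simp only [hD]
    refine ⟨(h.memLp_pointSum_sub ht hx _).const_mul _, fun j k hk => ?_⟩
    have e : ∀ ω, pointSum j k (η ω) * ((m' + 2) * (pointSum (m' + 1) (sect g x) (η ω) -
        t ^ (m' + 1) * meanVal Λ (sect g x))) =
        (m' + 2) * (pointSum j k (η ω) * (pointSum (m' + 1) (sect g x) (η ω) -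
        t ^ (m' + 1) * meanVal Λ (sect g x))) := fun ω => by ring
    simp only [e]
    rw [integral_const_mul, abs_mul, abs_of_nonneg (by positivity : (0 : ℝ) ≤ m' + 2)]
    calc _ ≤ ((m' : ℝ) + 2) * (B j * t ^ (j + m') * (normSqK Λ k + normSqK Λ (sect g x))) :=
          mul_le_mul_of_nonneg_left (hB j ht h hk hx) (by positivity)
      _ = _ := by rw [pow_add]; ring

/-- The remainder of the first order expansion is of smaller order than the linear part. -/
lemma exists_integral_remainder_sq_le (P : Measure Ω) [IsProbabilityMeasure P]
    (Λ : Measure X) [IsFiniteMeasure Λ] {m : ℕ} {f : (Fin (m + 1) → X) → ℝ}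
    (hf : IsKernel Λ f) :
    ∃ C : ℝ, 0 ≤ C ∧ ∀ {t : ℝ≥0} (_ : 1 ≤ t) {η : Ω → Measure X} (_ : IsFinitePoisson η (t • Λ) P),
      ∫ ω, remainder t Λ f (η ω) ^ 2 ∂P ≤ C * t ^ (2 * m) := by
  cases m with
  | zero =>
    refine ⟨0, le_rfl, fun {t} ht {η} h => ?_⟩
    simp [remainder_of_one]
  | succ m =>
    obtain ⟨A, hA, h1⟩ := exists_abs_integral_pointSum_mul_remainder_le P Λ (m + 2) m
    obtain ⟨B, hB, h2⟩ := exists_abs_integral_pointSum_mul_remainder_le P Λ 1 m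
    set N := normSqK Λ f
    set N' := normSqK Λ (firstProj Λ f)
    have hN : 0 ≤ N := normSqK_nonneg _ _
    have hN' : 0 ≤ N' := normSqK_nonneg _ _
    refine ⟨A * (N + N) + (m + 2) * (B * (N' + N)), by positivity, fun {t} ht {η} h => ?_⟩
    have hR := h.memLp_remainder ht hf
    have i1 : Integrable (fun ω => pointSum (m + 2) f (η ω) * remainder t Λ f (η ω)) P :=
      (h.memLp_pointSum ht hf).integrable_mul hR
    have i2 : Integrable (fun ω => pointSum 1 (firstProj Λ f) (η ω) * remainder t Λ f (η ω)) P :=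
      (h.memLp_pointSum ht hf.firstProj).integrable_mul hR
    have i3 : Integrable (fun ω => remainder t Λ f (η ω)) P := hR.integrable one_le_two
    have e : ∀ ω, remainder t Λ f (η ω) ^ 2 =
        pointSum (m + 2) f (η ω) * remainder t Λ f (η ω) -
        (m + 2) * t ^ (m + 1) * (pointSum 1 (firstProj Λ f) (η ω) * remainder t Λ f (η ω)) +
        (m + 1) * t ^ (m + 2) * meanVal Λ f * remainder t Λ f (η ω) := fun ω => by
      rw [sq]
      nth_rewrite 1 [remainder]
      push_cast
      ring
    have i4 : Integrable (fun ω => pointSum (m + 2) f (η ω) * remainder t Λ f (η ω) -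
        (m + 2) * t ^ (m + 1) * (pointSum 1 (firstProj Λ f) (η ω) * remainder t Λ f (η ω))) P :=
      i1.sub (i2.const_mul _)
    simp only [e]
    rw [integral_add i4 (i3.const_mul _), integral_sub i1 (i2.const_mul _), integral_const_mul,
      integral_const_mul, h.integral_remainder ht hf, mul_zero, add_zero]
    have b1 := (abs_le.1 (h1 ht h hf hf)).2
    have b2 := (abs_le.1 (h2 ht h hf.firstProj hf)).1
    have hc : (0 : ℝ) ≤ (m + 2) * t ^ (m + 1) := by positivity
    have b3 := mul_le_mul_of_nonneg_left b2 hc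
    calc _ ≤ A * t ^ (m + 2 + m) * (N + N) + (m + 2) * t ^ (m + 1) * (B * t ^ (1 + m) * (N' + N)) := by
          linarith
      _ = _ := by ring

end IsFinitePoisson

end Projection

/-! ### Linear functionals of a Poisson process -/

section Linear

universe u

variable {X : Type u} [MeasurableSpace X] [MeasurableSingletonClass X]

lemma pointSum_one {u : X → ℝ} {μ : Measure X} [MeasurableSpace.CountablySeparated X]
    [IsFiniteMeasure μ] (hμ : IsIntegerValued μ) :
    pointSum 1 (fun y => u (y 0)) μ = ∫ x, u x ∂μ := by
  obtain ⟨l, rfl⟩ := hμ.exists_listMeasure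
  have hs : IsSymm 1 fun y : Fin 1 → X => u (y 0) := trivial
  rw [pointSum_listMeasure hs, tupleSum_one, integral_listMeasure]
  simp only [Fin.cons_zero, List.get_eq_getElem, Fin.sum_univ_fun_getElem]

variable [MeasurableSpace.CountablySeparated X]
  {Ω : Type*} [MeasurableSpace Ω] {η : Ω → Measure X} {Λ : Measure X} {P : Measure Ω}
  [IsProbabilityMeasure P] [IsFiniteMeasure Λ]

omit [MeasurableSingletonClass X] [MeasurableSpace.CountablySeparated X] [IsFiniteMeasure Λ] in
lemma isKernel_one {u : X → ℝ} (hu : Measurable u) (hu2 : MemLp u 2 Λ) :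
    IsKernel Λ (fun y : Fin 1 → X => u (y 0)) :=
  ⟨hu.comp (measurable_pi_apply 0), trivial,
    ((measurePreserving_funUnique Λ (Fin 1)).integrable_comp_emb
      (MeasurableEquiv.measurableEmbedding _)).2 hu2.integrable_sq⟩

omit [MeasurableSingletonClass X] [MeasurableSpace.CountablySeparated X] in
lemma meanVal_one {u : X → ℝ} (hu : Measurable u) (hu2 : MemLp u 2 Λ) :
    meanVal Λ (fun y : Fin 1 → X => u (y 0)) = ∫ x, u x ∂Λ := by
  rw [meanVal_succ Λ (isKernel_one hu hu2).integrable]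
  refine integral_congr_ae (ae_of_all _ fun x => ?_)
  simp only [meanVal_zero]
  rfl

namespace IsFinitePoisson

omit [IsProbabilityMeasure P] [IsFiniteMeasure Λ] in
lemma integrable_point (h : IsFinitePoisson η Λ P) (ω : Ω) (u : X → ℝ) : Integrable u (η ω) := by
  have := h.finite
  obtain ⟨l, hl⟩ := (h.integer_valued ω).exists_listMeasure
  rw [hl]; exact integrable_listMeasure _ _

lemma memLp_linear (h : IsFinitePoisson η Λ P) {u : X → ℝ} (hu : Measurable u)
    (hu2 : MemLp u 2 Λ) : MemLp (fun ω => ∫ x, u x ∂η ω) 2 P := by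
  have := h.finite
  have h1 : IsFinitePoisson η ((1 : ℝ≥0) • Λ) P := by rwa [one_smul]
  have h2 := h1.memLp_pointSum le_rfl (isKernel_one hu hu2)
  simpa only [pointSum_one (h.integer_valued _)] using h2

lemma integral_linear (h : IsFinitePoisson η Λ P) {u : X → ℝ} (hu : Measurable u)
    (hu2 : MemLp u 2 Λ) : ∫ ω, ∫ x, u x ∂η ω ∂P = ∫ x, u x ∂Λ := by
  have := h.finite
  have h1 : IsFinitePoisson η ((1 : ℝ≥0) • Λ) P := by rwa [one_smul]
  have h2 := h1.integral_pointSum le_rfl (isKernel_one hu hu2)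
  simpa only [pointSum_one (h.integer_valued _), meanVal_one hu hu2, NNReal.coe_one, one_pow,
    one_mul] using h2

lemma integral_linear_mul (h : IsFinitePoisson η Λ P) {u v : X → ℝ} (hu : Measurable u)
    (hu2 : MemLp u 2 Λ) (hv : Measurable v) (hv2 : MemLp v 2 Λ) :
    ∫ ω, (∫ x, u x ∂η ω) * (∫ x, v x ∂η ω) ∂P =
      ∫ x, u x * v x ∂Λ + (∫ x, u x ∂Λ) * (∫ x, v x ∂Λ) := by
  have := h.finite
  have h1 : IsFinitePoisson η ((1 : ℝ≥0) • Λ) P := by rwa [one_smul]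
  have h2 := (h1.integral_pointSum_mul_of_memLp le_rfl (isKernel_one hu hu2)
    (G := pointSum 1 fun y => v (y 0)) (PoissonFlats.measurable_pointSum
      (isKernel_one hv hv2).measurable) (h1.memLp_pointSum le_rfl (isKernel_one hv hv2))).2
  simp only [pointSum_one (h.integer_valued _), pointSum_zero, NNReal.coe_one, one_mul,
    pointSum_add_dirac (isKernel_one hv hv2).symm _ (h.integer_valued _), integral_const_mul] at h2
  have huv : Integrable (fun x => u x * v x) Λ := hu2.integrable_mul hv2
  rw [h2, ← integral_mul_const, ← integral_add huv
    ((hu2.integrable one_le_two).mul_const _)]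
  refine integral_congr_ae (ae_of_all _ fun x => ?_)
  have i1 := (h.memLp_linear hv hv2).integrable one_le_two
  beta_reduce
  rw [integral_add i1 (integrable_const _), h.integral_linear hv hv2]
  simp only [Nat.cast_zero, zero_add, one_mul, integral_const, probReal_univ, one_smul]
  change u x * (_ + v x) = u x * v x + u x * _
  ring

omit [MeasurableSingletonClass X] [MeasurableSpace.CountablySeparated X] in
/-- The third moment of a linear functional of a Poisson process. -/
lemma lintegral_linear_pow_three (h : IsFinitePoisson η Λ P) {u : X → ℝ≥0∞} (hu : Measurable u) :
    ∫⁻ ω, (∫⁻ x, u x ∂η ω) ^ 3 ∂P = (∫⁻ x, u x ∂Λ) ^ 3 +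
      3 * (∫⁻ x, u x ∂Λ) * (∫⁻ x, u x ^ 2 ∂Λ) + ∫⁻ x, u x ^ 3 ∂Λ := by
  set a := ∫⁻ x, u x ∂Λ
  have hm : Measurable fun μ : Measure X => ∫⁻ x, u x ∂μ := Measure.measurable_lintegral hu
  have hm' : Measurable fun ω => ∫⁻ x, u x ∂η ω := hm.comp h.measurable
  have step : ∀ k, ∫⁻ ω, (∫⁻ x, u x ∂η ω) ^ (k + 1) ∂P =
      ∫⁻ x, u x * ∫⁻ ω, (∫⁻ y, u y ∂η ω + u x) ^ k ∂P ∂Λ := fun k => by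
    have hH : Measurable (Function.uncurry fun (x : X) (μ : Measure X) =>
        u x * (∫⁻ y, u y ∂μ) ^ k) :=
      (hu.comp measurable_fst).mul ((hm.comp measurable_snd).pow_const k)
    have h1 := h.lintegral_mecke hH
    have e : ∀ x ω, ∫⁻ y, u y ∂(η ω + Measure.dirac x) = ∫⁻ y, u y ∂η ω + u x := fun x ω => by
      rw [lintegral_add_measure, lintegral_dirac' _ hu]
    simp only [e, lintegral_mul_const _ hu] at h1
    simp only [pow_succ']
    rw [h1]
    refine lintegral_congr fun x => ?_
    rw [lintegral_const_mul _ ((hm'.add_const _).pow_const k)]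
  have s1 : ∫⁻ ω, (∫⁻ x, u x ∂η ω) ∂P = a := by
    have := step 0
    simpa using this
  have s2 : ∫⁻ ω, (∫⁻ x, u x ∂η ω) ^ 2 ∂P = a * a + ∫⁻ x, u x ^ 2 ∂Λ := by
    rw [step 1]
    have e : ∀ x, ∫⁻ ω, (∫⁻ y, u y ∂η ω + u x) ^ 1 ∂P = a + u x := fun x => by
      simp only [pow_one]
      rw [lintegral_add_left hm', s1]; simp
    simp only [e, mul_add, ← sq]
    rw [lintegral_add_left (hu.mul_const _), lintegral_mul_const _ hu, ← sq]
  rw [step 2]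
  have e : ∀ x, u x * ∫⁻ ω, (∫⁻ y, u y ∂η ω + u x) ^ 2 ∂P =
      u x * (a * a + ∫⁻ x, u x ^ 2 ∂Λ) + 2 * a * u x ^ 2 + u x ^ 3 := fun x => by
    have e1 : ∀ ω, (∫⁻ y, u y ∂η ω + u x) ^ 2 =
        (∫⁻ y, u y ∂η ω) ^ 2 + (2 * u x * (∫⁻ y, u y ∂η ω) + u x ^ 2) := fun ω => by ring
    simp only [e1]
    rw [lintegral_add_left (hm'.pow_const 2), lintegral_add_left (hm'.const_mul _),
      lintegral_const_mul _ hm', s1, s2]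
    simp only [lintegral_const, measure_univ, mul_one]
    ring
  simp only [e]
  have m1 : Measurable fun x => u x * (a * a + ∫⁻ x, u x ^ 2 ∂Λ) + 2 * a * u x ^ 2 :=
    (hu.mul_const _).add ((hu.pow_const 2).const_mul _)
  rw [lintegral_add_left m1, lintegral_add_left (hu.mul_const _), lintegral_mul_const _ hu,
    lintegral_const_mul _ (hu.pow_const 2)]
  ring

open Complex in
lemma integral_exp_linear_simpleFunc (h : IsFinitePoisson η Λ P) (u : SimpleFunc X ℝ) :
    ∫ ω, cexp ((∫ x, u x ∂η ω : ℝ) * I) ∂P = cexp (∫ x, (cexp (u x * I) - 1) ∂Λ) := by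
  have hB : ∀ c : u.range, MeasurableSet (u ⁻¹' {(c : ℝ)}) := fun c => u.measurableSet_preimage _
  have hd : Pairwise fun c c' : u.range => Disjoint (u ⁻¹' {(c : ℝ)}) (u ⁻¹' {(c' : ℝ)}) :=
    fun c c' hcc => Disjoint.preimage _ (Set.disjoint_singleton.2 fun h' => hcc (Subtype.ext h'))
  have h1 := h.map_pi hB hd
  have hfin := h.finite
  have hF : ∀ c : ℝ, Measurable fun y : ℝ≥0∞ => cexp ((y.toReal * c : ℝ) * I) := fun c => by
    fun_prop
  have e1 : ∀ ω, cexp ((∫ x, u x ∂η ω : ℝ) * I) =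
      ∏ c : u.range, cexp (((η ω (u ⁻¹' {(c : ℝ)})).toReal * c : ℝ) * I) := fun ω => by
    rw [SimpleFunc.integral_eq_sum u (h.integrable_point ω u), ← Complex.exp_sum,
      ← Finset.sum_mul, ← Complex.ofReal_sum, ← Finset.sum_coe_sort]
    rfl
  have e2 : ∀ (r : ℝ≥0) (c : ℝ), ∫ y, cexp ((y.toReal * c : ℝ) * I) ∂poissonENN r =
      cexp (r * (cexp (c * I) - 1)) := fun r c => by
    rw [← charFun_map_cast_poissonMeasure, charFun_apply_real, poissonENN,
      integral_map (Measurable.of_discrete).aemeasurable (hF c).aestronglyMeasurable,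
      integral_map (Measurable.of_discrete).aemeasurable (by fun_prop)]
    refine integral_congr_ae (ae_of_all _ fun n => ?_)
    simp only [ENNReal.toReal_natCast]
    push_cast
    ring_nf
  have hm : Measurable fun (ω : Ω) (c : u.range) => η ω (u ⁻¹' {(c : ℝ)}) :=
    measurable_pi_lambda _ fun c => measurable_eval h.measurable (hB c)
  have hG : Measurable fun y : u.range → ℝ≥0∞ =>
      ∏ c : u.range, cexp (((y c).toReal * (c : ℝ) : ℝ) * I) :=
    Finset.measurable_fun_prod _ fun c _ => (hF c).comp (measurable_pi_apply c)
  simp only [e1]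
  rw [← integral_map hm.aemeasurable (f := fun y : u.range → ℝ≥0∞ =>
      ∏ c : u.range, cexp (((y c).toReal * (c : ℝ) : ℝ) * I)) hG.aestronglyMeasurable, h1,
    integral_fintype_prod_eq_prod (𝕜 := ℂ) (fun (c : u.range) (y : ℝ≥0∞) =>
      cexp ((y.toReal * (c : ℝ) : ℝ) * I))]
  simp only [e2]
  rw [← Complex.exp_sum]
  congr 1
  have hint : Integrable u Λ := by
    have := u.integrable_of_isFiniteMeasure (μ := Λ)
    exact this
  have e3 := SimpleFunc.map_integral u (fun c : ℝ => cexp (c * I) - 1) hint (by simp)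
  rw [SimpleFunc.integral_eq_integral _ (SimpleFunc.integrable_of_isFiniteMeasure _)] at e3
  simp only [SimpleFunc.coe_map, Function.comp_apply] at e3
  rw [e3, ← Finset.sum_coe_sort u.range fun c : ℝ =>
    Λ.real (u ⁻¹' {c}) • (cexp (c * I) - 1)]
  refine Finset.sum_congr rfl fun c _ => ?_
  rw [Complex.real_smul]
  rfl

open Complex in
/-- The characteristic functional of a Poisson process. -/
lemma integral_exp_linear (h : IsFinitePoisson η Λ P) {u : X → ℝ} (hu : Measurable u) :
    ∫ ω, cexp ((∫ x, u x ∂η ω : ℝ) * I) ∂P = cexp (∫ x, (cexp (u x * I) - 1) ∂Λ) := by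
  have hfin := h.finite
  set v : ℕ → SimpleFunc X ℝ := fun n => hu.stronglyMeasurable.approx n
  have hv : ∀ x, Tendsto (fun n => v n x) atTop (𝓝 (u x)) :=
    hu.stronglyMeasurable.tendsto_approx
  have hml : ∀ u : X → ℝ, Measurable u → Measurable fun ω => ∫ x, u x ∂η ω := fun u hu => by
    have := h.measurable_pointSum (f := fun y : Fin 1 → X => u (y 0))
      (hu.comp (measurable_pi_apply 0))
    simpa only [pointSum_one (h.integer_valued _)] using this
  have t1 : Tendsto (fun n => ∫ ω, cexp ((∫ x, v n x ∂η ω : ℝ) * I) ∂P) atTop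
      (𝓝 (∫ ω, cexp ((∫ x, u x ∂η ω : ℝ) * I) ∂P)) := by
    refine tendsto_integral_of_dominated_convergence (fun _ => 1) (fun n => ?_)
      (integrable_const _) (fun n => ae_of_all _ fun ω => ?_) (ae_of_all _ fun ω => ?_)
    · have := hml _ (v n).measurable
      exact Measurable.aestronglyMeasurable (by fun_prop)
    · rw [Complex.norm_exp_ofReal_mul_I]
    · have : Tendsto (fun n => ∫ x, v n x ∂η ω) atTop (𝓝 (∫ x, u x ∂η ω)) := by
        obtain ⟨l, hl⟩ := (h.integer_valued ω).exists_listMeasure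
        simp only [hl, integral_listMeasure]
        exact tendsto_finsetSum _ fun i _ => hv _
      exact (continuous_exp.tendsto _).comp
        (((continuous_ofReal.tendsto _).comp this).mul_const I)
  have t2 : Tendsto (fun n => cexp (∫ x, (cexp (v n x * I) - 1) ∂Λ)) atTop
      (𝓝 (cexp (∫ x, (cexp (u x * I) - 1) ∂Λ))) := by
    refine (continuous_exp.tendsto _).comp ?_
    refine tendsto_integral_of_dominated_convergence (fun _ => 2) (fun n => ?_)
      (integrable_const _) (fun n => ae_of_all _ fun x => ?_) (ae_of_all _ fun x => ?_)
    · have := (v n).measurable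
      exact Measurable.aestronglyMeasurable (by fun_prop)
    · refine (norm_sub_le _ _).trans ?_
      rw [Complex.norm_exp_ofReal_mul_I, norm_one]
      norm_num
    · exact ((continuous_exp.tendsto _).comp
        (((continuous_ofReal.tendsto _).comp (hv x)).mul_const I)).sub_const 1
  simp only [h.integral_exp_linear_simpleFunc] at t1
  exact tendsto_nhds_unique t1 t2

end IsFinitePoisson

end Linear

/-! ### Taylor expansion of test functions -/

section Taylor

variable {l : ℕ}

/-- The `ℓ¹`-norm, to which bounds on partial derivatives are dual. -/
def norm1 (v : Fin l → ℝ) : ℝ := ∑ i, |v i|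

lemma norm1_nonneg (v : Fin l → ℝ) : 0 ≤ norm1 v := Finset.sum_nonneg fun _ _ => abs_nonneg _

lemma norm1_add_le (v w : Fin l → ℝ) : norm1 (v + w) ≤ norm1 v + norm1 w := by
  rw [norm1, norm1, norm1, ← Finset.sum_add_distrib]
  exact Finset.sum_le_sum fun i _ => abs_add_le _ _

lemma norm1_smul (c : ℝ) (v : Fin l → ℝ) : norm1 (c • v) = |c| * norm1 v := by
  simp only [norm1, Pi.smul_apply, smul_eq_mul, abs_mul, Finset.mul_sum]

lemma norm1_zero : norm1 (0 : Fin l → ℝ) = 0 := by simp [norm1]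

lemma continuous_norm1 : Continuous (norm1 : (Fin l → ℝ) → ℝ) :=
  continuous_finsetSum _ fun i _ => (continuous_apply i).abs

lemma abs_le_norm1 (v : Fin l → ℝ) (i : Fin l) : |v i| ≤ norm1 v :=
  Finset.single_le_sum (f := fun i => |v i|) (fun _ _ => abs_nonneg _) (Finset.mem_univ i)

lemma eq_sum_single (v : Fin l → ℝ) : v = ∑ i, v i • (Pi.single i 1 : Fin l → ℝ) := by
  funext j
  simp [Finset.sum_apply, Pi.single_apply]

lemma clm_apply_eq_sum (A : (Fin l → ℝ) →L[ℝ] ℝ) (v : Fin l → ℝ) :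
    A v = ∑ i, v i * A (Pi.single i 1) := by
  conv_lhs => rw [eq_sum_single v]
  rw [map_sum]
  exact Finset.sum_congr rfl fun i _ => by rw [map_smul, smul_eq_mul]

lemma bilin_apply_eq_sum (B : (Fin l → ℝ) →L[ℝ] (Fin l → ℝ) →L[ℝ] ℝ) (v : Fin l → ℝ) :
    B v v = ∑ i, ∑ j, v i * v j * B (Pi.single i 1) (Pi.single j 1) := by
  conv_lhs => enter [1]; rw [eq_sum_single v]
  rw [map_sum, sum_apply]
  refine Finset.sum_congr rfl fun i _ => ?_
  rw [map_smul, smul_apply, clm_apply_eq_sum, smul_eq_mul, Finset.mul_sum]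
  exact Finset.sum_congr rfl fun j _ => (mul_assoc _ _ _).symm

lemma abs_multilinear_le {n : ℕ} (M : ContinuousMultilinearMap ℝ (fun _ : Fin n => Fin l → ℝ) ℝ)
    (hM : ∀ r : Fin n → Fin l, |M fun i => Pi.single (r i) 1| ≤ 1) (v : Fin n → Fin l → ℝ) :
    |M v| ≤ ∏ i, norm1 (v i) := by
  have h1 : M v = ∑ r : Fin n → Fin l, (∏ i, v i (r i)) * M fun i => Pi.single (r i) 1 := by
    conv_lhs => rw [show v = fun i => ∑ j, v i j • (Pi.single j 1 : Fin l → ℝ) from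
      funext fun i => eq_sum_single (v i)]
    rw [M.map_sum]
    refine Finset.sum_congr rfl fun r _ => ?_
    rw [M.map_smul_univ (fun i => v i (r i)) fun i => (Pi.single (r i) 1 : Fin l → ℝ), smul_eq_mul]
  rw [h1]
  simp only [norm1]
  rw [Fintype.prod_sum]
  refine (Finset.abs_sum_le_sum_abs _ _).trans (Finset.sum_le_sum fun r _ => ?_)
  rw [abs_mul, Finset.abs_prod]
  exact mul_le_of_le_one_right (Finset.prod_nonneg fun _ _ => abs_nonneg _) (hM r)

variable {g : (Fin l → ℝ) → ℝ}

lemma abs_iteratedFDeriv_two_le (hg : g ∈ testFunctions l) (x v w : Fin l → ℝ) :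
    |iteratedFDeriv ℝ 2 g x ![v, w]| ≤ norm1 v * norm1 w := by
  have := abs_multilinear_le (iteratedFDeriv ℝ 2 g x) (fun r => by
    convert! hg.2.1 (r 0) (r 1) x using 3
    funext i; fin_cases i <;> rfl) ![v, w]
  simpa [Fin.prod_univ_two] using this

lemma abs_iteratedFDeriv_three_le (hg : g ∈ testFunctions l) (x v : Fin l → ℝ) :
    |iteratedFDeriv ℝ 3 g x fun _ => v| ≤ norm1 v ^ 3 := by
  have := abs_multilinear_le (iteratedFDeriv ℝ 3 g x) (fun r => by
    convert! hg.2.2 (r 0) (r 1) (r 2) x using 3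
    funext i; fin_cases i <;> rfl) fun _ => v
  simpa using this

lemma testFunctions_comp_add (hg : g ∈ testFunctions l) (y : Fin l → ℝ) :
    (fun x => g (y + x)) ∈ testFunctions l := by
  refine ⟨hg.1.comp (contDiff_const.add contDiff_id), fun i j x => ?_, fun i j k x => ?_⟩
  · rw [iteratedFDeriv_comp_add_left]; exact hg.2.1 i j _
  · rw [iteratedFDeriv_comp_add_left]; exact hg.2.2 i j k _

/-- The gradient of a test function is Lipschitz. -/
lemma abs_fderiv_sub_le (hg : g ∈ testFunctions l) (x v : Fin l → ℝ) :
    |fderiv ℝ g x v - fderiv ℝ g 0 v| ≤ norm1 x * norm1 v := by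
  have hd : Differentiable ℝ (fderiv ℝ g) :=
    (hg.1.fderiv_right (m := 1) (by norm_num)).differentiable one_ne_zero
  have hφd : ∀ s : ℝ, HasDerivAt (fun s : ℝ => fderiv ℝ g (s • x) v)
      (fderiv ℝ (fderiv ℝ g) (s • x) x v) s := fun s => by
    have h1 : HasDerivAt (fun s : ℝ => s • x) x s := by
      simpa only [id, one_smul] using (hasDerivAt_id s).smul_const x
    have h2 : HasFDerivAt (fun z => fderiv ℝ g z v)
        ((ContinuousLinearMap.apply ℝ ℝ v).comp (fderiv ℝ (fderiv ℝ g) (s • x))) (s • x) :=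
      (ContinuousLinearMap.apply ℝ ℝ v).hasFDerivAt.comp (s • x) (hd (s • x)).hasFDerivAt
    exact h2.comp_hasDerivAt s h1
  obtain ⟨c, -, hc⟩ := exists_hasDerivAt_eq_slope (fun s : ℝ => fderiv ℝ g (s • x) v) _ zero_lt_one
    (fun s _ => (hφd s).continuousAt.continuousWithinAt) fun s _ => hφd s
  have h3 := abs_iteratedFDeriv_two_le hg (c • x) x v
  rw [iteratedFDeriv_two_apply] at h3
  simp only [Matrix.cons_val_zero, Matrix.cons_val_one] at h3
  rw [hc] at h3
  simpa only [one_smul, zero_smul, sub_zero, div_one] using h3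

lemma abs_add_sub_fderiv_le (hg : g ∈ testFunctions l) (x y : Fin l → ℝ) :
    |g (x + y) - g x - fderiv ℝ g 0 y| ≤ (norm1 x + norm1 y) * norm1 y := by
  have hd : Differentiable ℝ g := hg.1.differentiable (by norm_num)
  have hφd : ∀ s : ℝ, HasDerivAt (fun s : ℝ => g (x + s • y)) (fderiv ℝ g (x + s • y) y) s :=
    fun s => by
    have h1 : HasDerivAt (fun s : ℝ => x + s • y) y s := by
      simpa using ((hasDerivAt_id s).smul_const y).const_add x
    exact (hd (x + s • y)).hasFDerivAt.comp_hasDerivAt s h1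
  obtain ⟨c, hc0, hc⟩ := exists_hasDerivAt_eq_slope (fun s : ℝ => g (x + s • y)) _ zero_lt_one
    (fun s _ => (hφd s).continuousAt.continuousWithinAt) fun s _ => hφd s
  have h3 := abs_fderiv_sub_le hg (x + c • y) y
  rw [hc] at h3
  simp only [one_smul, zero_smul, add_zero, sub_zero, div_one] at h3
  refine h3.trans (mul_le_mul_of_nonneg_right ?_ (norm1_nonneg _))
  refine (norm1_add_le _ _).trans (add_le_add le_rfl ?_)
  rw [norm1_smul, abs_of_pos hc0.1]
  exact mul_le_of_le_one_left (norm1_nonneg _) hc0.2.le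

lemma abs_taylor_three_le (hg : g ∈ testFunctions l) (v : Fin l → ℝ) :
    |g v - g 0 - fderiv ℝ g 0 v - fderiv ℝ (fderiv ℝ g) 0 v v / 2| ≤ norm1 v ^ 3 / 6 := by
  set L : ℝ →L[ℝ] (Fin l → ℝ) := ContinuousLinearMap.toSpanSingleton ℝ v
  have hL : ∀ s : ℝ, L s = s • v := fun s => rfl
  have hc : ContDiff ℝ 3 (g ∘ L) := hg.1.comp L.contDiff
  have hit : ∀ n : ℕ, n ≤ 3 → ∀ s, iteratedDeriv n (g ∘ L) s =
      iteratedFDeriv ℝ n g (s • v) fun _ => v := fun n hn s => by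
    rw [iteratedDeriv_eq_iteratedFDeriv, L.iteratedFDeriv_comp_right hg.1 s (by exact_mod_cast hn)]
    simp [hL]
  obtain ⟨c, -, hc'⟩ := taylor_mean_remainder_lagrange_iteratedDeriv (f := g ∘ L) (x₀ := 0)
    (x := 1) (n := 2) (by norm_num) (by exact_mod_cast hc.contDiffOn)
  have hw : ∀ n : ℕ, n ≤ 3 → iteratedDerivWithin n (g ∘ L) (Set.uIcc 0 1) 0 =
      iteratedDeriv n (g ∘ L) 0 := fun n hn =>
    iteratedDerivWithin_eq_iteratedDeriv (uniqueDiffOn_uIcc zero_ne_one)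
      (hc.of_le (by exact_mod_cast hn)).contDiffAt Set.left_mem_uIcc
  rw [taylorWithinEval_succ, taylorWithinEval_succ, taylor_within_zero_eval, hw 1 (by norm_num),
    hw 2 (by norm_num), hit 1 (by norm_num), hit 2 (by norm_num), hit 3 le_rfl,
    iteratedFDeriv_one_apply, iteratedFDeriv_two_apply] at hc'
  have h3 := abs_iteratedFDeriv_three_le hg (c • v) v
  simp only [Function.comp_apply, hL, one_smul, zero_smul] at hc'
  norm_num at hc'
  have e : g v - g 0 - fderiv ℝ g 0 v - fderiv ℝ (fderiv ℝ g) 0 v v / 2 =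
      (iteratedFDeriv ℝ 3 g (c • v) fun _ => v) / 6 := by
    linarith
  rw [e, abs_div, abs_of_pos (by norm_num : (0 : ℝ) < 6)]
  gcongr

end Taylor

/-! ### Comparison of convolution powers -/

section Lindeberg

variable {l : ℕ}

/-- A probability measure on `ℝ^ℓ` with finite second moments. -/
structure IsL2Law (ρ : Measure (Fin l → ℝ)) : Prop where
  prob : IsProbabilityMeasure ρ
  sq : Integrable (fun v => norm1 v ^ 2) ρ

namespace IsL2Law

variable {ρ ρ' : Measure (Fin l → ℝ)} {g : (Fin l → ℝ) → ℝ}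

lemma integrable_norm1 (h : IsL2Law ρ) : Integrable norm1 ρ := by
  have := h.prob
  refine Integrable.mono' ((integrable_const 1).add h.sq) continuous_norm1.aestronglyMeasurable
    (ae_of_all _ fun v => ?_)
  rw [Real.norm_of_nonneg (norm1_nonneg _), Pi.add_apply]
  nlinarith [sq_nonneg (norm1 v - 1), norm1_nonneg v]

lemma integrable_clm (h : IsL2Law ρ) (A : (Fin l → ℝ) →L[ℝ] ℝ) : Integrable (fun v => A v) ρ := by
  refine Integrable.congr ?_ (ae_of_all _ fun v => (clm_apply_eq_sum A v).symm)
  refine integrable_finsetSum _ fun i _ => Integrable.mul_const ?_ _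
  exact h.integrable_norm1.mono' (measurable_pi_apply i).aestronglyMeasurable
    (ae_of_all _ fun v => abs_le_norm1 v i)

lemma integrable (h : IsL2Law ρ) (hg : g ∈ testFunctions l) : Integrable g ρ := by
  have := h.prob
  refine Integrable.mono' (((integrable_const |g 0|).add (h.integrable_clm (fderiv ℝ g 0)).abs).add
    h.sq) hg.1.continuous.aestronglyMeasurable (ae_of_all _ fun v => ?_)
  have h1 := abs_add_sub_fderiv_le hg 0 v
  rw [zero_add, norm1_zero, zero_add, ← pow_two] at h1
  simp only [Pi.add_apply]
  have e : g v = (g v - g 0 - fderiv ℝ g 0 v) + g 0 + fderiv ℝ g 0 v := by ring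
  rw [Real.norm_eq_abs]
  nth_rewrite 1 [e]
  refine (abs_add_le _ _).trans ?_
  have := abs_add_le (g v - g 0 - fderiv ℝ g 0 v) (g 0)
  linarith

lemma conv (h : IsL2Law ρ) (h' : IsL2Law ρ') : IsL2Law (ρ ∗ ρ') := by
  have := h.prob
  have := h'.prob
  refine ⟨inferInstance, ?_⟩
  have hc : Continuous fun v : Fin l → ℝ => norm1 v ^ 2 := continuous_norm1.pow 2
  rw [Measure.conv, integrable_map_measure hc.aestronglyMeasurable (by fun_prop)]
  have i1 : Integrable (fun p : (Fin l → ℝ) × (Fin l → ℝ) => norm1 p.1 ^ 2) (ρ.prod ρ') :=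
    h.sq.comp_fst ρ'
  have i2 : Integrable (fun p : (Fin l → ℝ) × (Fin l → ℝ) => norm1 p.2 ^ 2) (ρ.prod ρ') :=
    h'.sq.comp_snd ρ
  refine Integrable.mono' ((i1.add i2).const_mul 2)
    ((continuous_norm1.pow 2).comp continuous_add).aestronglyMeasurable (ae_of_all _ fun p => ?_)
  simp only [Function.comp_apply, Pi.add_apply]
  rw [Real.norm_of_nonneg (sq_nonneg _)]
  have h1 := norm1_add_le p.1 p.2
  nlinarith [sq_nonneg (norm1 p.1 - norm1 p.2), norm1_nonneg (p.1 + p.2), norm1_nonneg p.1,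
    norm1_nonneg p.2]

lemma dirac_zero : IsL2Law (Measure.dirac (0 : Fin l → ℝ)) :=
  ⟨inferInstance, by simp [integrable_dirac]⟩

end IsL2Law

/-- The `n`-fold convolution power of a measure. -/
def convPow (ρ : Measure (Fin l → ℝ)) : ℕ → Measure (Fin l → ℝ)
  | 0 => Measure.dirac 0
  | n + 1 => convPow ρ n ∗ ρ

lemma IsL2Law.convPow {ρ : Measure (Fin l → ℝ)} (h : IsL2Law ρ) (n : ℕ) :
    IsL2Law (convPow ρ n) := by
  induction n with
  | zero => exact IsL2Law.dirac_zero
  | succ n ih => exact ih.conv h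

lemma charFunDual_convPow (ρ : Measure (Fin l → ℝ)) [IsProbabilityMeasure ρ] (n : ℕ)
    (A : StrongDual ℝ (Fin l → ℝ)) :
    charFunDual (convPow ρ n) A = charFunDual ρ A ^ n := by
  have hp : ∀ n, IsProbabilityMeasure (convPow ρ n) := fun n => by
    induction n with
    | zero => rw [convPow]; infer_instance
    | succ n ih => rw [convPow]; infer_instance
  induction n with
  | zero => simp [convPow, charFunDual_dirac]
  | succ n ih =>
    have := hp n
    rw [convPow, charFunDual_conv, ih, pow_succ]

/-- Lindeberg's replacement argument: if the integrals of test functions with respect to `ν` and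
`γ` differ by at most `δ`, then those with respect to the `n`-fold convolution powers differ by at
most `n δ`. -/
lemma abs_integral_convPow_sub_le {ν γ : Measure (Fin l → ℝ)} (hν : IsL2Law ν) (hγ : IsL2Law γ)
    {δ : ℝ} (hδ : ∀ g ∈ testFunctions l, |∫ v, g v ∂ν - ∫ v, g v ∂γ| ≤ δ) (n : ℕ) :
    ∀ g ∈ testFunctions l, |∫ v, g v ∂convPow ν n - ∫ v, g v ∂convPow γ n| ≤ n * δ := by
  induction n with
  | zero => intro g _; simp [convPow]
  | succ n ih =>
    intro g hg
    have := hν.prob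
    have := hγ.prob
    have hνn := hν.convPow n
    have hγn := hγ.convPow n
    have := hνn.prob
    have := hγn.prob
    have c1 := (hνn.conv hν).integrable hg
    have c2 := (hνn.conv hγ).integrable hg
    have c3 := (hγn.conv hγ).integrable hg
    have hs : ∀ a b : Measure (Fin l → ℝ), IsL2Law a → IsL2Law b → Integrable g (a ∗ b) →
        ∫ v, g v ∂(a ∗ b) = ∫ x, ∫ y, g (x + y) ∂b ∂a := fun a b ha hb hab => by
      have := ha.prob
      have := hb.prob
      exact integral_conv hab
    have hpr : ∀ a b : Measure (Fin l → ℝ), IsL2Law a → IsL2Law b → Integrable g (a ∗ b) →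
        Integrable (fun p : (Fin l → ℝ) × (Fin l → ℝ) => g (p.1 + p.2)) (a.prod b) :=
      fun a b _ _ hab => (integrable_map_measure hg.1.continuous.aestronglyMeasurable
        (by fun_prop)).1 hab
    have p1 := hpr _ _ hνn hν c1
    have p2 := hpr _ _ hνn hγ c2
    have p3 := hpr _ _ hγn hγ c3
    have b1 : |∫ v, g v ∂(convPow ν n ∗ ν) - ∫ v, g v ∂(convPow ν n ∗ γ)| ≤ δ := by
      rw [hs _ _ hνn hν c1, hs _ _ hνn hγ c2, ← integral_sub p1.integral_prod_left
        p2.integral_prod_left]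
      have := norm_integral_le_of_norm_le_const (μ := convPow ν n) (C := δ)
        (f := fun x => ∫ y, g (x + y) ∂ν - ∫ y, g (x + y) ∂γ)
        (ae_of_all _ fun x => hδ _ (testFunctions_comp_add hg x))
      simpa using this
    have b2 : |∫ v, g v ∂(convPow ν n ∗ γ) - ∫ v, g v ∂(convPow γ n ∗ γ)| ≤ n * δ := by
      rw [hs _ _ hνn hγ c2, hs _ _ hγn hγ c3, integral_integral_swap (f := fun x y => g (x + y)) p2,
        integral_integral_swap (f := fun x y => g (x + y))
          p3, ← integral_sub p2.integral_prod_right p3.integral_prod_right]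
      have := norm_integral_le_of_norm_le_const (μ := γ) (C := n * δ)
        (f := fun y => ∫ x, g (x + y) ∂(convPow ν n) - ∫ x, g (x + y) ∂(convPow γ n))
        (ae_of_all _ fun y => by
          simp only [add_comm _ y]
          exact ih _ (testFunctions_comp_add hg y))
      simpa using this
    rw [convPow, convPow]
    have := abs_sub_le (∫ v, g v ∂(convPow ν n ∗ ν)) (∫ v, g v ∂(convPow ν n ∗ γ))
      (∫ v, g v ∂(convPow γ n ∗ γ))
    push_cast
    linarith

/-- Two centred laws with the same covariances agree up to third moments on test functions. -/
lemma abs_integral_sub_le_of_moments {ν γ : Measure (Fin l → ℝ)} (hν : IsL2Law ν) (hγ : IsL2Law γ)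
    (hν1 : ∀ i, ∫ v, v i ∂ν = 0) (hγ1 : ∀ i, ∫ v, v i ∂γ = 0)
    (h2 : ∀ i j, ∫ v, v i * v j ∂ν = ∫ v, v i * v j ∂γ)
    (hν3 : Integrable (fun v => norm1 v ^ 3) ν) (hγ3 : Integrable (fun v => norm1 v ^ 3) γ)
    {g : (Fin l → ℝ) → ℝ} (hg : g ∈ testFunctions l) :
    |∫ v, g v ∂ν - ∫ v, g v ∂γ| ≤ (∫ v, norm1 v ^ 3 ∂ν + ∫ v, norm1 v ^ 3 ∂γ) / 6 := by
  set A := fderiv ℝ g 0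
  set B := fderiv ℝ (fderiv ℝ g) 0
  have hA := clm_apply_eq_sum A
  have hB := bilin_apply_eq_sum B
  have key : ∀ ρ : Measure (Fin l → ℝ), IsL2Law ρ → (∀ i, ∫ v, v i ∂ρ = 0) →
      Integrable (fun v => norm1 v ^ 3) ρ →
      |∫ v, g v ∂ρ - (g 0 + (∑ i, ∑ j, (∫ v, v i * v j ∂ρ) *
        B (Pi.single i 1) (Pi.single j 1)) / 2)| ≤ (∫ v, norm1 v ^ 3 ∂ρ) / 6 := by
    intro ρ hρ h1 h3
    have := hρ.prob
    have i1 := hρ.integrable hg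
    have i2 := hρ.integrable_clm A
    have ij : ∀ i j, Integrable (fun v : Fin l → ℝ => v i * v j) ρ := fun i j => by
      refine hρ.sq.mono' (by fun_prop) (ae_of_all _ fun v => ?_)
      rw [Real.norm_eq_abs, abs_mul, sq]
      exact mul_le_mul (abs_le_norm1 v i) (abs_le_norm1 v j) (abs_nonneg _) (norm1_nonneg _)
    have ii : ∀ i, Integrable (fun v : Fin l → ℝ => v i) ρ := fun i =>
      hρ.integrable_norm1.mono' (measurable_pi_apply i).aestronglyMeasurable (ae_of_all _ fun v => abs_le_norm1 v i)
    have i3 : Integrable (fun v => B v v) ρ := by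
      simp only [hB]
      exact integrable_finsetSum _ fun i _ => integrable_finsetSum _ fun j _ =>
        (ij i j).mul_const _
    have eA : ∫ v, A v ∂ρ = 0 := by
      rw [integral_congr_ae (ae_of_all _ hA)]
      rw [integral_finsetSum _ fun i _ => (ii i).mul_const _]
      refine Finset.sum_eq_zero fun i _ => ?_
      rw [integral_mul_const, h1, zero_mul]
    have eB : ∫ v, B v v ∂ρ = ∑ i, ∑ j, (∫ v, v i * v j ∂ρ) *
        B (Pi.single i 1) (Pi.single j 1) := by
      rw [integral_congr_ae (ae_of_all _ hB)]
      rw [integral_finsetSum _ fun i _ => integrable_finsetSum _ fun j _ => (ij i j).mul_const _]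
      refine Finset.sum_congr rfl fun i _ => ?_
      rw [integral_finsetSum _ fun j _ => (ij i j).mul_const _]
      simp only [integral_mul_const]
    rw [← eB]
    have e : ∫ v, g v ∂ρ - (g 0 + (∫ v, B v v ∂ρ) / 2) =
        ∫ v, (g v - g 0 - A v - B v v / 2) ∂ρ := by
      have j1 : Integrable (fun v => g v - g 0) ρ := i1.sub (integrable_const _)
      have j2 : Integrable (fun v => g v - g 0 - A v) ρ := j1.sub i2
      rw [integral_sub j2 (i3.div_const 2), integral_sub j1 i2,
        integral_sub i1 (integrable_const _), eA, integral_div]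
      simp only [integral_const, probReal_univ, one_smul]
      ring
    rw [e, ← integral_div]
    exact norm_integral_le_of_norm_le (f := fun v => g v - g 0 - A v - B v v / 2)
      (h3.div_const 6)
      (ae_of_all _ fun v => abs_taylor_three_le hg v)
  have k1 := key ν hν hν1 hν3
  have k2 := key γ hγ hγ1 hγ3
  simp only [h2] at k1
  rw [abs_sub_comm] at k2
  have := abs_sub_le (∫ v, g v ∂ν) (g 0 + (∑ i, ∑ j, (∫ v, v i * v j ∂γ) *
        B (Pi.single i 1) (Pi.single j 1)) / 2) (∫ v, g v ∂γ)
  linarith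

end Lindeberg

/-! ### Normal approximation of linear functionals -/

section LinearCLT

universe u

variable {X : Type u} [MeasurableSpace X] [MeasurableSingletonClass X]
  [MeasurableSpace.CountablySeparated X]
  {Ω : Type*} [MeasurableSpace Ω] {η : Ω → Measure X} {Λ : Measure X} {P : Measure Ω}
  [IsProbabilityMeasure P] [IsFiniteMeasure Λ] {l : ℕ}

/-- The vector of compensated integrals `∫ hᵢ dμ - s ∫ hᵢ dΛ`. -/
def compensated (s : ℝ≥0) (Λ : Measure X) (h : Fin l → X → ℝ) (μ : Measure X) : Fin l → ℝ :=
  fun i => ∫ x, h i x ∂μ - s * ∫ x, h i x ∂Λ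

omit [MeasurableSingletonClass X] [MeasurableSpace.CountablySeparated X]
  [IsFiniteMeasure Λ] in
lemma memLp_smul_nnreal {f : X → ℝ} {p : ℝ≥0∞} (hf : MemLp f p Λ) (s : ℝ≥0) : MemLp f p (s • Λ) :=
  hf.smul_measure (c := (s : ℝ≥0∞)) ENNReal.coe_ne_top

namespace IsFinitePoisson

variable {s : ℝ≥0} {h : Fin l → X → ℝ}

omit [IsProbabilityMeasure P] [IsFiniteMeasure Λ] in
lemma measurable_linear (hη : IsFinitePoisson η Λ P) {u : X → ℝ} (hu : Measurable u) :
    Measurable fun ω => ∫ x, u x ∂η ω := by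
  have := hη.finite
  have := hη.measurable_pointSum (f := fun y : Fin 1 → X => u (y 0))
    (hu.comp (measurable_pi_apply 0))
  simpa only [pointSum_one (hη.integer_valued _)] using this

omit [IsProbabilityMeasure P] [IsFiniteMeasure Λ] in
lemma measurable_compensated (hη : IsFinitePoisson η (s • Λ) P) (hm : ∀ i, Measurable (h i)) :
    Measurable fun ω => compensated s Λ h (η ω) :=
  measurable_pi_lambda _ fun i => (hη.measurable_linear (hm i)).sub_const _

lemma memLp_compensated (hη : IsFinitePoisson η (s • Λ) P) (hm : ∀ i, Measurable (h i))
    (h2 : ∀ i, MemLp (h i) 2 Λ) (i : Fin l) : MemLp (fun ω => compensated s Λ h (η ω) i) 2 P :=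
  (hη.memLp_linear (hm i) (memLp_smul_nnreal (h2 i) s)).sub (memLp_const _)

lemma integral_compensated (hη : IsFinitePoisson η (s • Λ) P) (hm : ∀ i, Measurable (h i))
    (h2 : ∀ i, MemLp (h i) 2 Λ) (i : Fin l) : ∫ ω, compensated s Λ h (η ω) i ∂P = 0 := by
  have h2' := fun i => memLp_smul_nnreal (h2 i) s
  simp only [compensated]
  rw [integral_sub ((hη.memLp_linear (hm i) (h2' i)).integrable one_le_two) (integrable_const _),
    hη.integral_linear (hm i) (h2' i), integral_smul_nnreal_measure]
  simp [NNReal.smul_def]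

lemma integral_compensated_mul (hη : IsFinitePoisson η (s • Λ) P) (hm : ∀ i, Measurable (h i))
    (h2 : ∀ i, MemLp (h i) 2 Λ) (i j : Fin l) :
    ∫ ω, compensated s Λ h (η ω) i * compensated s Λ h (η ω) j ∂P =
      s * ∫ x, h i x * h j x ∂Λ := by
  have h2' := fun i => memLp_smul_nnreal (h2 i) s
  set a := fun i => ∫ x, h i x ∂Λ
  have m := fun i => hη.memLp_linear (hm i) (h2' i)
  have i1 := fun i => (m i).integrable one_le_two
  have i2 : Integrable (fun ω => (∫ x, h i x ∂η ω) * ∫ x, h j x ∂η ω) P :=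
    (m i).integrable_mul (m j)
  have e : ∀ ω, compensated s Λ h (η ω) i * compensated s Λ h (η ω) j =
      (∫ x, h i x ∂η ω) * (∫ x, h j x ∂η ω) - s * a j * compensated s Λ h (η ω) i -
        s * a i * ∫ x, h j x ∂η ω := fun ω => by
    simp only [compensated, a]; ring
  have i3 := (hη.memLp_compensated hm h2 i).integrable one_le_two
  have i4 : Integrable (fun ω => (∫ x, h i x ∂η ω) * (∫ x, h j x ∂η ω) -
      s * a j * compensated s Λ h (η ω) i) P := i2.sub (i3.const_mul _)
  simp only [e]
  rw [integral_sub i4 ((i1 j).const_mul _), integral_sub i2 (i3.const_mul _), integral_const_mul,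
    integral_const_mul, hη.integral_compensated hm h2, hη.integral_linear_mul (hm i) (h2' i) (hm j)
    (h2' j), hη.integral_linear (hm j) (h2' j)]
  simp only [integral_smul_nnreal_measure, NNReal.smul_def, smul_eq_mul, a]
  ring

omit [IsProbabilityMeasure P] in
lemma norm1_compensated_le (hη : IsFinitePoisson η (s • Λ) P) (hs : s ≤ 1)
    (h2 : ∀ i, MemLp (h i) 2 Λ) (ω : Ω) :
    norm1 (compensated s Λ h (η ω)) ≤
      ∫ x, norm1 (fun i => h i x) ∂η ω + ∫ x, norm1 (fun i => h i x) ∂Λ := by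
  simp only [norm1]
  rw [integral_finsetSum _ fun i _ => hη.integrable_point ω _,
    integral_finsetSum _ fun i _ => ((h2 i).integrable one_le_two).abs, ← Finset.sum_add_distrib]
  refine Finset.sum_le_sum fun i _ => (abs_sub _ _).trans (add_le_add abs_integral_le_integral_abs ?_)
  rw [abs_mul, abs_of_nonneg s.coe_nonneg]
  refine (mul_le_of_le_one_left (abs_nonneg _) (by exact_mod_cast hs)).trans
    abs_integral_le_integral_abs

/-- Third moments of compensated integrals are bounded for bounded intensities. -/
lemma exists_integral_norm1_compensated_le (P : Measure Ω) [IsProbabilityMeasure P]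
    (Λ : Measure X) [IsFiniteMeasure Λ] (hm : ∀ i, Measurable (h i))
    (h3 : ∀ i, MemLp (h i) 3 Λ) :
    ∃ C : ℝ, 0 ≤ C ∧ ∀ {s : ℝ≥0} (_ : s ≤ 1) {η : Ω → Measure X}
      (_ : IsFinitePoisson η (s • Λ) P),
      Integrable (fun ω => norm1 (compensated s Λ h (η ω)) ^ 3) P ∧
        ∫ ω, norm1 (compensated s Λ h (η ω)) ^ 3 ∂P ≤ C := by
  set H : X → ℝ := fun x => norm1 fun i => h i x
  have hHm : Measurable H := Finset.measurable_fun_sum _ fun i _ => (hm i).abs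
  have hH3 : MemLp H 3 Λ := memLp_finsetSum _ fun i _ => (h3 i).abs
  have hH0 : ∀ x, 0 ≤ H x := fun x => norm1_nonneg _
  have h2 : ∀ i, MemLp (h i) 2 Λ := fun i => (h3 i).mono_exponent (by norm_num)
  set u : X → ℝ≥0∞ := fun x => ENNReal.ofReal (H x)
  have hu : Measurable u := hHm.ennreal_ofReal
  have hfin : ∀ k : ℕ, k ≠ 0 → k ≤ 3 → ∫⁻ x, u x ^ k ∂Λ ≠ ∞ := fun k hk0 hk => by
    have h4 : MemLp H k Λ := hH3.mono_exponent (by exact_mod_cast hk)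
    have h5 := h4.integrable_norm_pow hk0
    have h6 := h5.2
    rw [hasFiniteIntegral_iff_enorm] at h6
    refine ne_of_lt (lt_of_eq_of_lt (lintegral_congr fun x => ?_) h6)
    rw [enorm_pow, enorm_norm, Real.enorm_eq_ofReal (hH0 x)]
  set K := (∫⁻ x, u x ∂Λ) ^ 3 + 3 * (∫⁻ x, u x ∂Λ) * (∫⁻ x, u x ^ 2 ∂Λ) + ∫⁻ x, u x ^ 3 ∂Λ
  have hK : K ≠ ∞ := by
    have f1 := hfin 1 one_ne_zero (by norm_num)
    simp only [pow_one] at f1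
    have f2 := hfin 2 two_ne_zero (by norm_num)
    have f3 := hfin 3 three_ne_zero le_rfl
    finiteness
  set b := ∫ x, H x ∂Λ
  have hb : 0 ≤ b := integral_nonneg hH0
  refine ⟨4 * (K.toReal + b ^ 3), by positivity, fun {s} hs {η} hη => ?_⟩
  have hle : ∀ v : X → ℝ≥0∞, ∫⁻ x, v x ∂(s • Λ) ≤ ∫⁻ x, v x ∂Λ := fun v => by
    rw [lintegral_smul_measure, ENNReal.smul_def, smul_eq_mul]
    exact mul_le_of_le_one_left zero_le (by exact_mod_cast hs)
  have hT : ∫⁻ ω, (∫⁻ x, u x ∂η ω) ^ 3 ∂P ≤ K := by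
    rw [hη.lintegral_linear_pow_three hu]
    exact add_le_add (add_le_add (pow_le_pow_left' (hle u) 3) (mul_le_mul' (mul_le_mul' le_rfl
      (hle u)) (hle fun x => u x ^ 2))) (hle fun x => u x ^ 3)
  have hTm := hη.measurable_linear hHm
  have hT0 : ∀ ω, 0 ≤ ∫ x, H x ∂η ω := fun ω => integral_nonneg hH0
  have hTe : ∀ ω, ENNReal.ofReal ((∫ x, H x ∂η ω) ^ 3) = (∫⁻ x, u x ∂η ω) ^ 3 := fun ω => by
    rw [ENNReal.ofReal_pow (hT0 ω), ofReal_integral_eq_lintegral_ofReal (hη.integrable_point ω H)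
      (ae_of_all _ hH0)]
  have hTi : Integrable (fun ω => (∫ x, H x ∂η ω) ^ 3) P := by
    refine ⟨(hTm.pow_const 3).aestronglyMeasurable, ?_⟩
    rw [hasFiniteIntegral_iff_ofReal (ae_of_all _ fun ω => pow_nonneg (hT0 ω) 3)]
    simp only [hTe]
    exact hT.trans_lt hK.lt_top
  have hTb : ∫ ω, (∫ x, H x ∂η ω) ^ 3 ∂P ≤ K.toReal := by
    rw [integral_eq_lintegral_of_nonneg_ae (ae_of_all _ fun ω => pow_nonneg (hT0 ω) 3)
      (hTm.pow_const 3).aestronglyMeasurable]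
    simp only [hTe]
    exact ENNReal.toReal_mono hK hT
  have hbd : ∀ ω, norm1 (compensated s Λ h (η ω)) ^ 3 ≤ 4 * ((∫ x, H x ∂η ω) ^ 3 + b ^ 3) :=
    fun ω => by
    have h7 := hη.norm1_compensated_le hs h2 ω
    refine (pow_le_pow_left₀ (norm1_nonneg _) h7 3).trans ?_
    change (∫ x, H x ∂η ω + b) ^ 3 ≤ _
    nlinarith [mul_nonneg (add_nonneg (hT0 ω) hb) (sq_nonneg (∫ x, H x ∂η ω - b))]
  have hi : Integrable (fun ω => 4 * ((∫ x, H x ∂η ω) ^ 3 + b ^ 3)) P :=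
    (hTi.add (integrable_const _)).const_mul 4
  have hI : Integrable (fun ω => norm1 (compensated s Λ h (η ω)) ^ 3) P := by
    refine hi.mono' (((continuous_norm1.measurable.comp
      (hη.measurable_compensated hm)).pow_const 3).aestronglyMeasurable) (ae_of_all _ fun ω => ?_)
    rw [Real.norm_of_nonneg (pow_nonneg (norm1_nonneg _) 3)]
    exact hbd ω
  refine ⟨hI, (integral_mono hI hi hbd).trans ?_⟩
  rw [integral_const_mul, integral_add hTi (integrable_const _)]
  simp only [integral_const, probReal_univ, one_smul]
  gcongr

open Complex in
/-- The characteristic function of a rescaled vector of compensated integrals. -/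
lemma charFunDual_compensated (hη : IsFinitePoisson η (s • Λ) P) (hm : ∀ i, Measurable (h i))
    (h2 : ∀ i, MemLp (h i) 2 Λ) (c : ℝ) (A : StrongDual ℝ (Fin l → ℝ)) :
    charFunDual (P.map fun ω => c • compensated s Λ h (η ω)) A =
      cexp (s * (∫ x, (cexp (A (c • fun i => h i x) * I) - 1 - A (c • fun i => h i x) * I) ∂Λ)) := by
  set u : X → ℝ := fun x => A (c • fun i => h i x) with hu
  have hue : ∀ x, u x = ∑ i, c * h i x * A (Pi.single i 1) := fun x => clm_apply_eq_sum A _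
  have hum : Measurable u := A.continuous.measurable.comp
    ((measurable_pi_lambda _ hm).const_smul c)
  have hui : Integrable u Λ := by
    refine Integrable.congr (f := fun x => ∑ i, c * h i x * A (Pi.single i 1)) ?_
      (ae_of_all _ fun x => (hue x).symm)
    exact integrable_finsetSum _ fun i _ => (((h2 i).integrable one_le_two).const_mul c).mul_const _
  have hlin : ∀ μ : Measure X, (∀ i, Integrable (h i) μ) →
      ∫ x, u x ∂μ = ∑ i, c * (∫ x, h i x ∂μ) * A (Pi.single i 1) := fun μ hμ => by
    rw [integral_congr_ae (ae_of_all _ hue),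
      integral_finsetSum _ fun i _ => ((hμ i).const_mul c).mul_const _]
    simp only [integral_mul_const, integral_const_mul]
  have hA : ∀ ω, A (c • compensated s Λ h (η ω)) = ∫ x, u x ∂η ω - s * ∫ x, u x ∂Λ := fun ω => by
    rw [hlin _ fun i => hη.integrable_point ω _, hlin _ fun i => (h2 i).integrable one_le_two,
      clm_apply_eq_sum, Finset.mul_sum, ← Finset.sum_sub_distrib]
    refine Finset.sum_congr rfl fun i _ => ?_
    simp only [compensated, Pi.smul_apply, smul_eq_mul]
    ring
  have hmeas : Measurable fun ω => c • compensated s Λ h (η ω) :=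
    (hη.measurable_compensated hm (h := h)).const_smul c
  rw [charFunDual_apply, integral_map hmeas.aemeasurable
    (Continuous.aestronglyMeasurable (by fun_prop))]
  have e : ∀ ω, cexp (A (c • compensated s Λ h (η ω)) * I) =
      cexp ((∫ x, u x ∂η ω : ℝ) * I) * cexp (-(s * (∫ x, u x ∂Λ : ℝ) * I)) := fun ω => by
    rw [hA, ← Complex.exp_add]
    push_cast
    ring_nf
  have i1 : Integrable (fun x => cexp (u x * I) - 1) Λ := by
    refine Integrable.sub (Integrable.of_bound (C := 1) (by fun_prop) (ae_of_all _ fun x => ?_))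
      (integrable_const _)
    rw [Complex.norm_exp_ofReal_mul_I]
  have i2 : Integrable (fun x => (u x : ℂ) * I) Λ := hui.ofReal.mul_const I
  simp only [e]
  rw [integral_mul_const, hη.integral_exp_linear hum, ← Complex.exp_add, integral_sub i1 i2,
    integral_smul_nnreal_measure, integral_mul_const, integral_complex_ofReal, NNReal.smul_def,
    Complex.real_smul]
  congr 1
  ring

end IsFinitePoisson

end LinearCLT

/-! ### Normal approximation of factorial integrals -/

section CLT

universe u

variable {X : Type u} [MeasurableSpace X] [MeasurableSingletonClass X]
  [MeasurableSpace.CountablySeparated X]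
  {Ω : Type*} [MeasurableSpace Ω] {η : Ω → Measure X} {Λ : Measure X} {P : Measure Ω}
  [IsProbabilityMeasure P] [IsFiniteMeasure Λ] {l : ℕ}
  {Ω' : Type*} [MeasurableSpace Ω'] {P' : Measure Ω'} [IsProbabilityMeasure P']

lemma sq_norm1_le (v : Fin l → ℝ) : norm1 v ^ 2 ≤ l * ∑ i, v i ^ 2 := by
  have := sq_sum_le_card_mul_sum_sq (s := Finset.univ) (f := fun i => |v i|)
  simpa [norm1] using this

omit [IsProbabilityMeasure P] in
lemma integrable_sq_norm1 {Y : Ω → Fin l → ℝ} (hY : ∀ i, MemLp (fun ω => Y ω i) 2 P) :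
    Integrable (fun ω => norm1 (Y ω) ^ 2) P ∧
      ∫ ω, norm1 (Y ω) ^ 2 ∂P ≤ l * ∑ i, ∫ ω, Y ω i ^ 2 ∂P := by
  have hi : Integrable (fun ω => (l : ℝ) * ∑ i, Y ω i ^ 2) P :=
    (integrable_finsetSum _ fun i _ => (hY i).integrable_sq).const_mul _
  have hm : AEStronglyMeasurable (fun ω => norm1 (Y ω) ^ 2) P := by
    refine continuous_norm1.comp_aestronglyMeasurable ?_ |>.pow 2
    exact (aemeasurable_pi_lambda _ fun i => (hY i).aestronglyMeasurable.aemeasurable).aestronglyMeasurable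
  have hI : Integrable (fun ω => norm1 (Y ω) ^ 2) P := hi.mono' hm (ae_of_all _ fun ω => by
    rw [Real.norm_of_nonneg (sq_nonneg _)]; exact sq_norm1_le _)
  refine ⟨hI, (integral_mono hI hi fun ω => sq_norm1_le _).trans_eq ?_⟩
  rw [integral_const_mul, integral_finsetSum _ fun i _ => (hY i).integrable_sq]

lemma isL2Law_map {Y : Ω → Fin l → ℝ} (hYm : AEMeasurable Y P)
    (hY : ∀ i, MemLp (fun ω => Y ω i) 2 P) : IsL2Law (P.map Y) := by
  refine ⟨Measure.isProbabilityMeasure_map hYm, ?_⟩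
  have hc : Continuous fun v : Fin l → ℝ => norm1 v ^ 2 := continuous_norm1.pow 2
  exact (integrable_map_measure hc.aestronglyMeasurable hYm).2 (integrable_sq_norm1 hY).1

/-- A perturbation `R` with mean zero that is small in `L²` changes the expectation of a test
function by a term of the order of the `L²`-norm of `R`; the weight `c` balances the mixed term. -/
lemma abs_integral_add_sub_le {Y R : Ω → Fin l → ℝ} (hYm : AEMeasurable Y P)
    (hRm : AEMeasurable R P)
    (hY : ∀ i, MemLp (fun ω => Y ω i) 2 P) (hR : ∀ i, MemLp (fun ω => R ω i) 2 P)
    (hR0 : ∀ i, ∫ ω, R ω i ∂P = 0) {c : ℝ} (hc : 0 < c) {g : (Fin l → ℝ) → ℝ}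
    (hg : g ∈ testFunctions l) :
    |∫ ω, g (Y ω + R ω) ∂P - ∫ ω, g (Y ω) ∂P| ≤
      c * ∫ ω, norm1 (Y ω) ^ 2 ∂P + (1 / c + 1) * ∫ ω, norm1 (R ω) ^ 2 ∂P := by
  have i1 : Integrable (fun ω => g (Y ω + R ω)) P :=
    (integrable_map_measure hg.1.continuous.aestronglyMeasurable (hYm.add hRm)).1
      ((isL2Law_map (hYm.add hRm) fun i => (hY i).add (hR i)).integrable hg)
  have i2 : Integrable (fun ω => g (Y ω)) P :=
    (integrable_map_measure hg.1.continuous.aestronglyMeasurable hYm).1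
      ((isL2Law_map hYm hY).integrable hg)
  set A := fderiv ℝ g 0
  have hRi := fun i => (hR i).integrable one_le_two
  have i3 : Integrable (fun ω => A (R ω)) P := by
    refine Integrable.congr ?_ (ae_of_all _ fun ω => (clm_apply_eq_sum A (R ω)).symm)
    exact integrable_finsetSum _ fun i _ => (hRi i).mul_const _
  have e3 : ∫ ω, A (R ω) ∂P = 0 := by
    rw [integral_congr_ae (ae_of_all _ fun ω => clm_apply_eq_sum A (R ω)),
      integral_finsetSum _ fun i _ => (hRi i).mul_const _]
    exact Finset.sum_eq_zero fun i _ => by rw [integral_mul_const, hR0, zero_mul]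
  have e : ∫ ω, g (Y ω + R ω) ∂P - ∫ ω, g (Y ω) ∂P =
      ∫ ω, (g (Y ω + R ω) - g (Y ω) - A (R ω)) ∂P := by
    have i4 : Integrable (fun ω => g (Y ω + R ω) - g (Y ω)) P := i1.sub i2
    rw [integral_sub i4 i3, integral_sub i1 i2, e3, sub_zero]
  have iY := (integrable_sq_norm1 hY).1
  have iR := (integrable_sq_norm1 hR).1
  rw [e, ← integral_const_mul, ← integral_const_mul,
    ← integral_add (iY.const_mul _) (iR.const_mul _)]
  refine norm_integral_le_of_norm_le (f := fun ω => g (Y ω + R ω) - g (Y ω) - A (R ω))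
    ((iY.const_mul _).add (iR.const_mul _)) (ae_of_all _ fun ω => ?_)
  refine (abs_add_sub_fderiv_le hg (Y ω) (R ω)).trans ?_
  have hy := norm1_nonneg (Y ω)
  have hr := norm1_nonneg (R ω)
  have h1 : norm1 (Y ω) * norm1 (R ω) ≤ c * norm1 (Y ω) ^ 2 + 1 / c * norm1 (R ω) ^ 2 := by
    have h2 : 0 ≤ c * (norm1 (Y ω) - 1 / c * norm1 (R ω)) ^ 2 := by positivity
    have h3 : c * (norm1 (Y ω) - 1 / c * norm1 (R ω)) ^ 2 = c * norm1 (Y ω) ^ 2 +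
        1 / c * norm1 (R ω) ^ 2 - 2 * (norm1 (Y ω) * norm1 (R ω)) := by
      field_simp
      ring
    nlinarith [mul_nonneg hy hr]
  nlinarith

open Complex in
/-- The law of a centred Gaussian vector is a convolution power. -/
lemma map_eq_convPow_gaussian {Z : Ω' → Fin l → ℝ} (hZ : HasGaussianLaw Z P')
    (hZ0 : ∀ i, ∫ ω, Z ω i ∂P' = 0) {n : ℕ} (hn : n ≠ 0) :
    P'.map Z = convPow (P'.map fun ω => (Real.sqrt n)⁻¹ • Z ω) n := by
  have hZm := hZ.aemeasurable
  have hsc : HasGaussianLaw (fun ω => (Real.sqrt n)⁻¹ • Z ω) P' := hZ.fun_smul _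
  have hZm' := hsc.aemeasurable
  have : IsProbabilityMeasure (P'.map fun ω => (Real.sqrt n)⁻¹ • Z ω) :=
    Measure.isProbabilityMeasure_map hZm'
  have := Measure.isProbabilityMeasure_map hZm
  have hZi : ∀ i, Integrable (fun ω => Z ω i) P' := fun i =>
    (memLp_pi_iff.1 (hZ.memLp ENNReal.one_ne_top) i).integrable le_rfl
  have hZ2 : ∀ i, MemLp (fun ω => Z ω i) 2 P' := fun i =>
    memLp_pi_iff.1 (hZ.memLp ENNReal.ofNat_ne_top) i
  have hL2 := isL2Law_map hZm' fun i => (hZ2 i).const_mul (Real.sqrt n)⁻¹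
  have := (hL2.convPow n).prob
  refine Measure.ext_of_charFunDual (funext fun A => ?_)
  have h0 : ∫ ω, A (Z ω) ∂P' = 0 := by
    rw [integral_congr_ae (ae_of_all _ fun ω => clm_apply_eq_sum A (Z ω)),
      integral_finsetSum _ fun i _ => (hZi i).mul_const _]
    exact Finset.sum_eq_zero fun i _ => by rw [integral_mul_const, hZ0, zero_mul]
  rw [charFunDual_convPow, hsc.charFunDual_map_eq_fun, hZ.charFunDual_map_eq_fun,
    ← Complex.exp_nat_mul]
  simp only [map_smul, smul_eq_mul]
  have hn' : (n : ℂ) ≠ 0 := by exact_mod_cast hn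
  rw [variance_const_mul, integral_const_mul, h0, inv_pow, Real.sq_sqrt (Nat.cast_nonneg n)]
  congr 1
  push_cast
  field_simp
  simp

/-- The sum of `n` independent copies of a Poisson process with intensity `s Λ` is a Poisson
process with intensity `n s Λ`; in terms of the laws of linear functionals. -/
lemma map_compensated_eq_convPow {h : Fin l → X → ℝ} (hm : ∀ i, Measurable (h i))
    (h2 : ∀ i, MemLp (h i) 2 Λ) {s t : ℝ≥0} {n : ℕ} (hst : n * s = t) {ηs ηt : Ω → Measure X}
    (hs : IsFinitePoisson ηs (s • Λ) P) (ht : IsFinitePoisson ηt (t • Λ) P) (c : ℝ) :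
    P.map (fun ω => c • compensated t Λ h (ηt ω)) =
      convPow (P.map fun ω => c • compensated s Λ h (ηs ω)) n := by
  have m1 : Measurable fun ω => c • compensated s Λ h (ηs ω) :=
    (hs.measurable_compensated hm).const_smul c
  have m2 : Measurable fun ω => c • compensated t Λ h (ηt ω) :=
    (ht.measurable_compensated hm).const_smul c
  have := Measure.isProbabilityMeasure_map (μ := P) m1.aemeasurable
  have := Measure.isProbabilityMeasure_map (μ := P) m2.aemeasurable
  have := ((isL2Law_map m1.aemeasurable
    fun i => (hs.memLp_compensated hm h2 i).const_mul c).convPow n).prob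
  refine Measure.ext_of_charFunDual (funext fun A => ?_)
  rw [charFunDual_convPow, hs.charFunDual_compensated hm h2, ht.charFunDual_compensated hm h2,
    ← Complex.exp_nat_mul, ← mul_assoc, ← hst]
  push_cast
  rfl

/-- The normal approximation of the linear functionals of a Poisson process, by Lindeberg's
method applied to about `t` pieces of intensities between `1 / 2` and `1`. -/
theorem exists_abs_integral_compensated_sub_le
    (hP : ∀ s : ℝ≥0, 0 < s → ∃ η : Ω → Measure X, IsFinitePoisson η (s • Λ) P)
    {h : Fin l → X → ℝ} (hm : ∀ i, Measurable (h i)) (h3 : ∀ i, MemLp (h i) 3 Λ)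
    {Z : Ω' → Fin l → ℝ} (hZ : HasGaussianLaw Z P') (hZ0 : ∀ i, ∫ ω, Z ω i ∂P' = 0)
    (hcov : ∀ i j, ∫ ω, Z ω i * Z ω j ∂P' = ∫ x, h i x * h j x ∂Λ) :
    ∃ C : ℝ, 0 ≤ C ∧ ∀ {t : ℝ≥0} (_ : 1 ≤ t) {η : Ω → Measure X} (_ : IsFinitePoisson η (t • Λ) P)
      {g : (Fin l → ℝ) → ℝ} (_ : g ∈ testFunctions l),
      |∫ ω, g ((Real.sqrt t)⁻¹ • compensated t Λ h (η ω)) ∂P - ∫ ω, g (Z ω) ∂P'| ≤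
        C * (Real.sqrt t)⁻¹ := by
  have h2 : ∀ i, MemLp (h i) 2 Λ := fun i => (h3 i).mono_exponent (by norm_num)
  obtain ⟨C₁, hC₁, hW⟩ := IsFinitePoisson.exists_integral_norm1_compensated_le P Λ hm h3
  have hZm := hZ.aemeasurable
  have hZ2 : ∀ i, MemLp (fun ω => Z ω i) 2 P' := fun i =>
    memLp_pi_iff.1 (hZ.memLp ENNReal.ofNat_ne_top) i
  have hZ3 : Integrable (fun ω => norm1 (Z ω) ^ 3) P' := by
    have h4 : MemLp (fun ω => norm1 (Z ω)) 3 P' := memLp_finsetSum _ fun i _ =>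
      (memLp_pi_iff.1 (hZ.memLp (p := 3) ENNReal.ofNat_ne_top) i).abs
    have := h4.integrable_norm_pow (p := 3) three_ne_zero
    simpa only [Real.norm_of_nonneg (norm1_nonneg _)] using this
  set C₂ := ∫ ω, norm1 (Z ω) ^ 3 ∂P'
  have hC₂ : 0 ≤ C₂ := integral_nonneg fun _ => pow_nonneg (norm1_nonneg _) 3
  refine ⟨C₁ + C₂, by positivity, fun {t} ht {η} hη {g} hg => ?_⟩
  have ht0 : (0 : ℝ) < t := zero_lt_one.trans_le (by exact_mod_cast ht)
  -- `n` pieces of intensity `s = t / n ≤ 1`, whose third moments are uniformly bounded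
  set n := ⌈(t : ℝ)⌉₊ with hndef
  have hn0 : n ≠ 0 := (Nat.ceil_pos.2 ht0).ne'
  have hnt : (t : ℝ) ≤ n := Nat.le_ceil _
  have hn2 : (n : ℝ) ≤ 2 * t := by
    have h5 := (Nat.ceil_lt_add_one ht0.le).le
    have h6 : (1 : ℝ) ≤ t := by exact_mod_cast ht
    linarith
  have hnpos : (0 : ℝ) < n := by exact_mod_cast Nat.pos_of_ne_zero hn0
  set s : ℝ≥0 := t / n with hsdef
  have hst : n * s = t := by
    rw [hsdef]; field_simp
  have hs1 : s ≤ 1 := by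
    rw [hsdef]
    exact div_le_one_of_le₀ (by exact_mod_cast hnt) (by positivity)
  have hs0 : 0 < s := by
    rw [hsdef]; exact div_pos (by exact_mod_cast ht0) (by exact_mod_cast hnpos)
  obtain ⟨ηs, hηs⟩ := hP s hs0
  set a := (Real.sqrt t)⁻¹ with ha
  set b := (Real.sqrt n)⁻¹ with hb
  have hsq : Real.sqrt t ^ 2 = t := Real.sq_sqrt ht0.le
  have hsp : 0 < Real.sqrt t := Real.sqrt_pos.2 ht0
  have ha0 : 0 < a := inv_pos.2 hsp
  have hb0 : 0 < b := inv_pos.2 (Real.sqrt_pos.2 hnpos)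
  have ha2 : a ^ 2 = (t : ℝ)⁻¹ := by rw [ha, inv_pow, hsq]
  have hb2 : b ^ 2 = (n : ℝ)⁻¹ := by rw [hb, inv_pow, Real.sq_sqrt hnpos.le]
  have hba : b ≤ a := inv_anti₀ hsp (Real.sqrt_le_sqrt hnt)
  have mν : Measurable fun ω => a • compensated s Λ h (ηs ω) :=
    (hηs.measurable_compensated hm).const_smul a
  have mt : Measurable fun ω => a • compensated t Λ h (η ω) :=
    (hη.measurable_compensated hm).const_smul a
  have mγ : AEMeasurable (fun ω => b • Z ω) P' := (hZ.fun_smul b).aemeasurable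
  set ν := P.map fun ω => a • compensated s Λ h (ηs ω)
  set γ := P'.map fun ω => b • Z ω
  have hν : IsL2Law ν := isL2Law_map mν.aemeasurable
    fun i => (hηs.memLp_compensated hm h2 i).const_mul a
  have hγ : IsL2Law γ := isL2Law_map mγ fun i => (hZ2 i).const_mul b
  have hc3 : Continuous fun v : Fin l → ℝ => norm1 v ^ 3 := continuous_norm1.pow 3
  have e1 : ∀ ω, norm1 (a • compensated s Λ h (ηs ω)) ^ 3 =
      a ^ 3 * norm1 (compensated s Λ h (ηs ω)) ^ 3 := fun ω => by
    rw [norm1_smul, mul_pow, abs_of_pos ha0]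
  have e2 : ∀ ω, norm1 (b • Z ω) ^ 3 = b ^ 3 * norm1 (Z ω) ^ 3 := fun ω => by
    rw [norm1_smul, mul_pow, abs_of_pos hb0]
  have hδ : ∀ g ∈ testFunctions l, |∫ v, g v ∂ν - ∫ v, g v ∂γ| ≤ a ^ 3 * (C₁ + C₂) / 6 := by
    intro g hg
    refine (abs_integral_sub_le_of_moments hν hγ ?_ ?_ ?_ ?_ ?_ hg).trans ?_
    · intro i
      rw [integral_map mν.aemeasurable (measurable_pi_apply i).aestronglyMeasurable]
      simp only [Pi.smul_apply, smul_eq_mul]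
      rw [integral_const_mul, hηs.integral_compensated hm h2, mul_zero]
    · intro i
      rw [integral_map mγ (measurable_pi_apply i).aestronglyMeasurable]
      simp only [Pi.smul_apply, smul_eq_mul]
      rw [integral_const_mul, hZ0, mul_zero]
    · intro i j
      have hcij : AEStronglyMeasurable (fun v : Fin l → ℝ => v i * v j) ν := by fun_prop
      have hcij' : AEStronglyMeasurable (fun v : Fin l → ℝ => v i * v j) γ := by fun_prop
      rw [integral_map mν.aemeasurable hcij, integral_map mγ hcij']
      have hsw : ∀ c x y : ℝ, c * x * (c * y) = c ^ 2 * (x * y) := fun c x y => by ring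
      simp only [Pi.smul_apply, smul_eq_mul, hsw]
      rw [integral_const_mul, integral_const_mul, hηs.integral_compensated_mul hm h2, hcov, ha2,
        hb2, ← mul_assoc]
      congr 1
      rw [← hst]
      have : (s : ℝ) ≠ 0 := by exact_mod_cast hs0.ne'
      push_cast
      field_simp
    · refine (integrable_map_measure hc3.aestronglyMeasurable mν.aemeasurable).2 ?_
      exact ((hW hs1 hηs).1.const_mul (a ^ 3)).congr (ae_of_all _ fun ω => (e1 ω).symm)
    · refine (integrable_map_measure hc3.aestronglyMeasurable mγ).2 ?_
      exact (hZ3.const_mul (b ^ 3)).congr (ae_of_all _ fun ω => (e2 ω).symm)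
    · rw [integral_map mν.aemeasurable hc3.aestronglyMeasurable,
        integral_map mγ hc3.aestronglyMeasurable]
      simp only [e1, e2]
      rw [integral_const_mul, integral_const_mul, mul_add]
      have := (hW hs1 hηs).2
      change (_ + b ^ 3 * C₂) / 6 ≤ _
      gcongr
  have key := abs_integral_convPow_sub_le hν hγ hδ n g hg
  rw [← map_compensated_eq_convPow hm h2 hst hηs hη a, ← map_eq_convPow_gaussian hZ hZ0 hn0,
    integral_map mt.aemeasurable hg.1.continuous.aestronglyMeasurable,
    integral_map hZm hg.1.continuous.aestronglyMeasurable] at key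
  refine key.trans ?_
  calc (n : ℝ) * (a ^ 3 * (C₁ + C₂) / 6) ≤ 2 * t * (a ^ 3 * (C₁ + C₂) / 6) := by gcongr
    _ = (C₁ + C₂) * a * (t * a ^ 2) / 3 := by ring
    _ = (C₁ + C₂) * a / 3 := by rw [ha2, mul_inv_cancel₀ ht0.ne', mul_one]
    _ ≤ (C₁ + C₂) * a := by
      have : 0 ≤ (C₁ + C₂) * a := by positivity
      linarith

/-- Normal approximation of the vector of factorial integrals with kernels of order `m + 1`: the
linear part of the first order expansion is approximately normal, and the remainder is negligible. -/
theorem exists_abs_integral_pointSum_sub_le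
    (hP : ∀ s : ℝ≥0, 0 < s → ∃ η : Ω → Measure X, IsFinitePoisson η (s • Λ) P) {m : ℕ}
    {f : Fin l → (Fin (m + 1) → X) → ℝ} (hf : ∀ i, IsKernel Λ (f i))
    (h3 : ∀ i, MemLp (fun x => meanVal Λ (sect (f i) x)) 3 Λ)
    {Z : Ω' → Fin l → ℝ} (hZ : HasGaussianLaw Z P') (hZ0 : ∀ i, ∫ ω, Z ω i ∂P' = 0)
    (hcov : ∀ i j, ∫ ω, Z ω i * Z ω j ∂P' =
      ∫ x, ((m ! : ℝ)⁻¹ * meanVal Λ (sect (f i) x)) * ((m ! : ℝ)⁻¹ * meanVal Λ (sect (f j) x)) ∂Λ) :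
    ∃ C : ℝ, 0 ≤ C ∧ ∀ {t : ℝ≥0} (_ : 1 ≤ t) {η : Ω → Measure X} (_ : IsFinitePoisson η (t • Λ) P)
      {g : (Fin l → ℝ) → ℝ} (_ : g ∈ testFunctions l),
      |∫ ω, g (fun i => (t ^ m * Real.sqrt t * ((m + 1)! : ℝ))⁻¹ *
          (pointSum (m + 1) (f i) (η ω) - t ^ (m + 1) * meanVal Λ (f i))) ∂P -
        ∫ ω, g (Z ω) ∂P'| ≤ C * (Real.sqrt t)⁻¹ := by
  set h : Fin l → X → ℝ := fun i x => (m ! : ℝ)⁻¹ * meanVal Λ (sect (f i) x) with hh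
  have hpm : ∀ i, Measurable fun x => meanVal Λ (sect (f i) x) := fun i =>
    (stronglyMeasurable_meanVal_sect Λ (hf i).measurable).measurable
  have hm : ∀ i, Measurable (h i) := fun i => (hpm i).const_mul _
  have h3' : ∀ i, MemLp (h i) 3 Λ := fun i => (h3 i).const_mul _
  have h2 : ∀ i, MemLp (h i) 2 Λ := fun i => (h3' i).mono_exponent (by norm_num)
  obtain ⟨C₁, hC₁, hlin⟩ := exists_abs_integral_compensated_sub_le hP hm h3' hZ hZ0 hcov
  choose D hD0 hD using fun i => IsFinitePoisson.exists_integral_remainder_sq_le P Λ (hf i)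
  set S := ∑ i, ∫ x, h i x * h i x ∂Λ
  have hS : 0 ≤ S := Finset.sum_nonneg fun i _ => integral_nonneg fun x => mul_self_nonneg _
  have hDs : 0 ≤ ∑ i, D i := Finset.sum_nonneg fun i _ => hD0 i
  refine ⟨C₁ + (l * S + 2 * (l * ∑ i, D i)), by positivity, fun {t} ht {η} hη {g} hg => ?_⟩
  have ht0 : (0 : ℝ) < t := zero_lt_one.trans_le (by exact_mod_cast ht)
  have hsq : Real.sqrt t ^ 2 = t := Real.sq_sqrt ht0.le
  have hsp : 0 < Real.sqrt t := Real.sqrt_pos.2 ht0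
  set a := (Real.sqrt t)⁻¹ with ha
  have ha0 : 0 < a := inv_pos.2 hsp
  have ha1 : a ≤ 1 := inv_le_one_of_one_le₀ (Real.one_le_sqrt.2 (by exact_mod_cast ht))
  have ha2 : a ^ 2 = (t : ℝ)⁻¹ := by rw [ha, inv_pow, hsq]
  set κ := (t ^ m * Real.sqrt t * ((m + 1)! : ℝ))⁻¹ with hκ
  set Y : Ω → Fin l → ℝ := fun ω => a • compensated t Λ h (η ω)
  set R : Ω → Fin l → ℝ := fun ω i => κ * remainder t Λ (f i) (η ω)
  have hfin := hη.finite
  have hdec : ∀ ω, (fun i => κ * (pointSum (m + 1) (f i) (η ω) - t ^ (m + 1) * meanVal Λ (f i))) =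
      Y ω + R ω := fun ω => by
    funext i
    have e1 : ∫ x, h i x ∂η ω = (m ! : ℝ)⁻¹ * pointSum 1 (firstProj Λ (f i)) (η ω) := by
      rw [← pointSum_one (hη.integer_valued ω) (u := h i), pointSum_one (hη.integer_valued ω),
        integral_const_mul, ← pointSum_one (hη.integer_valued ω)]
      rfl
    have e2 : ∫ x, h i x ∂Λ = (m ! : ℝ)⁻¹ * meanVal Λ (f i) := by
      rw [integral_const_mul, meanVal_succ Λ (hf i).integrable]
    have e3 : κ * ((m + 1) * t ^ m) = a * (m ! : ℝ)⁻¹ := by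
      rw [hκ, ha, Nat.factorial_succ]
      have : (m ! : ℝ) ≠ 0 := by positivity
      push_cast
      field_simp
    simp only [Pi.add_apply, Y, R, Pi.smul_apply, smul_eq_mul, compensated, remainder, e1, e2]
    linear_combination (pointSum 1 (firstProj Λ (f i)) (η ω) - t * meanVal Λ (f i)) * e3
  have hYm : Measurable Y := (hη.measurable_compensated hm).const_smul a
  have hRm : Measurable R := measurable_pi_lambda _ fun i =>
    ((measurable_remainder t (hf i).measurable (hf i).firstProj.measurable).comp
      hη.measurable).const_mul κ
  have hY2 : ∀ i, MemLp (fun ω => Y ω i) 2 P := fun i => (hη.memLp_compensated hm h2 i).const_mul a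
  have hR2 : ∀ i, MemLp (fun ω => R ω i) 2 P := fun i => (hη.memLp_remainder ht (hf i)).const_mul κ
  have hR0 : ∀ i, ∫ ω, R ω i ∂P = 0 := fun i => by
    simp only [R]
    rw [integral_const_mul, hη.integral_remainder ht (hf i), mul_zero]
  -- the weight `a = 1 / √t` balances `∫ |Y|² = O(1)` against `∫ |R|² = O(1 / t)`
  have hpert := abs_integral_add_sub_le hYm.aemeasurable hRm.aemeasurable hY2 hR2 hR0 ha0 hg
  have bY : ∫ ω, norm1 (Y ω) ^ 2 ∂P ≤ l * S := by
    refine (integrable_sq_norm1 hY2).2.trans_eq ?_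
    congr 1
    refine Finset.sum_congr rfl fun i _ => ?_
    have e : ∀ ω, Y ω i ^ 2 = a ^ 2 * (compensated t Λ h (η ω) i * compensated t Λ h (η ω) i) :=
      fun ω => by simp only [Y, Pi.smul_apply, smul_eq_mul]; ring
    simp only [e]
    rw [integral_const_mul, hη.integral_compensated_mul hm h2, ha2, ← mul_assoc,
      inv_mul_cancel₀ ht0.ne', one_mul]
  have hκ2 : κ ^ 2 * t ^ (2 * m) ≤ a ^ 2 := by
    have h1 : (1 : ℝ) ≤ ((m + 1)! : ℝ) := by exact_mod_cast Nat.factorial_pos _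
    have e : κ ^ 2 * t ^ (2 * m) = a ^ 2 * ((((m + 1)! : ℝ))⁻¹) ^ 2 := by
      rw [hκ, ha]
      field_simp
      ring
    rw [e]
    exact mul_le_of_le_one_right (sq_nonneg _) (pow_le_one₀ (by positivity)
      (inv_le_one_of_one_le₀ h1))
  have bR : ∫ ω, norm1 (R ω) ^ 2 ∂P ≤ a ^ 2 * (l * ∑ i, D i) := by
    refine (integrable_sq_norm1 hR2).2.trans ?_
    rw [mul_left_comm, Finset.mul_sum Finset.univ D]
    refine mul_le_mul_of_nonneg_left (Finset.sum_le_sum fun i _ => ?_) (Nat.cast_nonneg l)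
    simp only [R, mul_pow]
    rw [integral_const_mul]
    calc κ ^ 2 * ∫ ω, remainder t Λ (f i) (η ω) ^ 2 ∂P ≤ κ ^ 2 * (D i * t ^ (2 * m)) :=
          mul_le_mul_of_nonneg_left (hD i ht hη) (sq_nonneg _)
      _ = κ ^ 2 * t ^ (2 * m) * D i := by ring
      _ ≤ a ^ 2 * D i := mul_le_mul_of_nonneg_right hκ2 (hD0 i)
  simp only [hdec]
  have hl := hlin ht hη hg
  refine (abs_sub_le _ (∫ ω, g (Y ω) ∂P) _).trans ?_
  have hD' : 0 ≤ l * ∑ i, D i := by positivity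
  calc _ ≤ (a * (l * S) + (1 / a + 1) * (a ^ 2 * (l * ∑ i, D i))) + C₁ * a := by
        refine add_le_add (hpert.trans ?_) hl
        gcongr
    _ = C₁ * a + a * (l * S) + (a + a ^ 2) * (l * ∑ i, D i) := by
        field_simp
        ring
    _ ≤ C₁ * a + a * (l * S) + (a + a) * (l * ∑ i, D i) := by
        gcongr
        nlinarith
    _ = _ := by ring

end CLT

/-! ### The Borel `σ`-field of the Fell topology -/

section Fell

variable {d k : ℕ}

/-- A countable family of closed balls whose interiors form a basis of the topology of `ℝ^d`. -/
def basicBall (d : ℕ) (p : ℕ × ℚ) : Set (Euc d) :=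
  Metric.closedBall (denseSeq (Euc d) p.1) (p.2 : ℝ)

lemma isCompact_basicBall (p : ℕ × ℚ) : IsCompact (basicBall d p) := isCompact_closedBall _ _

lemma exists_basicBall {x : Euc d} {U : Set (Euc d)} (hU : IsOpen U) (hx : x ∈ U) :
    ∃ p : ℕ × ℚ, x ∈ Metric.ball (denseSeq (Euc d) p.1) (p.2 : ℝ) ∧ basicBall d p ⊆ U := by
  obtain ⟨ε, hε, hεU⟩ := Metric.isOpen_iff.1 hU x hx
  obtain ⟨q, hq0, hq⟩ := exists_rat_btwn (half_pos hε)
  obtain ⟨n, hn⟩ := (denseRange_denseSeq (Euc d)).exists_dist_lt x hq0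
  refine ⟨(n, q), hn, fun y hy => hεU ?_⟩
  have hy' : dist y (denseSeq (Euc d) n) ≤ q := hy
  rw [Metric.mem_ball]
  calc dist y x ≤ dist y (denseSeq (Euc d) n) + dist (denseSeq (Euc d) n) x := dist_triangle _ _ _
    _ < ε := by rw [dist_comm _ x]; linarith

/-- A compact set is covered by the interiors of finitely many basic balls, each inside one of
given open sets. -/
lemma exists_finset_basicBall {C : Set (Euc d)} (hC : IsCompact C) {ι : Type*} {U : ι → Set (Euc d)}
    (hU : ∀ i, IsOpen (U i)) (hCU : ∀ x ∈ C, ∃ i, x ∈ U i) :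
    ∃ T : Finset (ℕ × ℚ), C ⊆ ⋃ p ∈ T, basicBall d p ∧ ∀ p ∈ T, ∃ i, basicBall d p ⊆ U i := by
  classical
  have h : ∀ x : C, ∃ p : ℕ × ℚ, (x : Euc d) ∈ Metric.ball (denseSeq (Euc d) p.1) (p.2 : ℝ) ∧
      ∃ i, basicBall d p ⊆ U i := fun x => by
    obtain ⟨i, hi⟩ := hCU x x.2
    obtain ⟨p, hp, hpU⟩ := exists_basicBall (hU i) hi
    exact ⟨p, hp, i, hpU⟩
  choose p hp hpU using h
  obtain ⟨t, ht⟩ := hC.elim_finite_subcover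
    (fun x : C => Metric.ball (denseSeq (Euc d) (p x).1) ((p x).2 : ℝ)) (fun _ => Metric.isOpen_ball)
    fun x hx => Set.mem_iUnion.2 ⟨⟨x, hx⟩, hp ⟨x, hx⟩⟩
  refine ⟨t.image p, fun x hx => ?_, fun q hq => ?_⟩
  · obtain ⟨y, hy, hxy⟩ := Set.mem_iUnion₂.1 (ht hx)
    exact Set.mem_iUnion₂.2 ⟨p y, Finset.mem_image_of_mem p hy, Metric.ball_subset_closedBall hxy⟩
  · obtain ⟨y, -, rfl⟩ := Finset.mem_image.1 hq
    exact hpU y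

/-- A countable subbasis of the Fell topology. -/
def fellSubbasis (d : ℕ) : Set (Set (Closeds (Euc d))) :=
  Set.range (fun T : Finset (ℕ × ℚ) =>
      {F : Closeds (Euc d) | (F : Set (Euc d)) ∩ ⋃ p ∈ T, basicBall d p = ∅}) ∪
    Set.range fun p : ℕ × ℚ =>
      {F : Closeds (Euc d) |
        ((F : Set (Euc d)) ∩ Metric.ball (denseSeq (Euc d) p.1) (p.2 : ℝ)).Nonempty}

lemma fellTopology_eq : fellTopology (Euc d) = generateFrom (fellSubbasis d) := by
  refine le_antisymm (le_generateFrom ?_) (le_generateFrom ?_)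
  · rintro s (⟨T, rfl⟩ | ⟨p, rfl⟩)
    · exact isOpen_generateFrom_of_mem (Or.inl ⟨_, T.finite_toSet.isCompact_biUnion
        fun p _ => isCompact_basicBall p, rfl⟩)
    · exact isOpen_generateFrom_of_mem (Or.inr ⟨_, Metric.isOpen_ball, rfl⟩)
  · let := generateFrom (fellSubbasis d)
    rintro s (⟨K, hK, rfl⟩ | ⟨G, hG, rfl⟩)
    · have : {F : Closeds (Euc d) | (F : Set (Euc d)) ∩ K = ∅} =
          ⋃ T ∈ {T : Finset (ℕ × ℚ) | K ⊆ ⋃ p ∈ T, basicBall d p},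
            {F : Closeds (Euc d) | (F : Set (Euc d)) ∩ ⋃ p ∈ T, basicBall d p = ∅} := by
        ext F
        simp only [Set.mem_ofPred_eq, Set.mem_iUnion, exists_prop]
        constructor
        · intro hF
          obtain ⟨T, hT, hTF⟩ := exists_finset_basicBall hK (U := fun _ : Unit => (F : Set (Euc d))ᶜ)
            (fun _ => F.isClosed.isOpen_compl) fun x hx => ⟨(), fun hxF => by
              have : x ∈ (F : Set (Euc d)) ∩ K := ⟨hxF, hx⟩
              rwa [hF] at this⟩
          refine ⟨T, hT, ?_⟩
          rw [Set.eq_empty_iff_forall_notMem]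
          rintro x ⟨hxF, hx⟩
          obtain ⟨p, hp, hxp⟩ := Set.mem_iUnion₂.1 hx
          obtain ⟨-, h⟩ := hTF p hp
          exact h hxp hxF
        · rintro ⟨T, hT, hF⟩
          exact Set.subset_empty_iff.1 ((Set.inter_subset_inter_right _ hT).trans hF.subset)
      rw [this]
      exact isOpen_biUnion fun T _ => isOpen_generateFrom_of_mem (Or.inl ⟨T, rfl⟩)
    · have : {F : Closeds (Euc d) | ((F : Set (Euc d)) ∩ G).Nonempty} =
          ⋃ p ∈ {p : ℕ × ℚ | basicBall d p ⊆ G}, {F : Closeds (Euc d) |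
            ((F : Set (Euc d)) ∩ Metric.ball (denseSeq (Euc d) p.1) (p.2 : ℝ)).Nonempty} := by
        ext F
        simp only [Set.mem_ofPred_eq, Set.mem_iUnion, exists_prop]
        constructor
        · rintro ⟨x, hxF, hxG⟩
          obtain ⟨p, hp, hpG⟩ := exists_basicBall hG hxG
          exact ⟨p, hpG, x, hxF, hp⟩
        · rintro ⟨p, hpG, x, hxF, hxp⟩
          exact ⟨x, hxF, hpG (Metric.ball_subset_closedBall hxp)⟩
      rw [this]
      exact isOpen_biUnion fun p _ => isOpen_generateFrom_of_mem (Or.inr ⟨p, rfl⟩)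

lemma countable_fellSubbasis : (fellSubbasis d).Countable :=
  (Set.countable_range _).union (Set.countable_range _)

lemma fellBorel_eq : fellBorel (Euc d) = MeasurableSpace.generateFrom (fellSubbasis d) := by
  let := fellTopology (Euc d)
  have : SecondCountableTopology (Closeds (Euc d)) :=
    ⟨⟨fellSubbasis d, countable_fellSubbasis, fellTopology_eq⟩⟩
  exact borel_eq_generateFrom_of_subbasis fellTopology_eq

/-- A map into the closed sets is measurable if the preimages of the families of sets that miss a
compact set are. -/
lemma measurable_fell {Y : Type*} [MeasurableSpace Y] {F : Y → Closeds (Euc d)}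
    (hF : ∀ K : Set (Euc d), IsCompact K → MeasurableSet {y | (F y : Set (Euc d)) ∩ K = ∅}) :
    @Measurable _ _ _ (fellBorel (Euc d)) F := by
  rw [fellBorel_eq]
  refine @measurable_generateFrom _ _ _ _ _ ?_
  rintro s (⟨T, rfl⟩ | ⟨p, rfl⟩)
  · exact hF _ (T.finite_toSet.isCompact_biUnion fun p _ => isCompact_basicBall p)
  · have : F ⁻¹' {F : Closeds (Euc d) |
        ((F : Set (Euc d)) ∩ Metric.ball (denseSeq (Euc d) p.1) (p.2 : ℝ)).Nonempty} =
        ⋃ q ∈ {q : ℕ × ℚ | basicBall d q ⊆ Metric.ball (denseSeq (Euc d) p.1) (p.2 : ℝ)},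
          {y | (F y : Set (Euc d)) ∩ basicBall d q = ∅}ᶜ := by
      ext y
      simp only [Set.mem_preimage, Set.mem_ofPred_eq, Set.mem_iUnion, exists_prop, Set.mem_compl_iff,
        ← Set.nonempty_iff_ne_empty, ← ne_eq]
      constructor
      · rintro ⟨x, hxF, hxG⟩
        obtain ⟨q, hq, hqG⟩ := exists_basicBall Metric.isOpen_ball hxG
        exact ⟨q, hqG, x, hxF, Metric.ball_subset_closedBall hq⟩
      · rintro ⟨q, hqG, x, hxF, hxq⟩
        exact ⟨x, hxF, hqG hxq⟩
    rw [this]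
    exact MeasurableSet.biUnion (Set.to_countable _) fun q _ => (hF _ (isCompact_basicBall q)).compl

lemma measurable_compacts {Y : Type*} [MeasurableSpace Y] {F : Y → Compacts (Euc d)}
    (hF : ∀ K : Set (Euc d), IsCompact K → MeasurableSet {y | (F y : Set (Euc d)) ∩ K = ∅}) :
    Measurable F := by
  have h := measurable_fell (F := fun y => (⟨(F y : Set (Euc d)), (F y).isCompact.isClosed⟩ :
    Closeds (Euc d))) hF
  rintro s ⟨s', hs', rfl⟩
  exact h hs'

lemma measurable_flat {Y : Type*} [MeasurableSpace Y] {F : Y → Flat d k}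
    (hF : ∀ K : Set (Euc d), IsCompact K → MeasurableSet {y | ((F y).1 : Set (Euc d)) ∩ K = ∅}) :
    Measurable F := by
  have h := measurable_fell (F := fun y => (F y).toCloseds) hF
  rintro s ⟨s', hs', rfl⟩
  exact h hs'

lemma measurableSet_fell_inter_eq_empty {K : Set (Euc d)} (hK : IsCompact K) :
    MeasurableSet[fellBorel (Euc d)] {F : Closeds (Euc d) | (F : Set (Euc d)) ∩ K = ∅} :=
  letI := fellTopology (Euc d)
  MeasurableSpace.measurableSet_generateFrom (isOpen_generateFrom_of_mem (Or.inl ⟨K, hK, rfl⟩))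

lemma measurableSet_flat_inter_eq_empty {K : Set (Euc d)} (hK : IsCompact K) :
    MeasurableSet {E : Flat d k | (E.1 : Set (Euc d)) ∩ K = ∅} :=
  ⟨_, measurableSet_fell_inter_eq_empty hK, rfl⟩

lemma measurableSet_grass_inter_eq_empty {K : Set (Euc d)} (hK : IsCompact K) :
    MeasurableSet {L : Grass d k | (L.1 : Set (Euc d)) ∩ K = ∅} :=
  ⟨_, measurableSet_fell_inter_eq_empty hK, rfl⟩

instance : MeasurableSpace.CountablyGenerated (Flat d k) := by
  let := fellBorel (Euc d)
  have : MeasurableSpace.CountablyGenerated (Closeds (Euc d)) :=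
    ⟨⟨fellSubbasis d, countable_fellSubbasis, fellBorel_eq⟩⟩
  exact MeasurableSpace.CountablyGenerated.comap Flat.toCloseds

instance : MeasurableSpace.SeparatesPoints (Flat d k) := by
  refine ⟨fun E F h => ?_⟩
  have key : ∀ x, x ∈ F.1 → x ∈ E.1 := fun x hxF => by
    by_contra hxE
    have := h _ (measurableSet_flat_inter_eq_empty (isCompact_singleton (x := x)))
      (Set.eq_empty_iff_forall_notMem.2 fun y hy => hxE (by
        have h2 : y = x := hy.2
        rw [← h2]; exact hy.1))
    have h2 : x ∈ (F.1 : Set (Euc d)) ∩ {x} := ⟨hxF, rfl⟩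
    have h3 : (F.1 : Set (Euc d)) ∩ {x} = ∅ := this
    rwa [h3] at h2
  have hle : F.1 ≤ E.1 := key
  have hd : F.1.direction = E.1.direction :=
    Submodule.eq_of_le_of_finrank_eq (AffineSubspace.direction_le hle) (F.2.2.trans E.2.2.symm)
  obtain ⟨p, hp⟩ := F.2.1
  exact Subtype.ext (AffineSubspace.eq_of_direction_eq_of_nonempty_of_le hd F.2.1 hle).symm

instance : MeasurableSingletonClass (Flat d k) :=
  MeasurableSpace.measurableSingletonClass_of_countablySeparated

/-- Intersecting a fixed compact set with flats is measurable. -/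
lemma measurable_interFlats {n : ℕ} (B : Compacts (Euc d)) :
    Measurable fun E : Fin n → Flat d k => interFlats B E := by
  refine measurable_compacts fun K hK => ?_
  have : {E : Fin n → Flat d k | (interFlats B E : Set (Euc d)) ∩ K = ∅} =
      ⋃ T ∈ {T : Finset (ℕ × ℚ) | (B : Set (Euc d)) ∩ K ⊆ ⋃ p ∈ T, basicBall d p},
        ⋂ p ∈ T, ⋃ i, {E : Fin n → Flat d k | ((E i).1 : Set (Euc d)) ∩ basicBall d p = ∅} := by
    ext E
    simp only [Set.mem_ofPred_eq, Set.mem_iUnion, Set.mem_iInter, exists_prop]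
    have hE : ((interFlats B E : Compacts (Euc d)) : Set (Euc d)) =
      (B : Set (Euc d)) ∩ ⋂ i, ((E i).1 : Set (Euc d)) := rfl
    constructor
    · intro h
      obtain ⟨T, hT, hTE⟩ := exists_finset_basicBall (B.isCompact.inter hK)
        (U := fun i => ((E i).1 : Set (Euc d))ᶜ)
        (fun i => (E i).1.closed_of_finiteDimensional.isOpen_compl) fun x hx => by
          by_contra! hx'
          have : x ∈ ((interFlats B E : Compacts (Euc d)) : Set (Euc d)) ∩ K :=
            ⟨⟨hx.1, Set.mem_iInter.2 fun i => not_not.1 (hx' i)⟩, hx.2⟩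
          rwa [h] at this
      refine ⟨T, hT, fun p hp => ?_⟩
      obtain ⟨i, hi⟩ := hTE p hp
      exact ⟨i, Set.eq_empty_iff_forall_notMem.2 fun x hx => hi hx.2 hx.1⟩
    · rintro ⟨T, hT, hTE⟩
      rw [Set.eq_empty_iff_forall_notMem]
      rintro x ⟨hx, hxK⟩
      rw [hE] at hx
      obtain ⟨p, hp, hxp⟩ := Set.mem_iUnion₂.1 (hT ⟨hx.1, hxK⟩)
      obtain ⟨i, hi⟩ := hTE p hp
      have : x ∈ ((E i).1 : Set (Euc d)) ∩ basicBall d p := ⟨Set.mem_iInter.1 hx.2 i, hxp⟩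
      rwa [hi] at this
  rw [this]
  refine MeasurableSet.biUnion (Set.to_countable _) fun T _ => MeasurableSet.biInter
    (Set.to_countable _) fun p _ => MeasurableSet.iUnion fun i => ?_
  exact (measurableSet_flat_inter_eq_empty (isCompact_basicBall p)).preimage (measurable_pi_apply i)

end Fell

/-! ### The intensity measure of a stationary flat process -/

section Intensity

variable {d k : ℕ}

lemma mem_translate {L : Grass d k} {x y : Euc d} : y ∈ (L.translate x).1 ↔ y - x ∈ L.1 :=
  AffineSubspace.mem_mk'

/-- Translation of linear subspaces is jointly measurable. -/
lemma measurable_translate : Measurable fun p : Grass d k × Euc d => p.1.translate p.2 := by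
  refine measurable_flat fun K hK => ?_
  -- `L + y` misses `K` iff `L` misses a neighbourhood of `K - q` for some rational `q` close to `y`
  have : {p : Grass d k × Euc d | ((p.1.translate p.2).1 : Set (Euc d)) ∩ K = ∅} =
      ⋃ q : ℕ × ℚ, {L : Grass d k | (L.1 : Set (Euc d)) ∩
          ((fun z : Euc d × Euc d => z.1 + z.2) ''
            (K ×ˢ Metric.closedBall (-denseSeq (Euc d) q.1) (q.2 : ℝ))) = ∅} ×ˢ
        Metric.ball (denseSeq (Euc d) q.1) (q.2 : ℝ) := by
    ext ⟨L, y⟩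
    simp only [Set.mem_iUnion, Set.mem_prod]
    constructor
    · intro h
      have h' : ((L.translate y).1 : Set (Euc d)) ∩ K = ∅ := h
      have hdisj : Disjoint K ((L.translate y).1 : Set (Euc d)) := by
        rw [disjoint_comm, Set.disjoint_iff_inter_eq_empty, h']
      obtain ⟨δ, hδ, hd⟩ := hdisj.exists_thickenings hK (L.translate y).1.closed_of_finiteDimensional
      obtain ⟨s, hs0, hs⟩ := exists_rat_btwn (half_pos hδ)
      obtain ⟨n, hn⟩ := (denseRange_denseSeq (Euc d)).exists_dist_lt y hs0
      refine ⟨(n, s), Set.eq_empty_iff_forall_notMem.2 ?_, Metric.mem_ball.2 hn⟩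
      rintro _ ⟨hzL, ⟨a, b⟩, ⟨ha, hb⟩, rfl⟩
      have hab : a + b ∈ L.1 := hzL
      have hb' : dist b (-denseSeq (Euc d) n) ≤ s := hb
      have hby : ‖b + y‖ < δ := by
        rw [dist_eq_norm, sub_neg_eq_add] at hb'
        rw [dist_eq_norm] at hn
        calc ‖b + y‖ = ‖(b + denseSeq (Euc d) n) + (y - denseSeq (Euc d) n)‖ := by congr 1; abel
          _ ≤ ‖b + denseSeq (Euc d) n‖ + ‖y - denseSeq (Euc d) n‖ := norm_add_le _ _
          _ < δ := by
            have : ‖y - denseSeq (Euc d) n‖ < (s : ℝ) := hn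
            linarith
      have hmem : a + b + y ∈ ((L.translate y).1 : Set (Euc d)) := by
        change a + b + y ∈ (L.translate y).1
        rw [mem_translate, add_sub_cancel_right]
        exact hab
      have hnear : a + b + y ∈ Metric.thickening δ K := by
        rw [Metric.mem_thickening_iff]
        refine ⟨a, ha, ?_⟩
        rw [dist_eq_norm, add_assoc, add_sub_cancel_left]
        exact hby
      exact Set.disjoint_left.1 hd hnear (Metric.self_subset_thickening hδ _ hmem)
    · rintro ⟨⟨n, s⟩, hL, hy⟩
      have hL' : (L.1 : Set (Euc d)) ∩ ((fun z : Euc d × Euc d => z.1 + z.2) ''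
            (K ×ˢ Metric.closedBall (-denseSeq (Euc d) n) (s : ℝ))) = ∅ := hL
      refine Set.eq_empty_iff_forall_notMem.2 ?_
      rintro z ⟨hz, hzK⟩
      have hz' : z - y ∈ L.1 := mem_translate.1 hz
      have : z - y ∈ (L.1 : Set (Euc d)) ∩ ((fun z : Euc d × Euc d => z.1 + z.2) ''
            (K ×ˢ Metric.closedBall (-denseSeq (Euc d) n) (s : ℝ))) := by
        refine ⟨hz', ⟨z, -y⟩, ⟨hzK, ?_⟩, (sub_eq_add_neg z y).symm⟩
        change dist (-y) (-denseSeq (Euc d) n) ≤ s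
        rw [dist_neg_neg]
        exact (Metric.mem_ball.1 hy).le
      rwa [hL'] at this
  rw [this]
  refine MeasurableSet.iUnion fun q => MeasurableSet.prod ?_ measurableSet_ball
  exact measurableSet_grass_inter_eq_empty
    ((hK.prod (isCompact_closedBall _ _)).image (continuous_fst.add continuous_snd))

/-- The distance of a flat to the origin. -/
def flatDist (E : Flat d k) : ℝ := Metric.infDist 0 (E.1 : Set (Euc d))

lemma measurable_flatDist : Measurable (flatDist : Flat d k → ℝ) := by
  refine measurable_of_Iic fun a => ?_
  have : flatDist ⁻¹' Set.Iic a =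
      {E : Flat d k | (E.1 : Set (Euc d)) ∩ Metric.closedBall 0 a = ∅}ᶜ := by
    ext E
    change flatDist E ≤ a ↔ ¬ ((E.1 : Set (Euc d)) ∩ Metric.closedBall 0 a = ∅)
    rw [← ne_eq, ← Set.nonempty_iff_ne_empty]
    constructor
    · intro h
      obtain ⟨y, hy, hyE⟩ := E.1.closed_of_finiteDimensional.exists_infDist_eq_dist E.2.1 (0 : Euc d)
      exact ⟨y, hy, by rw [Metric.mem_closedBall, dist_comm, ← hyE]; exact h⟩
    · rintro ⟨y, hy, hya⟩
      exact (Metric.infDist_le_dist_of_mem hy).trans (by rw [dist_comm]; exact hya)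
  rw [this]
  exact (measurableSet_flat_inter_eq_empty (isCompact_closedBall _ _)).compl

lemma translate_add {L : Grass d k} {u : Euc d} (hu : u ∈ L.1) (v : Euc d) :
    L.translate (u + v) = L.translate v := by
  refine Subtype.ext (AffineSubspace.ext fun y => ?_)
  change y ∈ (L.translate (u + v)).1 ↔ y ∈ (L.translate v).1
  rw [mem_translate, mem_translate, sub_add_eq_sub_sub_swap]
  exact Submodule.sub_mem_iff_left _ hu

lemma flatDist_translate (L : Grass d k) (v : L.1ᗮ) : flatDist (L.translate (v : Euc d)) = ‖v‖ := by
  refine le_antisymm ?_ ((Metric.le_infDist (L.translate (v : Euc d)).2.1).2 fun y hy => ?_)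
  · refine (Metric.infDist_le_dist_of_mem (y := (v : Euc d)) ?_).trans ?_
    · change (v : Euc d) ∈ (L.translate (v : Euc d)).1
      rw [mem_translate, sub_self]
      exact zero_mem _
    · rw [dist_zero_left, Submodule.coe_norm]
  · have hy' : y - v ∈ L.1 := mem_translate.1 hy
    have h0 : inner ℝ (y - v) (v : Euc d) = 0 := v.2 _ hy'
    have h := norm_add_sq_eq_norm_sq_add_norm_sq_of_inner_eq_zero (y - v) (v : Euc d) h0
    rw [sub_add_cancel] at h
    rw [dist_zero_left, Submodule.coe_norm]
    nlinarith [norm_nonneg y, norm_nonneg (v : Euc d), norm_nonneg (y - (v : Euc d))]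

lemma measurePreserving_add_orthogonal (L : Submodule ℝ (Euc d)) :
    MeasurePreserving (fun p : L × Lᗮ => (p.1 : Euc d) + (p.2 : Euc d)) := by
  have h := (L.orthogonalDecomposition.symm.measurePreserving).comp
    (WithLp.volume_preserving_toLp L Lᗮ)
  convert h using 1
  ext p
  simp [Submodule.orthogonalDecomposition_symm_apply]

lemma lintegral_gaussian (V : Type*) [NormedAddCommGroup V] [InnerProductSpace ℝ V]
    [FiniteDimensional ℝ V] [MeasurableSpace V] [BorelSpace V] :
    ∫⁻ v : V, ENNReal.ofReal (Real.exp (-Real.pi * ‖v‖ ^ 2)) = 1 := by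
  have h := GaussianFourier.integral_rexp_neg_mul_sq_norm (V := V) Real.pi_pos
  rw [div_self Real.pi_pos.ne', Real.one_rpow] at h
  have hint : Integrable fun v : V => Real.exp (-Real.pi * ‖v‖ ^ 2) :=
    not_imp_comm.1 integral_undef (by rw [h]; exact one_ne_zero)
  rw [← ofReal_integral_eq_lintegral_ofReal hint (ae_of_all _ fun _ => (Real.exp_pos _).le), h,
    ENNReal.ofReal_one]

/-- The image of Lebesgue measure on `L^⊥` under `x ↦ L + x`. -/
def translates (L : Grass d k) : Measure (Flat d k) :=
  (volume : Measure L.1ᗮ).map fun x : L.1ᗮ => L.translate (x : Euc d)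

lemma measurable_translate_orthogonal (L : Grass d k) :
    Measurable fun x : L.1ᗮ => L.translate (x : Euc d) :=
  measurable_translate.comp (measurable_const.prodMk measurable_subtype_coe)

lemma lintegral_translates (L : Grass d k) {h : Flat d k → ℝ≥0∞} (hh : Measurable h) :
    ∫⁻ E, h E ∂translates L = ∫⁻ x : L.1ᗮ, h (L.translate (x : Euc d)) :=
  lintegral_map hh (measurable_translate_orthogonal L)

/-- An integral over `L^⊥` as an integral over the whole space, against a Gaussian weight in the
directions of `L`. -/
lemma lintegral_translates_eq (L : Grass d k) {h : Flat d k → ℝ≥0∞} (hh : Measurable h) :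
    ∫⁻ E, h E ∂translates L = ∫⁻ y : Euc d, h (L.translate y) *
      ENNReal.ofReal (Real.exp (Real.pi * flatDist (L.translate y) ^ 2 - Real.pi * ‖y‖ ^ 2)) := by
  have hmeas : Measurable fun y : Euc d => h (L.translate y) *
      ENNReal.ofReal (Real.exp (Real.pi * flatDist (L.translate y) ^ 2 - Real.pi * ‖y‖ ^ 2)) := by
    have ht : Measurable fun y : Euc d => L.translate y :=
      measurable_translate.comp (measurable_const.prodMk measurable_id)
    have hd := measurable_flatDist.comp ht
    exact (hh.comp ht).mul (ENNReal.measurable_ofReal.comp (Real.measurable_exp.comp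
      (((hd.pow_const 2).const_mul _).sub ((measurable_norm.pow_const 2).const_mul _))))
  rw [lintegral_translates L hh, ← (measurePreserving_add_orthogonal L.1).lintegral_comp hmeas]
  have hcongr : ∀ p : L.1 × L.1ᗮ, h (L.translate ((p.1 : Euc d) + (p.2 : Euc d))) *
      ENNReal.ofReal (Real.exp (Real.pi * flatDist (L.translate ((p.1 : Euc d) + (p.2 : Euc d))) ^ 2
        - Real.pi * ‖(p.1 : Euc d) + (p.2 : Euc d)‖ ^ 2)) =
      ENNReal.ofReal (Real.exp (-Real.pi * ‖p.1‖ ^ 2)) * h (L.translate (p.2 : Euc d)) := by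
    rintro ⟨u, v⟩
    have h0 : inner ℝ (u : Euc d) (v : Euc d) = 0 := v.2 _ u.2
    have hn := norm_add_sq_eq_norm_sq_add_norm_sq_of_inner_eq_zero (u : Euc d) (v : Euc d) h0
    rw [translate_add u.2, flatDist_translate, mul_comm]
    congr 3
    rw [pow_two ‖(u : Euc d) + (v : Euc d)‖, hn, Submodule.coe_norm, Submodule.coe_norm]
    ring
  rw [lintegral_congr hcongr]
  change _ = ∫⁻ p : L.1 × L.1ᗮ, _ ∂(volume.prod volume)
  rw [lintegral_prod_mul (f := fun u : L.1 => ENNReal.ofReal (Real.exp (-Real.pi * ‖u‖ ^ 2)))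
    (g := fun v : L.1ᗮ => h (L.translate (v : Euc d))), lintegral_gaussian, one_mul]
  · exact (ENNReal.measurable_ofReal.comp (Real.measurable_exp.comp
      ((measurable_norm.pow_const 2).const_mul _))).aemeasurable
  · exact (hh.comp (measurable_translate_orthogonal L)).aemeasurable

lemma measurable_translates : Measurable (translates : Grass d k → Measure (Flat d k)) := by
  refine Measure.measurable_of_measurable_coe _ fun s hs => ?_
  have h1 : ∀ L : Grass d k, translates L s = ∫⁻ y : Euc d, s.indicator 1 (L.translate y) *
      ENNReal.ofReal (Real.exp (Real.pi * flatDist (L.translate y) ^ 2 - Real.pi * ‖y‖ ^ 2)) :=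
    fun L => by
      rw [← lintegral_indicator_one hs, lintegral_translates_eq L (measurable_one.indicator hs)]
  simp only [h1]
  refine Measurable.lintegral_prod_right' (f := fun p : Grass d k × Euc d =>
    s.indicator (1 : Flat d k → ℝ≥0∞) (p.1.translate p.2) * ENNReal.ofReal (Real.exp
      (Real.pi * flatDist (p.1.translate p.2) ^ 2 - Real.pi * ‖p.2‖ ^ 2))) ?_
  have hd := measurable_flatDist.comp (measurable_translate (d := d) (k := k))
  exact ((measurable_one.indicator hs).comp measurable_translate).mul
    (ENNReal.measurable_ofReal.comp (Real.measurable_exp.comp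
      (((hd.pow_const 2).const_mul _).sub ((measurable_snd.norm.pow_const 2).const_mul _))))

lemma flatIntensity_one_apply (Q : Measure (Grass d k)) {s : Set (Flat d k)}
    (hs : MeasurableSet s) : flatIntensity 1 Q s = ∫⁻ L, translates L s ∂Q := by
  change ((1 : ℝ≥0) • Q.bind translates) s = _
  rw [one_smul, Measure.bind_apply hs measurable_translates.aemeasurable]

/-- The flats that hit a set. -/
def hitting (k : ℕ) (K : Set (Euc d)) : Set (Flat d k) :=
  {E | ((E.1 : Set (Euc d)) ∩ K).Nonempty}

lemma measurableSet_hitting {K : Set (Euc d)} (hK : IsCompact K) :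
    MeasurableSet (hitting k K) := by
  have : hitting k K = {E : Flat d k | (E.1 : Set (Euc d)) ∩ K = ∅}ᶜ := by
    ext E
    exact Set.nonempty_iff_ne_empty
  rw [this]
  exact (measurableSet_flat_inter_eq_empty hK).compl

lemma finrank_orthogonal_grass (L : Grass d k) : Module.finrank ℝ L.1ᗮ = d - k := by
  have h := L.1.finrank_add_finrank_orthogonal
  rw [finrank_euclideanSpace_fin, L.2] at h
  omega

lemma flatIntensity_hitting_lt_top (hk : k < d) (Q : Measure (Grass d k)) [IsFiniteMeasure Q]
    {K : Set (Euc d)} (hK : IsCompact K) : flatIntensity 1 Q (hitting k K) < ∞ := by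
  obtain ⟨R, hR⟩ := hK.isBounded.subset_closedBall 0
  rw [flatIntensity_one_apply Q (measurableSet_hitting hK)]
  set c : ℝ≥0∞ := ENNReal.ofReal R ^ (d - k) *
    ENNReal.ofReal (√Real.pi ^ (d - k) / Real.Gamma (((d - k : ℕ) : ℝ) / 2 + 1)) with hc
  have hle : ∀ L : Grass d k, translates L (hitting k K) ≤ c := fun L => by
    have : Nontrivial L.1ᗮ := Module.nontrivial_of_finrank_pos (R := ℝ) (by
      rw [finrank_orthogonal_grass]; omega)
    have h1 := InnerProductSpace.volume_closedBall (0 : L.1ᗮ) R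
    rw [finrank_orthogonal_grass] at h1
    rw [hc, ← h1, translates, Measure.map_apply (measurable_translate_orthogonal L)
      (measurableSet_hitting hK)]
    refine measure_mono ?_
    rintro x ⟨y, hy, hyK⟩
    rw [Metric.mem_closedBall, dist_zero_right, ← flatDist_translate]
    exact (Metric.infDist_le_dist_of_mem hy).trans (by
      rw [dist_comm]; exact Metric.mem_closedBall.1 (hR hyK))
  calc ∫⁻ L, translates L (hitting k K) ∂Q ≤ ∫⁻ _, c ∂Q := lintegral_mono hle
    _ = c * Q Set.univ := lintegral_const c
    _ < ∞ := ENNReal.mul_lt_top (ENNReal.mul_lt_top (ENNReal.pow_lt_top ENNReal.ofReal_lt_top)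
        ENNReal.ofReal_lt_top) (measure_lt_top Q _)

lemma sigmaFinite_flatIntensity (hk : k < d) (Q : Measure (Grass d k)) [IsFiniteMeasure Q] :
    SigmaFinite (flatIntensity 1 Q) := by
  refine ⟨⟨⟨fun n => hitting k (Metric.closedBall (0 : Euc d) n), fun _ => trivial, fun n =>
    flatIntensity_hitting_lt_top hk Q (isCompact_closedBall _ _), ?_⟩⟩⟩
  refine Set.eq_univ_of_forall fun E => Set.mem_iUnion.2 ?_
  obtain ⟨x, hx⟩ := E.2.1
  obtain ⟨n, hn⟩ := exists_nat_ge (dist x 0)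
  exact ⟨n, x, hx, hn⟩

/-! ### Scaling -/

/-- The flat `r E` for `r ≠ 0` (and `E` itself for `r = 0`). -/
def Flat.scale (r : ℝ) (E : Flat d k) : Flat d k :=
  if hr : r = 0 then E else
    ⟨E.1.map ((LinearEquiv.smulOfNeZero ℝ (Euc d) r hr).toLinearMap.toAffineMap), by
      rw [AffineSubspace.coe_map]
      exact E.2.1.image _, by
      rw [AffineSubspace.map_direction, LinearMap.toAffineMap_linear]
      exact (LinearEquiv.finrank_map_eq _ _).trans E.2.2⟩

lemma Flat.coe_scale {r : ℝ} (hr : r ≠ 0) (E : Flat d k) :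
    ((E.scale r).1 : Set (Euc d)) = (fun x => r • x) '' (E.1 : Set (Euc d)) := by
  have h : E.scale r = _ := dif_neg hr
  rw [h]
  rfl

lemma Flat.mem_scale {r : ℝ} (hr : r ≠ 0) {E : Flat d k} {x : Euc d} :
    x ∈ (E.scale r).1 ↔ r⁻¹ • x ∈ E.1 := by
  have : x ∈ ((E.scale r).1 : Set (Euc d)) ↔ r⁻¹ • x ∈ E.1 := by
    rw [Flat.coe_scale hr]
    constructor
    · rintro ⟨y, hy, rfl⟩
      rwa [inv_smul_smul₀ hr]
    · intro h
      exact ⟨r⁻¹ • x, h, smul_inv_smul₀ hr x⟩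
  exact this

lemma measurable_scale {r : ℝ} (hr : r ≠ 0) : Measurable (Flat.scale r : Flat d k → Flat d k) := by
  refine measurable_flat fun K hK => ?_
  have : {E : Flat d k | ((E.scale r).1 : Set (Euc d)) ∩ K = ∅} =
      {E : Flat d k | (E.1 : Set (Euc d)) ∩ ((fun x => r⁻¹ • x) '' K) = ∅} := by
    ext E
    change _ ∩ _ = _ ↔ _ ∩ _ = _
    simp only [Set.eq_empty_iff_forall_notMem, Set.mem_inter_iff, not_and]
    constructor
    · rintro h x hx ⟨y, hy, rfl⟩
      exact h y ((Flat.mem_scale hr).2 hx) hy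
    · intro h x hx hxK
      exact h _ ((Flat.mem_scale hr).1 hx) ⟨x, hxK, rfl⟩
  rw [this]
  exact measurableSet_flat_inter_eq_empty (hK.image (continuous_const_smul _))

lemma scale_translate {r : ℝ} (hr : r ≠ 0) (L : Grass d k) (x : Euc d) :
    (L.translate x).scale r = L.translate (r • x) := by
  refine Subtype.ext (AffineSubspace.ext fun y => ?_)
  change y ∈ ((L.translate x).scale r).1 ↔ y ∈ (L.translate (r • x)).1
  rw [Flat.mem_scale hr, mem_translate, mem_translate]
  have : y - r • x = r • (r⁻¹ • y - x) := by rw [smul_sub, smul_inv_smul₀ hr]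
  rw [this, Submodule.smul_mem_iff _ hr]

/-- The intensity measure is homogeneous of degree `d - k`. -/
lemma map_scale_flatIntensity {r : ℝ} (hr : 0 < r) (Q : Measure (Grass d k)) :
    (flatIntensity 1 Q).map (Flat.scale r⁻¹) = (r ^ (d - k)).toNNReal • flatIntensity 1 Q := by
  have hr' : r⁻¹ ≠ 0 := (inv_pos.2 hr).ne'
  have hmap : ∀ L : Grass d k, (translates L).map (Flat.scale r⁻¹) =
      (r ^ (d - k)).toNNReal • translates L := fun L => by
    rw [translates, Measure.map_map (measurable_scale hr') (measurable_translate_orthogonal L)]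
    have : (Flat.scale r⁻¹ ∘ fun x : L.1ᗮ => L.translate (x : Euc d)) =
        (fun x : L.1ᗮ => L.translate (x : Euc d)) ∘ fun x => r⁻¹ • x := by
      ext1 x
      exact scale_translate hr' L x
    rw [this, ← Measure.map_map (measurable_translate_orthogonal L) (measurable_const_smul _),
      Measure.map_addHaar_smul _ hr', finrank_orthogonal_grass, inv_pow, inv_inv,
      abs_of_pos (by positivity), Measure.map_smul]
    rfl
  ext s hs
  rw [Measure.map_apply (measurable_scale hr') hs,
    flatIntensity_one_apply Q (measurable_scale hr' hs), Measure.smul_apply,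
    flatIntensity_one_apply Q hs]
  have : ∀ L : Grass d k, translates L (Flat.scale r⁻¹ ⁻¹' s) =
      ((r ^ (d - k)).toNNReal : ℝ≥0∞) * translates L s := fun L => by
    rw [← Measure.map_apply (measurable_scale hr') hs, hmap]
    rfl
  rw [lintegral_congr this, lintegral_const_mul' _ _ ENNReal.coe_ne_top]
  rfl

end Intensity

/-! ### Restricting a Poisson process to a set of finite intensity -/

section Window

universe u

variable {X : Type u} [MeasurableSpace X]

/-- The image under `S` of the points of `μ` in `S⁻¹ W`, if there are only finitely many. -/
def windowed (S : X → X) (W : Set X) (μ : Measure X) : Measure X :=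
  open scoped Classical in if μ (S ⁻¹' W) < ∞ then (μ.restrict (S ⁻¹' W)).map S else 0

variable {S : X → X} {W : Set X}

lemma windowed_of_lt {μ : Measure X} (h : μ (S ⁻¹' W) < ∞) :
    windowed S W μ = (μ.restrict (S ⁻¹' W)).map S := if_pos h

lemma windowed_apply (hS : Measurable S) {μ : Measure X} (h : μ (S ⁻¹' W) < ∞) {B : Set X}
    (hB : MeasurableSet B) : windowed S W μ B = μ (S ⁻¹' (B ∩ W)) := by
  rw [windowed_of_lt h, Measure.map_apply hS hB, Measure.restrict_apply (hS hB), Set.preimage_inter]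

lemma measurable_windowed (hS : Measurable S) (hW : MeasurableSet W) :
    Measurable (windowed S W) := by
  classical
  have hm : MeasurableSet {μ : Measure X | μ (S ⁻¹' W) < ∞} :=
    measurableSet_lt (Measure.measurable_coe (hS hW)) measurable_const
  refine Measure.measurable_of_measurable_coe _ fun B hB => ?_
  have : (fun μ : Measure X => windowed S W μ B) =
      fun μ => if μ ∈ {μ : Measure X | μ (S ⁻¹' W) < ∞} then μ (S ⁻¹' (B ∩ W)) else 0 := by
    ext1 μ
    by_cases h : μ (S ⁻¹' W) < ∞
    · rw [windowed_apply hS h hB]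
      exact (if_pos h).symm
    · rw [windowed, if_neg h]
      exact (if_neg h).symm
  rw [this]
  exact Measurable.ite hm (Measure.measurable_coe (hS (hB.inter hW))) measurable_const

lemma isFiniteMeasure_windowed (μ : Measure X) :
    IsFiniteMeasure (windowed S W μ) := by
  unfold windowed
  split_ifs with h
  · have : IsFiniteMeasure (μ.restrict (S ⁻¹' W)) := ⟨by rwa [Measure.restrict_apply_univ]⟩
    infer_instance
  · infer_instance

lemma isIntegerValued_windowed (hS : Measurable S) (hW : MeasurableSet W) {μ : Measure X}
    (hμ : IsIntegerValued μ) : IsIntegerValued (windowed S W μ) := fun B hB => by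
  by_cases h : μ (S ⁻¹' W) < ∞
  · rw [windowed_apply hS h hB]
    exact hμ _ (hS (hB.inter hW))
  · rw [windowed, if_neg h]
    exact ⟨0, by simp⟩

variable {Ω : Type*} [MeasurableSpace Ω] {η : Ω → Measure X} {Λ : Measure X} {P : Measure Ω}

lemma IsPoissonProcess.ae_lt_top (hη : IsPoissonProcess η Λ P) {B : Set X} (hB : MeasurableSet B)
    (h : Λ B ≠ ∞) : ∀ᵐ ω ∂P, η ω B < ∞ := by
  have h1 : ∀ᵐ x ∂(P.map fun ω => η ω B), x < ∞ := by
    rw [hη.map_eval B hB h]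
    exact (ae_map_iff (by fun_prop) measurableSet_Iio).2
      (ae_of_all _ fun n => ENNReal.natCast_lt_top n)
  exact ae_of_ae_map (measurable_eval hη.measurable hB).aemeasurable h1

lemma IsPoissonProcess.windowed (hη : IsPoissonProcess η Λ P) (hS : Measurable S)
    (hW : MeasurableSet W) (h : Λ (S ⁻¹' W) ≠ ∞) :
    IsFinitePoisson (fun ω => windowed S W (η ω)) ((Λ.map S).restrict W) P := by
  have hae : ∀ B, MeasurableSet B →
      (fun ω => PoissonFlats.windowed S W (η ω) B) =ᵐ[P] fun ω => η ω (S ⁻¹' (B ∩ W)) :=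
    fun B hB => by
      filter_upwards [hη.ae_lt_top (hS hW) h] with ω hω using windowed_apply hS hω hB
  refine ⟨(measurable_windowed hS hW).comp hη.measurable, fun ω => isFiniteMeasure_windowed _,
    fun ω => isIntegerValued_windowed hS hW (hη.integer_valued ω), fun B hB => ?_,
    fun n B hB hdisj => ?_⟩
  · rw [Measure.map_congr (hae B hB), Measure.restrict_apply hB, Measure.map_apply hS (hB.inter hW)]
    exact hη.map_eval _ (hS (hB.inter hW))
      (measure_ne_top_of_subset (Set.preimage_mono Set.inter_subset_right) h)
  · refine (hη.indep n (fun i => S ⁻¹' (B i ∩ W)) (fun i => hS ((hB i).inter hW))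
      fun i j hij => ?_).congr fun i => (hae (B i) (hB i)).symm
    exact ((hdisj hij).mono Set.inter_subset_left Set.inter_subset_left).preimage S

omit [MeasurableSpace X] in
lemma isSymm_comp_right {m : ℕ} {f : (Fin m → X) → ℝ} (hf : IsSymm m f) (S : X → X) :
    IsSymm m fun z => f fun i => S (z i) := by
  have hsect : ∀ {m : ℕ} (f : (Fin (m + 1) → X) → ℝ) (x : X),
      sect (fun z => f fun i => S (z i)) x = fun z => sect f (S x) fun i => S (z i) := by
    intro m f x
    ext1 z
    change f _ = f _
    congr 1
    ext1 i
    refine Fin.cases rfl (fun j => rfl) i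
  induction m with
  | zero => trivial
  | succ m ih =>
    cases m with
    | zero => trivial
    | succ m =>
      refine ⟨fun x => ?_, fun x y => ?_⟩
      · rw [hsect]
        exact ih (hf.1 (S x))
      · rw [hsect, hsect, hsect, hsect, hf.2]

omit [MeasurableSpace X] in
lemma tupleSum_map {m : ℕ} (f : (Fin m → X) → ℝ) (S : X → X) (l : List X) :
    tupleSum m f (l.map S) = tupleSum m (fun z => f fun i => S (z i)) l := by
  induction m generalizing l with
  | zero =>
    rw [tupleSum_zero, tupleSum_zero]
    congr 1
    ext i
    exact i.elim0
  | succ m ih =>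
    induction l with
    | nil => rw [List.map_nil, tupleSum_nil, tupleSum_nil]
    | cons x l ihl =>
      rw [List.map_cons, tupleSum_cons, tupleSum_cons, ihl, ih]
      congr 3
      ext1 z
      change f _ = f _
      congr 1
      ext1 i
      exact (Fin.cases rfl (fun j => rfl) i)

lemma map_listMeasure (hS : Measurable S) (l : List X) :
    (listMeasure l).map S = listMeasure (l.map S) := by
  induction l with
  | nil => exact Measure.map_zero S
  | cons x l ih =>
    rw [listMeasure_cons, Measure.map_add _ _ hS, ih, Measure.map_dirac' hS, List.map_cons,
      listMeasure_cons]

/-- The integral of a function supported by `W^m` with respect to the factorial measure is a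
factorial sum over the finitely many points of the window. -/
lemma integral_factorialMeasure_eq_pointSum [MeasurableSingletonClass X]
    [MeasurableSpace.CountablySeparated X] (hS : Measurable S) (hW : MeasurableSet W)
    {μ : Measure X} [SigmaFinite μ] (hμ : IsIntegerValued μ) (hfin : μ (S ⁻¹' W) < ∞) {m : ℕ}
    {f : (Fin m → X) → ℝ} (hf : Measurable f) (hs : IsSymm m f)
    (h0 : ∀ z, (∃ i, z i ∉ W) → f z = 0) :
    Integrable (fun z => f fun i => S (z i)) (factorialMeasure m μ) ∧
      ∫ z, f (fun i => S (z i)) ∂(factorialMeasure m μ) = pointSum m f (windowed S W μ) := by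
  have : IsFiniteMeasure (μ.restrict (S ⁻¹' W)) := ⟨by rwa [Measure.restrict_apply_univ]⟩
  obtain ⟨l, hl⟩ := (hμ.restrict (hS hW)).exists_listMeasure
  have hr := factorialMeasure_restrict (hS hW) m μ hμ l hl
  have hm : Measurable fun z : Fin m → X => f fun i => S (z i) :=
    hf.comp (measurable_pi_lambda _ fun i => hS.comp (measurable_pi_apply i))
  have h0' : ∀ z, z ∉ (Set.univ.pi fun _ : Fin m => S ⁻¹' W) → f (fun i => S (z i)) = 0 :=
    fun z hz => h0 _ (by simpa [Set.mem_pi] using hz)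
  constructor
  · rw [← integrableOn_iff_integrable_of_support_subset
      (s := Set.univ.pi fun _ : Fin m => S ⁻¹' W)
      (fun z hz => by by_contra hz'; exact hz (h0' z hz')), IntegrableOn, hr]
    exact integrable_factorialList m hm l
  · rw [← setIntegral_eq_integral_of_forall_compl_eq_zero h0', hr,
      integral_factorialList hm (isSymm_comp_right hs S), windowed_of_lt hfin, hl,
      map_listMeasure hS, pointSum_listMeasure hs, tupleSum_map]

lemma restrict_pi_window [SigmaFinite Λ] {m : ℕ} :
    (Measure.pi fun _ : Fin m => Λ.restrict W) =
      (Measure.pi fun _ : Fin m => Λ).restrict (Set.univ.pi fun _ => W) :=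
  (Measure.restrict_pi_pi _ _).symm

lemma meanVal_restrict [SigmaFinite Λ] {m : ℕ} {f : (Fin m → X) → ℝ}
    (h0 : ∀ z, (∃ i, z i ∉ W) → f z = 0) :
    meanVal (Λ.restrict W) f = meanVal Λ f := by
  rw [meanVal, restrict_pi_window, setIntegral_eq_integral_of_forall_compl_eq_zero]
  · rfl
  · exact fun z hz => h0 _ (by simpa [Set.mem_pi] using hz)

/-- The power mean inequality for the exponents `1` and `3`. -/
lemma lintegral_pow_three_le {Y : Type*} [MeasurableSpace Y] (μ : Measure Y) {f : Y → ℝ≥0∞}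
    (hf : AEMeasurable f μ) :
    (∫⁻ y, f y ∂μ) ^ 3 ≤ μ Set.univ ^ 2 * ∫⁻ y, f y ^ 3 ∂μ := by
  have hpq : (3 / 2 : ℝ).HolderConjugate 3 := by
    rw [Real.holderConjugate_iff]; norm_num
  have h := ENNReal.lintegral_mul_le_Lp_mul_Lq μ hpq (f := fun _ => 1) (g := f)
    aemeasurable_const hf
  simp only [Pi.mul_apply, one_mul, ENNReal.one_rpow, lintegral_const] at h
  have h3 := pow_le_pow_left' h 3
  rw [mul_pow, ← ENNReal.rpow_natCast, ← ENNReal.rpow_natCast, ← ENNReal.rpow_natCast,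
    ← ENNReal.rpow_mul, ← ENNReal.rpow_mul] at h3
  norm_num at h3
  have e : ∀ y, f y ^ (3 : ℝ) = f y ^ 3 := fun y => by
    rw [← ENNReal.rpow_natCast]; norm_num
  simpa only [e] using h3

lemma memLp_three_meanVal_sect [IsFiniteMeasure Λ] {m : ℕ} {f : (Fin (m + 1) → X) → ℝ}
    (hf : Measurable f) (h3 : ∫⁻ z, ‖f z‖ₑ ^ 3 ∂(Measure.pi fun _ => Λ) < ∞) :
    MemLp (fun x => meanVal Λ (sect f x)) 3 Λ := by
  refine ⟨(stronglyMeasurable_meanVal_sect Λ hf).aestronglyMeasurable, ?_⟩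
  rw [eLpNorm_lt_top_iff_lintegral_rpow_enorm_lt_top (by norm_num) (by norm_num)]
  have e : ∀ a : ℝ≥0∞, a ^ (ENNReal.toReal 3) = a ^ 3 := fun a => by
    rw [← ENNReal.rpow_natCast]; norm_num
  simp only [e]
  set c := (Measure.pi fun _ : Fin m => Λ) Set.univ ^ 2 with hc
  calc ∫⁻ x, ‖meanVal Λ (sect f x)‖ₑ ^ 3 ∂Λ
      ≤ ∫⁻ x, c * ∫⁻ z, ‖sect f x z‖ₑ ^ 3 ∂(Measure.pi fun _ => Λ) ∂Λ :=
        lintegral_mono fun x => (pow_le_pow_left' (enorm_integral_le_lintegral_enorm _) 3).trans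
          (lintegral_pow_three_le _ (measurable_sect hf x).enorm.aemeasurable)
    _ = c * ∫⁻ z, ‖f z‖ₑ ^ 3 ∂(Measure.pi fun _ => Λ) := by
        rw [lintegral_const_mul', lintegral_pi_succ Λ (hf.enorm.pow_const 3)]
        · rfl
        · exact ENNReal.pow_ne_top (measure_ne_top _ _)
    _ < ∞ := ENNReal.mul_lt_top (ENNReal.pow_lt_top (measure_lt_top _ _)) h3

lemma isKernel_of_lintegral_pow_three [IsFiniteMeasure Λ] {m : ℕ} {f : (Fin m → X) → ℝ}
    (hf : Measurable f) (hs : IsSymm m f)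
    (h3 : ∫⁻ z, ‖f z‖ₑ ^ 3 ∂(Measure.pi fun _ => Λ) < ∞) : IsKernel Λ f := by
  refine ⟨hf, hs, ?_⟩
  have : MemLp f 3 (Measure.pi fun _ => Λ) := by
    refine ⟨hf.aestronglyMeasurable, ?_⟩
    rw [eLpNorm_lt_top_iff_lintegral_rpow_enorm_lt_top (by norm_num) (by norm_num)]
    have e : ∀ a : ℝ≥0∞, a ^ (ENNReal.toReal 3) = a ^ 3 := fun a => by
      rw [← ENNReal.rpow_natCast]; norm_num
    simpa only [e] using h3
  exact (this.mono_exponent (p := 2) (by norm_num)).integrable_sq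

end Window

/-! ### The distance `d₃` controls convergence in distribution -/

section ConvergenceInDistribution

variable {l : ℕ}

/-- A smooth function of one linear functional, with derivatives bounded by one, is a test function
up to a positive factor. -/
lemma exists_mul_comp_mem_testFunctions {h : ℝ → ℝ} (hh : ContDiff ℝ 3 h)
    (hb : ∀ n x, |iteratedDeriv n h x| ≤ 1) (u : (Fin l → ℝ) →L[ℝ] ℝ) :
    ∃ c : ℝ, 0 < c ∧ (fun x => c * h (u x)) ∈ testFunctions l := by
  set M : ℝ := 1 + ∑ i, |u (Pi.single i 1)| with hM
  have hM1 : 1 ≤ M := by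
    rw [hM]
    have := Finset.sum_nonneg fun (i : Fin l) (_ : i ∈ Finset.univ) => abs_nonneg (u (Pi.single i 1))
    linarith
  have hM0 : 0 < M := by linarith
  have huM : ∀ i, |u (Pi.single i 1)| ≤ M := fun i => by
    have := Finset.single_le_sum (f := fun i : Fin l => |u (Pi.single i 1)|)
      (fun i _ => abs_nonneg _) (Finset.mem_univ i)
    rw [hM]
    linarith
  have hc : ContDiff ℝ 3 fun x => h (u x) := hh.comp u.contDiff
  have key : ∀ (n : ℕ) (hn : n ≤ 3) (x : Fin l → ℝ) (v : Fin n → Fin l → ℝ)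
      (hv : ∀ j, |u (v j)| ≤ M),
      |iteratedFDeriv ℝ n (fun x => (M ^ 3)⁻¹ * h (u x)) x v| ≤ 1 := fun n hn x v hv => by
    have hn' : ((n : ℕ∞) : WithTop ℕ∞) ≤ 3 := by
      rw [show (3 : WithTop ℕ∞) = ((3 : ℕ) : ℕ∞) from rfl]
      exact_mod_cast hn
    have e1 : iteratedFDeriv ℝ n (fun x => (M ^ 3)⁻¹ * h (u x)) x =
        (M ^ 3)⁻¹ • iteratedFDeriv ℝ n (fun x => h (u x)) x :=
      iteratedFDeriv_const_smul_apply (a := (M ^ 3)⁻¹) (f := fun x => h (u x))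
        (hc.contDiffAt.of_le hn')
    have e2 : iteratedFDeriv ℝ n (fun x => h (u x)) x =
        (iteratedFDeriv ℝ n h (u x)).compContinuousLinearMap fun _ => u :=
      u.iteratedFDeriv_comp_right hh x hn'
    have h1 : |iteratedFDeriv ℝ n (fun x => h (u x)) x v| ≤ M ^ n := by
      rw [e2, ContinuousMultilinearMap.compContinuousLinearMap_apply]
      calc |iteratedFDeriv ℝ n h (u x) fun i => u (v i)|
          ≤ ‖iteratedFDeriv ℝ n h (u x)‖ * ∏ i, ‖u (v i)‖ :=
            (iteratedFDeriv ℝ n h (u x)).le_opNorm fun i => u (v i)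
        _ ≤ 1 * ∏ _i : Fin n, M := by
            rw [norm_iteratedFDeriv_eq_norm_iteratedDeriv]
            exact mul_le_mul (hb n (u x)) (Finset.prod_le_prod (fun i _ => norm_nonneg _)
              fun i _ => hv i) (Finset.prod_nonneg fun i _ => norm_nonneg _) zero_le_one
        _ = M ^ n := by rw [one_mul, Finset.prod_const, Finset.card_univ, Fintype.card_fin]
    rw [e1, smul_apply, smul_eq_mul, abs_mul,
      abs_of_pos (by positivity : (0 : ℝ) < (M ^ 3)⁻¹), inv_mul_le_one₀ (by positivity)]
    exact h1.trans (pow_le_pow_right₀ hM1 hn)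
  refine ⟨(M ^ 3)⁻¹, by positivity, contDiff_const.mul hc, fun i₁ i₂ x => ?_,
    fun i₁ i₂ i₃ x => ?_⟩
  · refine key 2 (by norm_num) x _ fun j => ?_
    fin_cases j
    exacts [huM i₁, huM i₂]
  · refine key 3 le_rfl x _ fun j => ?_
    fin_cases j
    exacts [huM i₁, huM i₂, huM i₃]

variable {Ω Ω' ι : Type*} [MeasurableSpace Ω] [MeasurableSpace Ω'] {P : Measure Ω}
  [IsProbabilityMeasure P] {P' : Measure Ω'} [IsProbabilityMeasure P'] {L : Filter ι}

lemma charFun_map_eq {Y : Ω → EuclideanSpace ℝ (Fin l)} (hY : AEMeasurable Y P)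
    (u : EuclideanSpace ℝ (Fin l)) :
    charFun (P.map Y) u = ((∫ ω, Real.cos (inner ℝ (Y ω) u) ∂P : ℝ) : ℂ) +
      ((∫ ω, Real.sin (inner ℝ (Y ω) u) ∂P : ℝ) : ℂ) * Complex.I := by
  have hi : AEStronglyMeasurable (fun ω => Complex.exp ((inner ℝ (Y ω) u : ℝ) * Complex.I)) P :=
    (Continuous.comp_aestronglyMeasurable (g := fun y : EuclideanSpace ℝ (Fin l) =>
      Complex.exp ((inner ℝ y u : ℝ) * Complex.I)) (by fun_prop) hY.aestronglyMeasurable)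
  have hint : Integrable (fun ω => Complex.exp ((inner ℝ (Y ω) u : ℝ) * Complex.I)) P :=
    (integrable_const (1 : ℝ)).mono' hi
      (ae_of_all _ fun ω => (Complex.norm_exp_ofReal_mul_I _).le)
  have hre : (∫ ω, Complex.exp ((inner ℝ (Y ω) u : ℝ) * Complex.I) ∂P).re =
      ∫ ω, Real.cos (inner ℝ (Y ω) u) ∂P :=
    (integral_re hint).symm.trans
      (integral_congr_ae (ae_of_all _ fun ω => Complex.exp_ofReal_mul_I_re _))
  have him : (∫ ω, Complex.exp ((inner ℝ (Y ω) u : ℝ) * Complex.I) ∂P).im =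
      ∫ ω, Real.sin (inner ℝ (Y ω) u) ∂P :=
    (integral_im hint).symm.trans
      (integral_congr_ae (ae_of_all _ fun ω => Complex.exp_ofReal_mul_I_im _))
  rw [charFun_apply, integral_map hY (by fun_prop), ← hre, ← him, Complex.re_add_im]

/-- Random vectors converge in distribution if the expectations of the test functions of the
distance `d₃` converge; these include the trigonometric functions, up to constant factors, so that
the characteristic functions converge. -/
lemma tendstoInDistribution_of_testFunctions [L.IsCountablyGenerated] {X : ι → Ω → Fin l → ℝ}
    {Z : Ω' → Fin l → ℝ} (hX : ∀ i, AEMeasurable (X i) P) (hZ : AEMeasurable Z P')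
    (h : ∀ g ∈ testFunctions l, Tendsto (fun i => ∫ ω, g (X i ω) ∂P) L (𝓝 (∫ ω, g (Z ω) ∂P'))) :
    TendstoInDistribution X L Z (fun _ => P) P' := by
  have hm : Measurable (WithLp.toLp 2 : (Fin l → ℝ) → EuclideanSpace ℝ (Fin l)) := by fun_prop
  have key : TendstoInDistribution (fun i ω => (WithLp.toLp 2 (X i ω) : EuclideanSpace ℝ (Fin l))) L
      (fun ω => WithLp.toLp 2 (Z ω)) (fun _ => P) P' := by
    refine ⟨fun i => hm.comp_aemeasurable (hX i), hm.comp_aemeasurable hZ,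
      tendsto_of_seq_tendsto fun s hs => ?_⟩
    refine ProbabilityMeasure.tendsto_of_tendsto_charFun fun u => ?_
    let v : (Fin l → ℝ) →L[ℝ] ℝ :=
      ((innerSL ℝ) u).comp (EuclideanSpace.equiv (Fin l) ℝ).symm.toContinuousLinearMap
    have hv : ∀ x : Fin l → ℝ,
        inner ℝ (WithLp.toLp 2 x : EuclideanSpace ℝ (Fin l)) u = v x := fun x =>
      real_inner_comm _ _
    have hlim : ∀ {w : ℝ → ℝ} (_ : ContDiff ℝ 3 w) (_ : ∀ n x, |iteratedDeriv n w x| ≤ 1),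
        Tendsto (fun n => ∫ ω, w (inner ℝ (WithLp.toLp 2 (X (s n) ω)) u) ∂P) atTop
          (𝓝 (∫ ω, w (inner ℝ (WithLp.toLp 2 (Z ω)) u) ∂P')) := fun {w} hh hb => by
      obtain ⟨c, hc, hcg⟩ := exists_mul_comp_mem_testFunctions hh hb v
      have h1 := ((h _ hcg).comp hs).const_mul c⁻¹
      simp only [hv]
      simp only [integral_const_mul, Function.comp_def] at h1
      simpa only [inv_mul_cancel_left₀ hc.ne'] using h1
    have hre := hlim Real.contDiff_cos Real.abs_iteratedDeriv_cos_le_one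
    have him := hlim Real.contDiff_sin Real.abs_iteratedDeriv_sin_le_one
    change Tendsto (fun n => charFun (P.map fun ω => WithLp.toLp 2 (X (s n) ω)) u) atTop
      (𝓝 (charFun (P'.map fun ω => WithLp.toLp 2 (Z ω)) u))
    have eX : ∀ n, charFun (P.map fun ω => WithLp.toLp 2 (X (s n) ω)) u = _ :=
      fun n => charFun_map_eq (hm.comp_aemeasurable (hX (s n))) u
    have eZ : charFun (P'.map fun ω => WithLp.toLp 2 (Z ω)) u = _ :=
      charFun_map_eq (hm.comp_aemeasurable hZ) u
    rw [eZ, funext eX]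
    exact (Filter.Tendsto.ofReal hre).add ((Filter.Tendsto.ofReal him).mul_const _)
  exact key.continuous_comp (g := fun y : EuclideanSpace ℝ (Fin l) => WithLp.ofLp y) (by fun_prop)

end ConvergenceInDistribution

/-! ### The limit field and the normalization -/

section Gaussian

lemma IsCentredGaussianField.hasGaussianLaw {T Ω : Type*} [MeasurableSpace Ω] {ξ : T → Ω → ℝ}
    {C : T → T → ℝ} {P : Measure Ω} (hξ : IsCentredGaussianField ξ C P) {l : ℕ} (B : Fin l → T) :
    HasGaussianLaw (fun ω i => ξ (B i) ω) P := by
  classical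
  exact (hξ.gaussian.hasGaussianLaw (Finset.univ.image B)).map_fun
    (ContinuousLinearMap.pi fun i => ContinuousLinearMap.proj
      (⟨B i, Finset.mem_image_of_mem B (Finset.mem_univ i)⟩ : Finset.univ.image B))

lemma IsCentredGaussianField.integral_mul {T Ω : Type*} [MeasurableSpace Ω] {ξ : T → Ω → ℝ}
    {C : T → T → ℝ} {P : Measure Ω} (hξ : IsCentredGaussianField ξ C P) (s t : T) :
    ∫ ω, ξ s ω * ξ t ω ∂P = C s t := by
  rw [← hξ.covariance_eq, covariance, hξ.integral_eq_zero, hξ.integral_eq_zero]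
  simp only [sub_zero]

/-- The powers of the scale and of the intensity `t = r^N` match. -/
lemma rpow_normalization {r : ℝ} (hr : 0 < r) (N n : ℕ) (α c : ℝ) :
    r ^ (-(((n + 1 : ℕ) : ℝ) - 1 / 2) * (N : ℝ) - α) * (r ^ α / c) =
      ((r ^ N) ^ n * Real.sqrt (r ^ N) * c)⁻¹ := by
  have h1 : (r ^ N) ^ n * Real.sqrt (r ^ N) = r ^ (((n : ℝ) + 1 / 2) * N) := by
    rw [Real.sqrt_eq_rpow, ← Real.rpow_natCast, ← Real.rpow_natCast, ← Real.rpow_mul hr.le,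
      ← Real.rpow_mul hr.le, ← Real.rpow_add hr]
    congr 1
    ring
  rw [h1, mul_inv, ← Real.rpow_neg hr.le, mul_div_assoc', ← Real.rpow_add hr, div_eq_mul_inv]
  congr 2
  push_cast
  ring

end Gaussian

/-! ### Functionals of intersections with flats -/

section Functional

variable {d k : ℕ}

/-- The kernel `(E₁, …, E_m) ↦ ψ(B ∩ E₁ ∩ … ∩ E_m)`. -/
def flatKernel (k m : ℕ) (ψ : Compacts (Euc d) → ℝ) (B : Compacts (Euc d)) :
    (Fin m → Flat d k) → ℝ := fun E => ψ (interFlats B E)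

lemma interFlats_cons {m : ℕ} (B : Compacts (Euc d)) (x : Flat d k) (E : Fin m → Flat d k) :
    interFlats B (Fin.cons x E : Fin (m + 1) → Flat d k) = interFlats (interAffine B x.1) E := by
  refine Compacts.ext (Set.ext fun y => ?_)
  change (y ∈ B ∧ y ∈ ⋂ i, _) ↔ ((y ∈ B ∧ y ∈ x.1) ∧ y ∈ ⋂ i, _)
  rw [Set.mem_iInter, Set.mem_iInter, Fin.forall_fin_succ, and_assoc]
  rfl

lemma sect_flatKernel {m : ℕ} (ψ : Compacts (Euc d) → ℝ) (B : Compacts (Euc d)) (x : Flat d k) :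
    sect (flatKernel k (m + 1) ψ B) x = flatKernel k m ψ (interAffine B x.1) :=
  funext fun E => congrArg ψ (interFlats_cons B x E)

lemma interAffine_right_comm (B : Compacts (Euc d)) (E F : AffineSubspace ℝ (Euc d)) :
    interAffine (interAffine B E) F = interAffine (interAffine B F) E :=
  Compacts.ext (Set.inter_right_comm (B : Set (Euc d)) E F)

lemma isSymm_flatKernel (m : ℕ) (ψ : Compacts (Euc d) → ℝ) (B : Compacts (Euc d)) :
    IsSymm m (flatKernel k m ψ B) := by
  induction m generalizing B with
  | zero => trivial
  | succ m ih =>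
    cases m with
    | zero => trivial
    | succ m =>
      refine ⟨fun x => ?_, fun x y => ?_⟩
      · rw [sect_flatKernel]
        exact ih _
      · simp only [sect_flatKernel]
        rw [interAffine_right_comm]

lemma dilate_one (B : Compacts (Euc d)) : dilate 1 B = B := by
  refine Compacts.ext ?_
  change (fun x : Euc d => (1 : ℝ) • x) '' (B : Set (Euc d)) = B
  simp

lemma mem_dilate {r : ℝ} (hr : r ≠ 0) {B : Compacts (Euc d)} {x : Euc d} :
    x ∈ dilate r B ↔ r⁻¹ • x ∈ B := by
  change x ∈ (fun x : Euc d => r • x) '' (B : Set (Euc d)) ↔ _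
  constructor
  · rintro ⟨y, hy, rfl⟩
    rwa [inv_smul_smul₀ hr]
  · intro h
    exact ⟨r⁻¹ • x, h, smul_inv_smul₀ hr x⟩

lemma interFlats_dilate {m : ℕ} {r : ℝ} (hr : r ≠ 0) (B : Compacts (Euc d))
    (E : Fin m → Flat d k) :
    interFlats (dilate r B) E = dilate r (interFlats B fun i => (E i).scale r⁻¹) := by
  refine Compacts.ext (Set.ext fun y => ?_)
  change (y ∈ dilate r B ∧ y ∈ ⋂ i, ((E i).1 : Set (Euc d))) ↔ y ∈ dilate r _
  rw [mem_dilate hr, mem_dilate hr]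
  change (r⁻¹ • y ∈ B ∧ y ∈ ⋂ i, ((E i).1 : Set (Euc d))) ↔
    (r⁻¹ • y ∈ B ∧ r⁻¹ • y ∈ ⋂ i, (((E i).scale r⁻¹).1 : Set (Euc d)))
  rw [Set.mem_iInter, Set.mem_iInter]
  refine and_congr_right fun _ => forall_congr' fun i => ?_
  change y ∈ (E i).1 ↔ r⁻¹ • y ∈ ((E i).scale r⁻¹).1
  rw [Flat.mem_scale (inv_ne_zero hr), inv_inv, smul_inv_smul₀ hr]

lemma flatKernel_eq_zero {m : ℕ} {ψ : Compacts (Euc d) → ℝ} (h0 : ψ ⊥ = 0) {B : Compacts (Euc d)}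
    {K : Set (Euc d)} (hB : (B : Set (Euc d)) ⊆ K) (E : Fin m → Flat d k)
    (hE : ∃ i, E i ∉ hitting k K) : flatKernel k m ψ B E = 0 := by
  obtain ⟨i, hi⟩ := hE
  have : interFlats B E = ⊥ := Compacts.ext (Set.eq_empty_iff_forall_notMem.2 fun y hy =>
    hi ⟨y, Set.mem_iInter.1 hy.2 i, hB hy.1⟩)
  rw [flatKernel, this, h0]

variable {C₀ : Set (Compacts (Euc d))}

lemma IsWindowFamily.inter_mem (hC₀ : IsWindowFamily C₀) {B : Compacts (Euc d)} (hB : B ∈ C₀)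
    (E : AffineSubspace ℝ (Euc d)) : interAffine B E ∈ C₀ := by
  have := hC₀.interAffine_mem B hB 1 one_pos E
  rwa [dilate_one] at this

lemma IsWindowFamily.interFlats_mem (hC₀ : IsWindowFamily C₀) {m : ℕ} {B : Compacts (Euc d)}
    (hB : B ∈ C₀) (E : Fin m → Flat d k) : interFlats B E ∈ C₀ := by
  induction m generalizing B with
  | zero =>
    have : interFlats B E = B := Compacts.ext (by
      change (B : Set (Euc d)) ∩ ⋂ i, _ = _
      rw [Set.iInter_of_empty, Set.inter_univ])
    rwa [this]
  | succ m ih =>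
    rw [← Fin.cons_self_tail E, interFlats_cons]
    exact ih (hC₀.inter_mem hB _) _

lemma IsWindowFamily.measurable_flatKernel (hC₀ : IsWindowFamily C₀) {m : ℕ}
    {ψ : Compacts (Euc d) → ℝ} (hψ : Measurable fun B : C₀ => ψ B) {B : Compacts (Euc d)}
    (hB : B ∈ C₀) : Measurable (flatKernel k m ψ B) :=
  hψ.comp ((measurable_interFlats B).subtype_mk (h := fun E => hC₀.interFlats_mem hB E))

variable (hk : k < d) {Q : Measure (Grass d k)} [IsProbabilityMeasure Q]
  {Ω : Type*} [MeasurableSpace Ω] {P : Measure Ω} {η : Ω → Measure (Flat d k)}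
  (hη : IsPoissonProcess η (flatIntensity 1 Q) P) {K : Set (Euc d)} (hK : IsCompact K)

include hk hη hK

lemma isFinitePoisson_windowed {r : ℝ} (hr : 0 < r) :
    IsFinitePoisson (fun ω => windowed (Flat.scale r⁻¹) (hitting k K) (η ω))
      ((r ^ (d - k)).toNNReal • (flatIntensity 1 Q).restrict (hitting k K)) P := by
  have hS := measurable_scale (d := d) (k := k) (inv_ne_zero hr.ne')
  have hW := measurableSet_hitting (k := k) hK
  rw [← Measure.restrict_smul, ← map_scale_flatIntensity hr Q]
  refine hη.windowed hS hW ?_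
  rw [← Measure.map_apply hS hW, map_scale_flatIntensity hr Q]
  exact (ENNReal.mul_lt_top ENNReal.coe_lt_top (flatIntensity_hitting_lt_top hk Q hK)).ne

/-- The flats that hit a window realize all finite intensities, after scaling. -/
lemma exists_isFinitePoisson (s : ℝ≥0) (hs : 0 < s) :
    ∃ η' : Ω → Measure (Flat d k),
      IsFinitePoisson η' (s • (flatIntensity 1 Q).restrict (hitting k K)) P := by
  have hs' : (0 : ℝ) < s := hs
  have hr : (0 : ℝ) < (s : ℝ) ^ (((d - k : ℕ) : ℝ)⁻¹) := Real.rpow_pos_of_pos hs' _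
  have h := isFinitePoisson_windowed hk hη hK hr
  rw [Real.rpow_inv_natCast_pow hs'.le (by omega), Real.toNNReal_coe] at h
  exact ⟨_, h⟩

variable (hC₀ : IsWindowFamily C₀) {m : ℕ} {ψ : Compacts (Euc d) → ℝ}
  (hψ : Measurable fun B : C₀ => ψ B) (h0 : ψ ⊥ = 0)

include hC₀ hψ h0

/-- By homogeneity, the functional of the window `rB` is a factorial sum of the scaled process. -/
lemma ae_zeta_dilate {α : ℝ}
    (hψ_hom : ∀ B ∈ C₀, ∀ r : ℝ, 0 < r → ψ (dilate r B) = r ^ α * ψ B)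
    {B : Compacts (Euc d)} (hB : B ∈ C₀) (hBK : (B : Set (Euc d)) ⊆ K) {r : ℝ} (hr : 0 < r) :
    ∀ᵐ ω ∂P, Integrable (fun E => ψ (interFlats (dilate r B) E)) (factorialMeasure m (η ω)) ∧
      zeta m ψ (η ω) (dilate r B) = r ^ α / (m ! : ℝ) *
        pointSum m (flatKernel k m ψ B) (windowed (Flat.scale r⁻¹) (hitting k K) (η ω)) := by
  have hS := measurable_scale (d := d) (k := k) (inv_ne_zero hr.ne')
  have hW := measurableSet_hitting (k := k) hK
  have hfin : flatIntensity 1 Q (Flat.scale r⁻¹ ⁻¹' hitting k K) ≠ ∞ := by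
    rw [← Measure.map_apply hS hW, map_scale_flatIntensity hr Q]
    exact (ENNReal.mul_lt_top ENNReal.coe_lt_top (flatIntensity_hitting_lt_top hk Q hK)).ne
  have e : (fun E : Fin m → Flat d k => ψ (interFlats (dilate r B) E)) =
      fun E => r ^ α * flatKernel k m ψ B fun i => (E i).scale r⁻¹ := by
    ext1 E
    rw [interFlats_dilate hr.ne', hψ_hom _ (hC₀.interFlats_mem hB _) r hr]
    rfl
  filter_upwards [hη.ae_lt_top (hS hW) hfin] with ω hω
  have := hη.sigmaFinite ω
  have h := integral_factorialMeasure_eq_pointSum hS hW (hη.integer_valued ω) hω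
    (hC₀.measurable_flatKernel hψ hB) (isSymm_flatKernel m ψ B)
    (flatKernel_eq_zero h0 hBK)
  refine ⟨by rw [e]; exact h.1.const_mul _, ?_⟩
  rw [zeta, e, integral_const_mul, h.2]
  ring

omit hη hK hψ hC₀ h0 in
lemma lintegral_flatKernel_restrict_lt_top {B : Compacts (Euc d)}
    (h3 : ∫⁻ E : Fin m → Flat d k, ‖ψ (interFlats B E)‖ₑ ^ 3
        ∂(Measure.pi fun _ => flatIntensity 1 Q) < ∞) :
    ∫⁻ E : Fin m → Flat d k, ‖flatKernel k m ψ B E‖ₑ ^ 3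
        ∂(Measure.pi fun _ => (flatIntensity 1 Q).restrict (hitting k K)) < ∞ := by
  have := sigmaFinite_flatIntensity hk Q
  rw [restrict_pi_window]
  exact (lintegral_mono' Measure.restrict_le_self le_rfl).trans_lt h3

omit hη hK hψ hC₀ in
/-- The covariance function of the limit field in terms of the one-point projections of the kernels
restricted to the window. -/
lemma covFun_eq {A B : Compacts (Euc d)} (hA : (A : Set (Euc d)) ⊆ K)
    (hB : (B : Set (Euc d)) ⊆ K) :
    covFun (m + 1) ψ (flatIntensity 1 Q) A B =
      ∫ x, ((m ! : ℝ)⁻¹ * meanVal ((flatIntensity 1 Q).restrict (hitting k K))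
          (sect (flatKernel k (m + 1) ψ A) x)) *
        ((m ! : ℝ)⁻¹ * meanVal ((flatIntensity 1 Q).restrict (hitting k K))
          (sect (flatKernel k (m + 1) ψ B) x)) ∂((flatIntensity 1 Q).restrict (hitting k K)) := by
  have := sigmaFinite_flatIntensity hk Q
  have hz : ∀ {A : Compacts (Euc d)} (_ : (A : Set (Euc d)) ⊆ K) (x : Flat d k),
      meanVal ((flatIntensity 1 Q).restrict (hitting k K)) (sect (flatKernel k (m + 1) ψ A) x) =
        meanVal (flatIntensity 1 Q) (sect (flatKernel k (m + 1) ψ A) x) := fun hA x =>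
    meanVal_restrict fun z ⟨i, hi⟩ => flatKernel_eq_zero h0 hA _ ⟨i.succ, by simpa using hi⟩
  simp only [hz hA, hz hB]
  rw [setIntegral_eq_integral_of_forall_compl_eq_zero]
  · rw [covFun, ← integral_const_mul]
    refine integral_congr_ae (ae_of_all _ fun x => ?_)
    change 1 / (m ! : ℝ) ^ 2 * (meanVal (flatIntensity 1 Q) (sect (flatKernel k (m + 1) ψ A) x) *
      meanVal (flatIntensity 1 Q) (sect (flatKernel k (m + 1) ψ B) x)) = _
    field_simp
  · intro x hx
    have : sect (flatKernel k (m + 1) ψ A) x = fun _ => 0 :=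
      funext fun z => flatKernel_eq_zero h0 hA _ ⟨0, by simpa using hx⟩
    rw [this, meanVal, integral_zero]
    ring

omit hη h0 in
lemma isKernel_flatKernel {B : Compacts (Euc d)} (hB : B ∈ C₀)
    (h3 : ∫⁻ E : Fin m → Flat d k, ‖ψ (interFlats B E)‖ₑ ^ 3
        ∂(Measure.pi fun _ => flatIntensity 1 Q) < ∞) :
    IsKernel ((flatIntensity 1 Q).restrict (hitting k K)) (flatKernel k m ψ B) := by
  have : IsFiniteMeasure ((flatIntensity 1 Q).restrict (hitting k K)) :=
    ⟨by rw [Measure.restrict_apply_univ]; exact flatIntensity_hitting_lt_top hk Q hK⟩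
  exact isKernel_of_lintegral_pow_three (hC₀.measurable_flatKernel hψ hB)
    (isSymm_flatKernel m ψ B) (lintegral_flatKernel_restrict_lt_top hk h3)

/-- The normalized functional in terms of the scaled process, whose intensity is
`t = r ^ (d - k)`. -/
lemma ae_zetaTilde [IsProbabilityMeasure P] {n : ℕ} {α : ℝ}
    (hψ_hom : ∀ B ∈ C₀, ∀ r : ℝ, 0 < r → ψ (dilate r B) = r ^ α * ψ B)
    {B : Compacts (Euc d)} (hB : B ∈ C₀) (hBK : (B : Set (Euc d)) ⊆ K)
    (h3 : ∫⁻ E : Fin (n + 1) → Flat d k, ‖ψ (interFlats B E)‖ₑ ^ 3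
        ∂(Measure.pi fun _ => flatIntensity 1 Q) < ∞)
    {r : ℝ} (hr : 1 ≤ r) :
    ∀ᵐ ω ∂P, zetaTilde (n + 1) α ψ η P r B ω =
      ((r ^ (d - k)) ^ n * Real.sqrt (r ^ (d - k)) * ((n + 1)! : ℝ))⁻¹ *
        (pointSum (n + 1) (flatKernel k (n + 1) ψ B)
            (windowed (Flat.scale r⁻¹) (hitting k K) (η ω)) -
          (r ^ (d - k)) ^ (n + 1) * meanVal ((flatIntensity 1 Q).restrict (hitting k K))
            (flatKernel k (n + 1) ψ B)) := by
  have : IsFiniteMeasure ((flatIntensity 1 Q).restrict (hitting k K)) :=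
    ⟨by rw [Measure.restrict_apply_univ]; exact flatIntensity_hitting_lt_top hk Q hK⟩
  have hr0 : 0 < r := one_pos.trans_le hr
  have hz := ae_zeta_dilate hk hη hK hC₀ (m := n + 1) hψ h0 hψ_hom hB hBK hr0
  have ht : 1 ≤ (r ^ (d - k)).toNNReal := by
    rw [Real.one_le_toNNReal]
    exact one_le_pow₀ hr
  have hmean := (isFinitePoisson_windowed hk hη hK hr0).integral_pointSum ht
    (isKernel_flatKernel hk hK hC₀ hψ hB h3)
  rw [Real.coe_toNNReal _ (by positivity)] at hmean
  have hE : ∫ ω, zeta (n + 1) ψ (η ω) (dilate r B) ∂P = r ^ α / ((n + 1)! : ℝ) *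
      ((r ^ (d - k)) ^ (n + 1) * meanVal ((flatIntensity 1 Q).restrict (hitting k K))
            (flatKernel k (n + 1) ψ B)) := by
    rw [integral_congr_ae (hz.mono fun ω hω => hω.2), integral_const_mul, hmean]
  filter_upwards [hz] with ω hω
  rw [zetaTilde, hE, hω.2, ← rpow_normalization hr0, Nat.cast_sub hk.le]
  ring

lemma aemeasurable_zetaTilde {α : ℝ}
    (hψ_hom : ∀ B ∈ C₀, ∀ r : ℝ, 0 < r → ψ (dilate r B) = r ^ α * ψ B)
    {B : Compacts (Euc d)} (hB : B ∈ C₀) (hBK : (B : Set (Euc d)) ⊆ K) {r : ℝ} (hr : 0 < r) :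
    AEMeasurable (zetaTilde m α ψ η P r B) P := by
  have hm : Measurable fun ω => r ^ α / (m ! : ℝ) *
      pointSum m (flatKernel k m ψ B) (windowed (Flat.scale r⁻¹) (hitting k K) (η ω)) :=
    ((measurable_pointSum (hC₀.measurable_flatKernel hψ hB)).comp
      (isFinitePoisson_windowed hk hη hK hr).measurable).const_mul _
  have hz : AEMeasurable (fun ω => zeta m ψ (η ω) (dilate r B)) P :=
    hm.aemeasurable.congr ((ae_zeta_dilate hk hη hK hC₀ hψ h0 hψ_hom hB hBK hr).mono
      fun ω hω => hω.2.symm)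
  exact (hz.sub_const _).const_mul _

omit hK in
/-- Normal approximation of the normalized functionals, tested against smooth functions. -/
theorem exists_abs_integral_zetaTilde_sub_le [IsProbabilityMeasure P] {n : ℕ} {α : ℝ}
    (hψ_hom : ∀ B ∈ C₀, ∀ r : ℝ, 0 < r → ψ (dilate r B) = r ^ α * ψ B)
    (h3 : ∀ B ∈ C₀, ∫⁻ E : Fin (n + 1) → Flat d k, ‖ψ (interFlats B E)‖ₑ ^ 3
        ∂(Measure.pi fun _ => flatIntensity 1 Q) < ∞)
    {Ω' : Type*} [MeasurableSpace Ω'] {P' : Measure Ω'} [IsProbabilityMeasure P']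
    {ξ : C₀ → Ω' → ℝ}
    (hξ : IsCentredGaussianField ξ (fun A B => covFun (n + 1) ψ (flatIntensity 1 Q) A B) P')
    {l : ℕ} (B : Fin l → C₀) :
    ∃ c : ℝ, 0 ≤ c ∧ ∀ r : ℝ, 1 ≤ r → ∀ g ∈ testFunctions l,
      |∫ ω, g (fun i => zetaTilde (n + 1) α ψ η P r (B i) ω) ∂P - ∫ ω, g (fun i => ξ (B i) ω) ∂P'|
        ≤ c * r ^ (-((d : ℝ) - (k : ℝ)) / 2) := by
  set K : Set (Euc d) := ⋃ i, ((B i : Compacts (Euc d)) : Set (Euc d)) with hKdef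
  have hK : IsCompact K := isCompact_iUnion fun i => (B i : Compacts (Euc d)).isCompact
  have hBK : ∀ i, ((B i : Compacts (Euc d)) : Set (Euc d)) ⊆ K := fun i =>
    Set.subset_iUnion (fun i => ((B i : Compacts (Euc d)) : Set (Euc d))) i
  have : IsFiniteMeasure ((flatIntensity 1 Q).restrict (hitting k K)) :=
    ⟨by rw [Measure.restrict_apply_univ]; exact flatIntensity_hitting_lt_top hk Q hK⟩
  obtain ⟨C, hC0, hC⟩ := exists_abs_integral_pointSum_sub_le
    (exists_isFinitePoisson hk hη hK) (m := n)
    (f := fun i => flatKernel k (n + 1) ψ (B i))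
    (fun i => isKernel_flatKernel hk hK hC₀ hψ (B i).2 (h3 _ (B i).2))
    (fun i => memLp_three_meanVal_sect (hC₀.measurable_flatKernel hψ (B i).2)
      (lintegral_flatKernel_restrict_lt_top hk (h3 _ (B i).2)))
    (hξ.hasGaussianLaw B) (fun i => hξ.integral_eq_zero (B i))
    (fun i j => (hξ.integral_mul (B i) (B j)).trans (covFun_eq hk h0 (hBK i) (hBK j)))
  refine ⟨C, hC0, fun r hr g hg => ?_⟩
  have hr0 : 0 < r := one_pos.trans_le hr
  have ht : 1 ≤ (r ^ (d - k)).toNNReal := by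
    rw [Real.one_le_toNNReal]
    exact one_le_pow₀ hr
  have h := hC ht (isFinitePoisson_windowed hk hη hK hr0) hg
  rw [Real.coe_toNNReal _ (by positivity)] at h
  have hae := ae_all_iff.2 fun i =>
    ae_zetaTilde hk hη hK hC₀ hψ h0 hψ_hom (B i).2 (hBK i) (h3 _ (B i).2) hr
  have e : ∫ ω, g (fun i => zetaTilde (n + 1) α ψ η P r (B i) ω) ∂P = _ :=
    integral_congr_ae (hae.mono fun ω hω => congrArg g (funext hω))
  have hs : (Real.sqrt (r ^ (d - k)))⁻¹ = r ^ (-((d : ℝ) - (k : ℝ)) / 2) := by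
    rw [Real.sqrt_eq_rpow, ← Real.rpow_natCast, ← Real.rpow_mul hr0.le, ← Real.rpow_neg hr0.le,
      Nat.cast_sub hk.le]
    congr 1
    ring
  rw [e, ← hs]
  exact h

end Functional

end

end PoissonFlats

theorem mainTheorem9 (d k m : ℕ) (hk : k < d) (hm : 1 ≤ m)
    -- the directional distribution and the stationary Poisson flat process of intensity one
    (Q : Measure (Grass d k)) [IsProbabilityMeasure Q]
    {Ω : Type*} [MeasurableSpace Ω] (P : Measure Ω) [IsProbabilityMeasure P]
    (η : Ω → Measure (Flat d k)) (hη : IsPoissonProcess η (flatIntensity 1 Q) P)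
    -- the family of windows and the functional
    (C₀ : Set (Compacts (Euc d))) (hC₀ : IsWindowFamily C₀)
    (ψ : Compacts (Euc d) → ℝ) (hψ : Measurable (fun B : C₀ => ψ B)) (hψ_empty : ψ ⊥ = 0)
    (hψ_int : ∀ B ∈ C₀,
      ∫⁻ E : Fin m → Flat d k, ‖ψ (interFlats B E)‖ₑ ^ 3
        ∂(Measure.pi fun _ => flatIntensity 1 Q) < ∞)
    (α : ℝ) (hψ_hom : ∀ B ∈ C₀, ∀ r : ℝ, 0 < r → ψ (dilate r B) = r ^ α * ψ B)
    -- the limit field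
    {Ω' : Type*} [MeasurableSpace Ω'] (P' : Measure Ω') [IsProbabilityMeasure P']
    (ξ : C₀ → Ω' → ℝ)
    (hξ : IsCentredGaussianField ξ (fun A B => covFun m ψ (flatIntensity 1 Q) A B) P') :
    -- the functionals are almost surely absolutely convergent and square integrable
    (∀ B ∈ C₀,
      (∀ᵐ ω ∂P, Integrable (fun E => ψ (interFlats B E)) (factorialMeasure m (η ω))) ∧
      MemLp (fun ω => zeta m ψ (η ω) B) 2 P) ∧
    -- the bound on the distance
    (∀ (l : ℕ) (B : Fin l → C₀), ∃ c : ℝ, ∀ r : ℝ, 1 ≤ r →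
      dist3 (fun ω i => zetaTilde m α ψ η P r (B i) ω) P (fun ω i => ξ (B i) ω) P' ≤
        ENNReal.ofReal (c * r ^ (-((d : ℝ) - (k : ℝ)) / 2))) ∧
    -- convergence of the finite-dimensional distributions
    (∀ (l : ℕ) (B : Fin l → C₀),
      TendstoInDistribution
        (fun (r : Set.Ioi (0 : ℝ)) ω i => zetaTilde m α ψ η P r (B i) ω) atTop
        (fun ω i => ξ (B i) ω) (fun _ => P) P') := by
  obtain ⟨n, rfl⟩ : ∃ n, m = n + 1 := ⟨m - 1, by omega⟩
  refine ⟨fun B hB => ?_, fun l B => ?_, fun l B => ?_⟩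
  -- square integrability is a statement about the flats that hit `B`, at the scale `r = 1`
  · have hK := B.isCompact
    have : IsFiniteMeasure ((flatIntensity 1 Q).restrict (hitting k (B : Set (Euc d)))) :=
      ⟨by rw [Measure.restrict_apply_univ]; exact flatIntensity_hitting_lt_top hk Q hK⟩
    have h := ae_zeta_dilate hk hη hK hC₀ (m := n + 1) hψ hψ_empty hψ_hom hB subset_rfl one_pos
    have hP := isFinitePoisson_windowed hk hη hK one_pos
    rw [dilate_one] at h
    refine ⟨h.mono fun ω hω => hω.1, ?_⟩
    have h2 := hP.memLp_pointSum (by rw [one_pow, Real.toNNReal_one])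
      (isKernel_flatKernel hk hK hC₀ hψ hB (hψ_int B hB))
    exact (h2.const_mul _).ae_eq (h.mono fun ω hω => hω.2.symm)
  · obtain ⟨c, -, hc⟩ := exists_abs_integral_zetaTilde_sub_le hk hη hC₀ hψ hψ_empty hψ_hom hψ_int
      hξ B
    exact ⟨c, fun r hr => iSup₂_le fun g hg => ENNReal.ofReal_le_ofReal (hc r hr g hg)⟩
  · obtain ⟨c, -, hc⟩ := exists_abs_integral_zetaTilde_sub_le hk hη hC₀ hψ hψ_empty hψ_hom hψ_int
      hξ B
    refine tendstoInDistribution_of_testFunctions (fun r => aemeasurable_pi_lambda _ fun i =>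
        aemeasurable_zetaTilde hk hη (B i : Compacts (Euc d)).isCompact hC₀ hψ hψ_empty hψ_hom
          (B i).2 subset_rfl r.2)
      (aemeasurable_pi_lambda _ fun i => hξ.gaussian.aemeasurable (B i)) fun g hg => ?_
    have hval : Tendsto (fun r : Set.Ioi (0 : ℝ) => (r : ℝ)) atTop atTop :=
      tendsto_comp_val_Ioi_atTop.2 tendsto_id
    have hd : 0 < ((d : ℝ) - (k : ℝ)) / 2 := by
      have : (k : ℝ) < d := by exact_mod_cast hk
      linarith
    have hlim : Tendsto (fun r : Set.Ioi (0 : ℝ) => c * (r : ℝ) ^ (-((d : ℝ) - (k : ℝ)) / 2)) atTop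
        (𝓝 0) := by
      have h1 := ((tendsto_rpow_neg_atTop hd).comp hval).const_mul c
      rw [mul_zero] at h1
      refine h1.congr fun r => ?_
      rw [Function.comp_apply, neg_div]
    rw [tendsto_iff_dist_tendsto_zero]
    refine squeeze_zero' (Eventually.of_forall fun r => dist_nonneg) ?_ hlim
    filter_upwards [hval.eventually_ge_atTop 1] with r hr
    rw [Real.dist_eq]
    exact hc r hr g hg
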